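/- A polygonal curve in $\mathbb{R}$ with $n$ (non-degenerate) segments is given by its vertices $p_0,\dots,p_n\in\mathbb{R}$ and is parameterized by arc length, $P:[0,\ell_P]\to\mathbb{R}$. For $\varepsilon>0$ and curves $P,Q$ in $\mathbb{R}$ with $n$ and $m$ segments, the free space diagram $D_\varepsilon(P,Q)$ is the rectangle $R=[0,\ell_P]\times[0,\ell_Q]$ in which a point $(r,t)$ is colored white if $|P(r)-Q(t)|\le\varepsilon$ and gray otherwise, together with the grid of vertical and horizontal lines through the parameters of the vertices of $P$ and of $Q$ (including the four sides of $R$), which divides $R$ into $n$ columns and $m$ rows, i.e. $mn$ cells. An $m\times n$ diagram $D_\varepsilon$ ($m,n\ge 1$, $\varepsilon>0$) is any rectangle $[0,a]\times[0,b]$ with such a grid ($n$ columns and $m$ rows of positive widths and heights) and a coloring in white and gray, such that the white part of each closed cell is the intersection of that cell with a slab $\{\lambda\le y-x\le\mu\}$ or $\{\lambda\le y+x\le\mu\}$, $\lambda,\mu\in\mathbb{R}$; the cell may be empty or full. The input consists of $m$, $n$, $\varepsilon$, the column widths and row heights, and for each cell the slope ($+1$ or $-1$) and the numbers $\lambda,\mu$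 of its slab. **Theorem.** There are a real RAM program and a constant $C$ such that for all $m,n\ge 1$ and every $m\times n$ diagram $D_\varepsilon$ the program, given $D_\varepsilon$, halts after at most $C\cdot mn\,2^k$ steps and outputs (the vertices of) two polygonal curves $P$ and $Q$ in $\mathbb{R}$ with $D_\varepsilon=D_\varepsilon(P,Q)$ if such curves exist, and otherwise reports that there are none. Here $k$ is the number of vertical and horizontal grid lines that do not meet the boundary of the white space relative to the rectangle, i.e. the set of points that are limits both of white points and of gray points of the rectangle. -/

import Mathlib

/-! ## Diagrams -/

/-- An `n` (columns) by `m` (rows) diagram: the rectangle `[0, ∑ width] × [0, ∑ height]`, subdivided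
by a grid with the given column widths and row heights, together with the set of its white points
(all other points are gray). -/
@[ext]
structure Diagram (n m : ℕ) where
  width : Fin n → ℝ
  height : Fin m → ℝ
  white : Set (ℝ × ℝ)

namespace Diagram

variable {n m : ℕ}

/-- Abscissa of the `i`-th vertical grid line. -/
def xPos (D : Diagram n m) (i : Fin (n + 1)) : ℝ := Fin.partialSum D.width i

/-- Ordinate of the `j`-th horizontal grid line. -/
def yPos (D : Diagram n m) (j : Fin (m + 1)) : ℝ := Fin.partialSum D.height j

/-- The whole rectangle. -/
def rect (D : Diagram n m) : Set (ℝ × ℝ) :=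
  Set.Icc 0 (D.xPos (Fin.last n)) ×ˢ Set.Icc 0 (D.yPos (Fin.last m))

/-- The (closed) cell in column `i` and row `j`. -/
def cell (D : Diagram n m) (i : Fin n) (j : Fin m) : Set (ℝ × ℝ) :=
  Set.Icc (D.xPos i.castSucc) (D.xPos i.succ) ×ˢ Set.Icc (D.yPos j.castSucc) (D.yPos j.succ)

/-- The `i`-th vertical grid line, a segment. -/
def vLine (D : Diagram n m) (i : Fin (n + 1)) : Set (ℝ × ℝ) :=
  {D.xPos i} ×ˢ Set.Icc 0 (D.yPos (Fin.last m))

/-- The `j`-th horizontal grid line, a segment. -/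
def hLine (D : Diagram n m) (j : Fin (m + 1)) : Set (ℝ × ℝ) :=
  Set.Icc 0 (D.xPos (Fin.last n)) ×ˢ {D.yPos j}

/-- The boundary between white and gray: the boundary of the white space relative to the
rectangle. -/
def whiteBoundary (D : Diagram n m) : Set (ℝ × ℝ) :=
  closure D.white ∩ closure (D.rect \ D.white)

/-- The number of (vertical and horizontal) grid lines that do not meet the boundary of the white
space. -/
noncomputable def freeLines (D : Diagram n m) : ℕ :=
  {i : Fin (n + 1) | Disjoint (D.vLine i) D.whiteBoundary}.ncard +
    {j : Fin (m + 1) | Disjoint (D.hLine j) D.whiteBoundary}.ncard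

end Diagram

/-! ## Polygonal curves on the real line and their free space diagram -/

/-- A polygonal curve in `ℝ` with `n` segments, given by its vertices. -/
abbrev Curve (n : ℕ) := Fin (n + 1) → ℝ

namespace Curve

variable {n : ℕ}

/-- Length of the `i`-th segment. -/
def segLength (P : Curve n) (i : Fin n) : ℝ := |P i.succ - P i.castSucc|

/-- The arc length parametrization of `P`. At parameter `r` the `i`-th segment, which occupies the
parameters from `∑ j < i, segLength j` to `∑ j ≤ i, segLength j`, has been traversed for a fraction
`max 0 (min 1 _)` of its length, and the point is `P 0` plus the displacements so far. -/
noncomputable def param (P : Curve n) (r : ℝ) : ℝ :=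
  P 0 + ∑ i : Fin n,
    max 0 (min 1 ((r - Fin.partialSum P.segLength i.castSucc) / P.segLength i)) *
      (P i.succ - P i.castSucc)

theorem monotone_partialSum_segLength {n : ℕ} (P : Curve n) :
    Monotone (Fin.partialSum P.segLength) := by
  rw [Fin.monotone_iff_le_succ]
  intro i
  rw [Fin.partialSum_succ]
  have : 0 ≤ P.segLength i := abs_nonneg _
  linarith

theorem sum_displacements {n : ℕ} (P : Curve n) (k : Fin (n + 1)) :
    ∑ j : Fin n, (if j.castSucc < k then P j.succ - P j.castSucc else 0) = P k - P 0 := by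
  induction k using Fin.induction with
  | zero => simp
  | succ i ih =>
    have h : ∀ j : Fin n, (if j.castSucc < i.succ then P j.succ - P j.castSucc else 0) =
        (if j.castSucc < i.castSucc then P j.succ - P j.castSucc else 0) +
          (if j = i then P j.succ - P j.castSucc else 0) := by
      intro j
      rcases lt_trichotomy j i with h | h | h
      · have h1 : j.castSucc < i.succ := by
          rw [Fin.lt_def] at h ⊢; simp only [Fin.val_succ, Fin.val_castSucc]; omega
        simp [h, h.ne, h1]
      · subst h; simp
      · have h1 : ¬ j.castSucc < i.succ := by
          rw [Fin.lt_def] at h ⊢; simp only [Fin.val_succ, Fin.val_castSucc]; omega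
        simp [h.ne', h1, h.le]
    rw [Finset.sum_congr rfl fun j _ => h j, Finset.sum_add_distrib, ih]
    simp

/-- If no segment is degenerate, then `param` runs through the segments of `P` one after the other
at unit speed. -/
theorem param_segment {n : ℕ} (P : Curve n) (hP : ∀ i, 0 < P.segLength i) (i : Fin n) {s : ℝ}
    (h0 : 0 ≤ s) (h1 : s ≤ 1) :
    P.param (Fin.partialSum P.segLength i.castSucc + s * P.segLength i) =
      P i.castSucc + s * (P i.succ - P i.castSucc) := by
  have hterm : ∀ j : Fin n,
      max 0 (min 1 ((Fin.partialSum P.segLength i.castSucc + s * P.segLength i -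
        Fin.partialSum P.segLength j.castSucc) / P.segLength j)) * (P j.succ - P j.castSucc) =
      (if j.castSucc < i.castSucc then P j.succ - P j.castSucc else 0) +
        (if j = i then s * (P j.succ - P j.castSucc) else 0) := by
    intro j
    have hj := hP j
    have hi := hP i
    have hmono := P.monotone_partialSum_segLength
    rcases lt_trichotomy j i with h | h | h
    · have h2 : j.succ ≤ i.castSucc := by
        rw [Fin.lt_def] at h; rw [Fin.le_def]; simp only [Fin.val_succ, Fin.val_castSucc]; omega
      have h3 := hmono h2
      rw [Fin.partialSum_succ] at h3
      have h4 : 1 ≤ (Fin.partialSum P.segLength i.castSucc + s * P.segLength i -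
          Fin.partialSum P.segLength j.castSucc) / P.segLength j := by
        rw [le_div_iff₀ hj]; nlinarith
      simp [h, h.ne, min_eq_left h4]
    · subst h
      have : (Fin.partialSum P.segLength j.castSucc + s * P.segLength j -
          Fin.partialSum P.segLength j.castSucc) / P.segLength j = s := by
        field_simp; ring
      rw [this, min_eq_right h1, max_eq_right h0]; simp
    · have h2 : i.succ ≤ j.castSucc := by
        rw [Fin.lt_def] at h; rw [Fin.le_def]; simp only [Fin.val_succ, Fin.val_castSucc]; omega
      have h3 := hmono h2
      rw [Fin.partialSum_succ] at h3
      have h4 : (Fin.partialSum P.segLength i.castSucc + s * P.segLength i -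
          Fin.partialSum P.segLength j.castSucc) / P.segLength j ≤ 0 := by
        apply div_nonpos_of_nonpos_of_nonneg _ hj.le; nlinarith
      have h5 := (min_le_right (1 : ℝ) _).trans h4
      simp [h.ne', h.le, max_eq_left h5]
  rw [param, Finset.sum_congr rfl fun j _ => hterm j, Finset.sum_add_distrib,
    P.sum_displacements]
  simp only [Finset.sum_ite_eq', Finset.mem_univ, if_true]
  ring

end Curve

/-- The free space diagram `D_ε(P, Q)`: column widths and row heights are the segment lengths of `P`
and `Q`, and the point `(r, t)` of the rectangle is white iff `|P(r) - Q(t)| ≤ ε`. -/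
noncomputable def freeSpaceDiagram {n m : ℕ} (ε : ℝ) (P : Curve n) (Q : Curve m) :
    Diagram n m where
  width := P.segLength
  height := Q.segLength
  white := {z | z ∈ Set.Icc 0 (Fin.partialSum P.segLength (Fin.last n)) ×ˢ
                    Set.Icc 0 (Fin.partialSum Q.segLength (Fin.last m)) ∧
                |P.param z.1 - Q.param z.2| ≤ ε}

/-! ## Diagrams as inputs -/

/-- The slab of slope `+1` (`up = true`) or `-1` (`up = false`) between the two parallel lines
`y = x + lo`, `y = x + hi`, respectively `y = -x + lo`, `y = -x + hi`. It is empty if `hi < lo`. -/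
def slab (up : Bool) (lo hi : ℝ) : Set (ℝ × ℝ) :=
  {z | (if up then z.2 - z.1 else z.2 + z.1) ∈ Set.Icc lo hi}

/-- An input of the one-dimensional realizability problem: a number `ε > 0` and a diagram whose
white space in each cell is the part of a slab of slope `±1` in it, together with the equations of
the lines bounding these slabs. Empty and full cells are included: they are
described by slabs that miss, respectively cover, the cell. The slabs need not have the width that
`ε` dictates, nor need they fit together to the diagram of a pair of curves. -/
structure InputDiagram (n m : ℕ) extends Diagram n m where
  eps : ℝ
  eps_pos : 0 < eps
  width_pos : ∀ i, 0 < width i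
  height_pos : ∀ j, 0 < height j
  white_subset : white ⊆ toDiagram.rect
  up : Fin n → Fin m → Bool
  lo : Fin n → Fin m → ℝ
  hi : Fin n → Fin m → ℝ
  white_inter_cell : ∀ i j,
    white ∩ toDiagram.cell i j = slab (up i j) (lo i j) (hi i j) ∩ toDiagram.cell i j

/-- The curves `P` and `Q` realize the diagram `D`, i.e. `D = D_ε(P, Q)`. -/
def InputDiagram.RealizedBy {n m : ℕ} (D : InputDiagram n m) (P : Curve n) (Q : Curve m) : Prop :=
  freeSpaceDiagram D.eps P Q = D.toDiagram

/-! ## The real RAM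

Programs are structured programs over arrays of real numbers and arrays of natural numbers; the
arrays are numbered, and a program refers to an array by a fixed number, so it uses finitely many of
them. Only natural numbers serve as array indices, so there is indirect addressing. Each
constant, memory access, arithmetic operation, comparison and control step costs one unit of time.
There is no rounding, no conversion between the two types, and no multiplication of natural
numbers. -/

namespace RealRAM

/-- A memory: `nat a i` and `real a i` are entry `i` of the array with number `a` of either type. -/
structure Memory where
  nat : ℕ → ℕ → ℕ
  real : ℕ → ℕ → ℝ

namespace Memory

/-- Write `v` to entry `i` of array `a` of natural numbers. -/
def setNat (s : Memory) (a i v : ℕ) : Memory :=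
  { s with nat := Function.update s.nat a (Function.update (s.nat a) i v) }

/-- Write `v` to entry `i` of array `a` of real numbers. -/
noncomputable def setReal (s : Memory) (a i : ℕ) (v : ℝ) : Memory :=
  { s with real := Function.update s.real a (Function.update (s.real a) i v) }

end Memory

/-- Expressions of natural number type. -/
inductive NatExpr where
  | const (c : ℕ)
  | read (a : ℕ) (i : NatExpr)
  | add (e f : NatExpr)
  | sub (e f : NatExpr)

namespace NatExpr

/-- Value of an expression; subtraction is truncated at zero. -/
def eval (s : Memory) : NatExpr → ℕ
  | const c => c
  | read a i => s.nat a (i.eval s)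
  | add e f => e.eval s + f.eval s
  | sub e f => e.eval s - f.eval s

/-- Time to evaluate an expression. -/
def cost : NatExpr → ℕ
  | const _ => 1
  | read _ i => i.cost + 1
  | add e f => e.cost + f.cost + 1
  | sub e f => e.cost + f.cost + 1

end NatExpr

/-- Expressions of real number type; constants are rational. -/
inductive RealExpr where
  | const (c : ℚ)
  | read (a : ℕ) (i : NatExpr)
  | add (e f : RealExpr)
  | sub (e f : RealExpr)
  | mul (e f : RealExpr)
  | div (e f : RealExpr)

namespace RealExpr

/-- Value of an expression. Division by zero yields zero, which gives no additional power, as a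
program can test whether the divisor is zero. -/
noncomputable def eval (s : Memory) : RealExpr → ℝ
  | const c => (c : ℝ)
  | read a i => s.real a (i.eval s)
  | add e f => e.eval s + f.eval s
  | sub e f => e.eval s - f.eval s
  | mul e f => e.eval s * f.eval s
  | div e f => e.eval s / f.eval s

/-- Time to evaluate an expression. -/
def cost : RealExpr → ℕ
  | const _ => 1
  | read _ i => i.cost + 1
  | add e f => e.cost + f.cost + 1
  | sub e f => e.cost + f.cost + 1
  | mul e f => e.cost + f.cost + 1
  | div e f => e.cost + f.cost + 1

end RealExpr

/-- Tests. -/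
inductive Test where
  | natLE (e f : NatExpr)
  | realLE (e f : RealExpr)
  | neg (b : Test)
  | conj (b c : Test)

namespace Test

/-- Truth of a test. -/
def Holds (s : Memory) : Test → Prop
  | natLE e f => e.eval s ≤ f.eval s
  | realLE e f => e.eval s ≤ f.eval s
  | neg b => ¬ b.Holds s
  | conj b c => b.Holds s ∧ c.Holds s

/-- Time to evaluate a test. -/
def cost : Test → ℕ
  | natLE e f => e.cost + f.cost + 1
  | realLE e f => e.cost + f.cost + 1
  | neg b => b.cost + 1
  | conj b c => b.cost + c.cost + 1

end Test

/-- Programs: assignments to entry `i` of array `a`, composition, branching and while loops. -/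
inductive Program where
  | skip
  | assignNat (a : ℕ) (i e : NatExpr)
  | assignReal (a : ℕ) (i : NatExpr) (e : RealExpr)
  | seq (p q : Program)
  | branch (b : Test) (p q : Program)
  | loop (b : Test) (p : Program)

/-- `Runs p s t s₁`: the program `p`, started with memory `s`, halts after time `t` with
memory `s₁`. -/
inductive Runs : Program → Memory → ℕ → Memory → Prop
  | skip (s : Memory) : Runs .skip s 1 s
  | assignNat (a : ℕ) (i e : NatExpr) (s : Memory) :
      Runs (.assignNat a i e) s (i.cost + e.cost + 1) (s.setNat a (i.eval s) (e.eval s))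
  | assignReal (a : ℕ) (i : NatExpr) (e : RealExpr) (s : Memory) :
      Runs (.assignReal a i e) s (i.cost + e.cost + 1) (s.setReal a (i.eval s) (e.eval s))
  | seq {p q : Program} {s s₁ s₂ : Memory} {t u : ℕ} :
      Runs p s t s₁ → Runs q s₁ u s₂ → Runs (.seq p q) s (t + u) s₂
  | branch_true {b : Test} {p q : Program} {s s₁ : Memory} {t : ℕ} :
      b.Holds s → Runs p s t s₁ → Runs (.branch b p q) s (b.cost + t + 1) s₁
  | branch_false {b : Test} {p q : Program} {s s₁ : Memory} {t : ℕ} :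
      ¬ b.Holds s → Runs q s t s₁ → Runs (.branch b p q) s (b.cost + t + 1) s₁
  | loop_false {b : Test} {p : Program} {s : Memory} :
      ¬ b.Holds s → Runs (.loop b p) s (b.cost + 1) s
  | loop_true {b : Test} {p : Program} {s s₁ s₂ : Memory} {t u : ℕ} :
      b.Holds s → Runs p s t s₁ → Runs (.loop b p) s₁ u s₂ →
      Runs (.loop b p) s (b.cost + t + u + 1) s₂

/-- The array with entries `f 0, …, f (n - 1)`, followed by zeros. -/
def vec {α : Type} [Zero α] {n : ℕ} (f : Fin n → α) (k : ℕ) : α :=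
  if h : k < n then f ⟨k, h⟩ else 0

/-- The array with entry `f i j` at index `i * m + j`, followed by zeros. -/
def mat {α : Type} [Zero α] {n m : ℕ} (f : Fin n → Fin m → α) : ℕ → α :=
  vec fun k : Fin (n * m) => f k.divNat k.modNat

/-- The initial memory for the input `D`. Arrays of natural numbers: array `0` is `n, m`, and array
`1` tells for each cell whether its slab has slope `+1` (entry `1`) or `-1` (entry `0`). Arrays of
real numbers: array `0` is `ε`, arrays `1` and `2` are the widths and the heights, arrays `3` and `4`
are the numbers `lo` and `hi` of the cells. Everything else is zero. -/
noncomputable def load {n m : ℕ} (D : InputDiagram n m) : Memory where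
  nat := fun
    | 0 => vec ![n, m]
    | 1 => mat fun i j => if D.up i j then 1 else 0
    | _ => fun _ => 0
  real := fun
    | 0 => vec ![D.eps]
    | 1 => vec D.width
    | 2 => vec D.height
    | 3 => mat D.lo
    | 4 => mat D.hi
    | _ => fun _ => 0

/-- The output flag: entry `0` of array `0` of natural numbers. -/
def Memory.flag (s : Memory) : ℕ := s.nat 0 0

/-- The first output curve: its `n + 1` vertices are in array `0` of real numbers. -/
def Memory.outP (s : Memory) (n : ℕ) : Curve n := fun i => s.real 0 i

/-- The second output curve: its `m + 1` vertices are in array `1` of real numbers. -/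
def Memory.outQ (s : Memory) (m : ℕ) : Curve m := fun j => s.real 1 j

end RealRAM

/-! On the line, a curve with prescribed segment lengths is determined by its starting point and the
directions `±1` of its segments, and the free space depends only on the difference of the two
curves. A realization is therefore a finite sequence of turns `±1`, for the two curves written one
after the other, together with one real offset.

A grid line that meets the boundary of the white space reveals its turn. At a boundary point on an
inner vertical line every realization has `P - Q = ±ε`. If `P` keeps its direction there, then `P -
Q` runs monotonically through `±ε` along the horizontal direction, so exactly one of the points
immediately to the left and right is gray. If `P` turns back, these two points have the same color.
The colors can be read off from the two adjacent slabs (`turn_of_crossing`), and the boundary point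
is one of the four points where the bounding lines of these slabs meet the grid line
(`crossing_of_mem_closure_left`, `crossing_of_mem_closure_right`). Horizontal lines are treated by
exchanging the coordinates. Hence constantly many tests per cell determine all turns except those at
the `k` free lines, the first direction of `P`, and the turn from the last segment of `P` to the
first one of `Q`: at most `4 * 2 ^ k` sequences remain (`card_unforced_le`).

For given turns three offsets suffice (`realizes_candidate`). A cell with both colors shows a
bounding line of its slab, which must be at vertical distance `ε` from the middle line of the free
space, and this fixes the offset (`offset_of_mixed`). If there is no such cell, the rectangle has a
single color (`covers_of_not_mixed`): if it is gray, a huge offset works; if it is white, the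
largest admissible offset works whenever any does.

Each of the candidates is built in time linear in `n + m` and verified cell by cell, since two slabs
can be compared inside a rectangle in constant time (`slabsAgree_iff`). The verification also makes
contradictory forced turns harmless: a mark only asserts something about all realizations, and there
are none in that case.

The program enumerates the undetermined turns as the binary digits of a counter (`enc`,
`decode_spec`). Its analysis rests on a total correctness predicate with a time bound, `Ensures`,
and on the rule that arrays to which a program has no assignment are unchanged (`Runs.frame`). -/

/-! ## Slabs in a rectangle -/

/-- A slab `lo ≤ v ≤ hi` misses the cell on which `v` ranges over `[vn, vx]`. -/
def SlabMisses (vn vx lo hi : ℝ) : Prop := hi < lo ∨ hi < vn ∨ vx < lo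

/-- A slab `lo ≤ v ≤ hi` covers the cell on which `v` ranges over `[vn, vx]`. -/
def SlabCovers (vn vx lo hi : ℝ) : Prop := lo ≤ vn ∧ vx ≤ hi

/-- The minimum of `t - g * r` on `[x0, x1] × [y0, y1]`, for `g = ±1`. -/
noncomputable def slabMin (g x0 x1 y0 : ℝ) : ℝ := y0 - g * ((x0 + x1) / 2) - (x1 - x0) / 2

/-- The maximum of `t - g * r` on `[x0, x1] × [y0, y1]`, for `g = ±1`. -/
noncomputable def slabMax (g x0 x1 y1 : ℝ) : ℝ := y1 - g * ((x0 + x1) / 2) + (x1 - x0) / 2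

/-- A criterion for two slabs to agree on a cell. -/
def SlabsAgree (g vn vx lo hi g' vn' vx' lo' hi' : ℝ) : Prop :=
  (SlabMisses vn vx lo hi ∧ SlabMisses vn' vx' lo' hi') ∨
  (SlabCovers vn vx lo hi ∧ SlabCovers vn' vx' lo' hi') ∨
  (¬ SlabMisses vn vx lo hi ∧ ¬ SlabMisses vn' vx' lo' hi' ∧ g = g' ∧
    (lo = lo' ∨ (lo ≤ vn ∧ lo' ≤ vn)) ∧ (hi = hi' ∨ (vx ≤ hi ∧ vx ≤ hi')))

section Slabs

variable {g g' x0 x1 y0 y1 lo hi lo' hi' : ℝ}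

theorem slabMin_le (hg : g = 1 ∨ g = -1) {r t : ℝ} (hr : r ∈ Set.Icc x0 x1)
    (ht : t ∈ Set.Icc y0 y1) : slabMin g x0 x1 y0 ≤ t - g * r := by
  obtain ⟨h1, h2⟩ := hr
  obtain ⟨h3, h4⟩ := ht
  rcases hg with rfl | rfl <;> simp only [slabMin] <;> linarith

theorem le_slabMax (hg : g = 1 ∨ g = -1) {r t : ℝ} (hr : r ∈ Set.Icc x0 x1)
    (ht : t ∈ Set.Icc y0 y1) : t - g * r ≤ slabMax g x0 x1 y1 := by
  obtain ⟨h1, h2⟩ := hr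
  obtain ⟨h3, h4⟩ := ht
  rcases hg with rfl | rfl <;> simp only [slabMax] <;> linarith

theorem slabMin_lt_slabMax (hx : x0 < x1) (hy : y0 < y1) :
    slabMin g x0 x1 y0 < slabMax g x0 x1 y1 := by
  simp only [slabMin, slabMax]; linarith

/-- Every value between the extremes is attained, at a point which can be moved a bit in both
coordinate directions that increase (decrease) the value unless it is the maximum (minimum). -/
theorem exists_slab_eq (hg : g = 1 ∨ g = -1) (hx : x0 < x1) (hy : y0 < y1) {v : ℝ}
    (h1 : slabMin g x0 x1 y0 ≤ v) (h2 : v ≤ slabMax g x0 x1 y1) :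
    ∃ r ∈ Set.Icc x0 x1, ∃ t ∈ Set.Icc y0 y1, t - g * r = v ∧
      (v < slabMax g x0 x1 y1 → ∃ δ > 0, r - g * δ ∈ Set.Icc x0 x1 ∧ t + δ ∈ Set.Icc y0 y1) ∧
      (slabMin g x0 x1 y0 < v → ∃ δ > 0, r + g * δ ∈ Set.Icc x0 x1 ∧ t - δ ∈ Set.Icc y0 y1) := by
  -- Points are taken on the diagonal from the corner with the minimal value to the corner with the
  -- maximal one. Along it the value grows linearly by half the perimeter, and `θ` is the fraction
  -- that is traversed.
  obtain ⟨θ, hθ, h0, h1', hv0, hv1⟩ : ∃ θ, v = slabMin g x0 x1 y0 + θ * ((x1 - x0) + (y1 - y0)) ∧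
      0 ≤ θ ∧ θ ≤ 1 ∧ (v < slabMax g x0 x1 y1 → θ < 1) ∧ (slabMin g x0 x1 y0 < v → 0 < θ) := by
    have hp : 0 < (x1 - x0) + (y1 - y0) := by linarith
    have hd : slabMax g x0 x1 y1 = slabMin g x0 x1 y0 + ((x1 - x0) + (y1 - y0)) := by
      simp only [slabMin, slabMax]; ring
    refine ⟨(v - slabMin g x0 x1 y0) / ((x1 - x0) + (y1 - y0)), ?_, ?_, ?_, ?_, ?_⟩
    · field_simp; ring
    · exact div_nonneg (by linarith) hp.le
    · rw [div_le_one hp]; linarith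
    · intro h; rw [div_lt_one hp]; linarith
    · intro h; exact div_pos (by linarith) hp
  have a1 : 0 ≤ θ * (x1 - x0) := mul_nonneg h0 (by linarith)
  have a2 : 0 ≤ (1 - θ) * (x1 - x0) := mul_nonneg (by linarith) (by linarith)
  have a3 : 0 ≤ θ * (y1 - y0) := mul_nonneg h0 (by linarith)
  have a4 : 0 ≤ (1 - θ) * (y1 - y0) := mul_nonneg (by linarith) (by linarith)
  refine ⟨(x0 + x1) / 2 - g * ((x1 - x0) * (θ - 1 / 2)), ?_, y0 + θ * (y1 - y0), ?_, ?_, ?_, ?_⟩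
  · rcases hg with rfl | rfl <;> constructor <;> linarith
  · constructor <;> linarith
  · rw [hθ]; simp only [slabMin]; rcases hg with rfl | rfl <;> ring
  · intro h
    have h := hv0 h
    have b1 : 0 < (1 - θ) * (x1 - x0) := mul_pos (by linarith) (by linarith)
    have b2 : 0 < (1 - θ) * (y1 - y0) := mul_pos (by linarith) (by linarith)
    refine ⟨min ((1 - θ) * (x1 - x0)) ((1 - θ) * (y1 - y0)), lt_min b1 b2, ?_, ?_⟩
    · have := min_le_left ((1 - θ) * (x1 - x0)) ((1 - θ) * (y1 - y0))
      have := lt_min b1 b2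
      rcases hg with rfl | rfl <;> constructor <;> linarith
    · have := min_le_right ((1 - θ) * (x1 - x0)) ((1 - θ) * (y1 - y0))
      have := lt_min b1 b2
      constructor <;> linarith
  · intro h
    have h := hv1 h
    have b1 : 0 < θ * (x1 - x0) := mul_pos h (by linarith)
    have b2 : 0 < θ * (y1 - y0) := mul_pos h (by linarith)
    refine ⟨min (θ * (x1 - x0)) (θ * (y1 - y0)), lt_min b1 b2, ?_, ?_⟩
    · have := min_le_left (θ * (x1 - x0)) (θ * (y1 - y0))
      have := lt_min b1 b2
      rcases hg with rfl | rfl <;> constructor <;> linarith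
    · have := min_le_right (θ * (x1 - x0)) (θ * (y1 - y0))
      have := lt_min b1 b2
      constructor <;> linarith

theorem not_slabMisses_iff (hg : g = 1 ∨ g = -1) (hx : x0 < x1) (hy : y0 < y1) :
    ¬ SlabMisses (slabMin g x0 x1 y0) (slabMax g x0 x1 y1) lo hi ↔
      ∃ r ∈ Set.Icc x0 x1, ∃ t ∈ Set.Icc y0 y1, lo ≤ t - g * r ∧ t - g * r ≤ hi := by
  constructor
  · intro h
    simp only [SlabMisses, not_or, not_lt] at h
    obtain ⟨h1, h2, h3⟩ := h
    -- The smallest value of the slab that lies in the range of the cell.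
    obtain ⟨r, hr, t, ht, hv, -, -⟩ := exists_slab_eq hg hx hy (v := max lo (slabMin g x0 x1 y0))
      (le_max_right _ _) (max_le h3 (slabMin_lt_slabMax hx hy).le)
    exact ⟨r, hr, t, ht, hv ▸ le_max_left _ _, hv ▸ max_le h1 h2⟩
  · rintro ⟨r, hr, t, ht, h1, h2⟩ h
    have := slabMin_le hg hr ht
    have := le_slabMax hg hr ht
    rcases h with h | h | h <;> linarith

theorem slabCovers_iff (hg : g = 1 ∨ g = -1) (hx : x0 < x1) (hy : y0 < y1) :
    SlabCovers (slabMin g x0 x1 y0) (slabMax g x0 x1 y1) lo hi ↔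
      ∀ r ∈ Set.Icc x0 x1, ∀ t ∈ Set.Icc y0 y1, lo ≤ t - g * r ∧ t - g * r ≤ hi := by
  constructor
  · rintro ⟨h1, h2⟩ r hr t ht
    exact ⟨h1.trans (slabMin_le hg hr ht), (le_slabMax hg hr ht).trans h2⟩
  · intro h
    obtain ⟨r, hr, t, ht, hv, -⟩ := exists_slab_eq hg hx hy (v := slabMin g x0 x1 y0)
      le_rfl (slabMin_lt_slabMax hx hy).le
    obtain ⟨r', hr', t', ht', hv', -⟩ := exists_slab_eq hg hx hy (v := slabMax g x0 x1 y1)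
      (slabMin_lt_slabMax hx hy).le le_rfl
    exact ⟨hv ▸ (h r hr t ht).1, hv' ▸ (h r' hr' t' ht').2⟩

/-- Slabs of different slopes that agree on a cell without missing it cover the cell. -/
theorem slabCovers_of_agree_neg (hg : g = 1 ∨ g = -1) (hx : x0 < x1) (hy : y0 < y1)
    (h : ∀ r ∈ Set.Icc x0 x1, ∀ t ∈ Set.Icc y0 y1,
      (lo ≤ t - g * r ∧ t - g * r ≤ hi) ↔ (lo' ≤ t - -g * r ∧ t - -g * r ≤ hi'))
    (hm : ¬ SlabMisses (slabMin g x0 x1 y0) (slabMax g x0 x1 y1) lo hi) :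
    SlabCovers (slabMin g x0 x1 y0) (slabMax g x0 x1 y1) lo hi := by
  simp only [SlabMisses, not_or, not_lt] at hm
  obtain ⟨h1, h2, h3⟩ := hm
  have hgg : g * g = 1 := by rcases hg with rfl | rfl <;> norm_num
  constructor
  · by_contra hc
    push Not at hc
    obtain ⟨r, hr, t, ht, hv, -, hδ⟩ := exists_slab_eq hg hx hy hc.le h3
    obtain ⟨δ, hδ, hr', ht'⟩ := hδ hc
    have e1 := (h r hr t ht).1 ⟨hv.ge, hv.le.trans h1⟩
    -- This move follows a line of the second slab, so membership in that slab is kept, while the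
    -- value for the first slab drops by `2 * δ` below `lo`.
    have e2 : t - δ - -g * (r + g * δ) = t - -g * r := by linear_combination δ * hgg
    have e3 := ((h _ hr' _ ht').2 (by rwa [e2])).1
    have e4 : t - δ - g * (r + g * δ) = t - g * r - 2 * δ := by linear_combination -δ * hgg
    linarith
  · by_contra hc
    push Not at hc
    obtain ⟨r, hr, t, ht, hv, hδ, -⟩ := exists_slab_eq hg hx hy h2 hc.le
    obtain ⟨δ, hδ, hr', ht'⟩ := hδ hc
    have e1 := (h r hr t ht).1 ⟨h1.trans hv.ge, hv.le⟩
    have e2 : t + δ - -g * (r - g * δ) = t - -g * r := by linear_combination -δ * hgg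
    have e3 := ((h _ hr' _ ht').2 (by rwa [e2])).2
    have e4 : t + δ - g * (r - g * δ) = t - g * r + 2 * δ := by linear_combination δ * hgg
    linarith

/-- For equal slopes everything depends on the value of `t - g * r`, which fills the interval
between its extremes: two intervals have the same trace there iff each pair of endpoints is equal or
invisible. Different slopes can only agree trivially, by `slabCovers_of_agree_neg`. This makes the
verification of a cell a test of constant length. -/
theorem slabsAgree_iff (hg : g = 1 ∨ g = -1) (hg' : g' = 1 ∨ g' = -1) (hx : x0 < x1)
    (hy : y0 < y1) :
    SlabsAgree g (slabMin g x0 x1 y0) (slabMax g x0 x1 y1) lo hi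
        g' (slabMin g' x0 x1 y0) (slabMax g' x0 x1 y1) lo' hi' ↔
      ∀ r ∈ Set.Icc x0 x1, ∀ t ∈ Set.Icc y0 y1,
        (lo ≤ t - g * r ∧ t - g * r ≤ hi) ↔ (lo' ≤ t - g' * r ∧ t - g' * r ≤ hi') := by
  constructor
  · rintro (⟨h, h'⟩ | ⟨h, h'⟩ | ⟨-, -, rfl, h1, h2⟩) r hr t ht
    · have a1 : ¬ (lo ≤ t - g * r ∧ t - g * r ≤ hi) := fun hh =>
        (not_slabMisses_iff hg hx hy).2 ⟨r, hr, t, ht, hh⟩ h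
      have a2 : ¬ (lo' ≤ t - g' * r ∧ t - g' * r ≤ hi') := fun hh =>
        (not_slabMisses_iff hg' hx hy).2 ⟨r, hr, t, ht, hh⟩ h'
      exact iff_of_false a1 a2
    · exact iff_of_true ((slabCovers_iff hg hx hy).1 h r hr t ht)
        ((slabCovers_iff hg' hx hy).1 h' r hr t ht)
    · have a1 := slabMin_le hg hr ht
      have a2 := le_slabMax hg hr ht
      have b1 : lo ≤ t - g * r ↔ lo' ≤ t - g * r := by
        rcases h1 with rfl | ⟨h, h'⟩
        · rfl
        · exact iff_of_true (h.trans a1) (h'.trans a1)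
      have b2 : t - g * r ≤ hi ↔ t - g * r ≤ hi' := by
        rcases h2 with rfl | ⟨h, h'⟩
        · rfl
        · exact iff_of_true (a2.trans h) (a2.trans h')
      rw [b1, b2]
  · intro h
    by_cases hm : SlabMisses (slabMin g x0 x1 y0) (slabMax g x0 x1 y1) lo hi
    · refine Or.inl ⟨hm, ?_⟩
      by_contra hm'
      obtain ⟨r, hr, t, ht, hh⟩ := (not_slabMisses_iff hg' hx hy).1 hm'
      exact (not_slabMisses_iff hg hx hy).2 ⟨r, hr, t, ht, (h r hr t ht).2 hh⟩ hm
    · have hm' : ¬ SlabMisses (slabMin g' x0 x1 y0) (slabMax g' x0 x1 y1) lo' hi' := by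
        obtain ⟨r, hr, t, ht, hh⟩ := (not_slabMisses_iff hg hx hy).1 hm
        exact (not_slabMisses_iff hg' hx hy).2 ⟨r, hr, t, ht, (h r hr t ht).1 hh⟩
      right
      by_cases hgg : g = g'
      · right
        subst hgg
        refine ⟨hm, hm', rfl, ?_⟩
        have key : ∀ v, slabMin g x0 x1 y0 ≤ v → v ≤ slabMax g x0 x1 y1 →
            ((lo ≤ v ∧ v ≤ hi) ↔ (lo' ≤ v ∧ v ≤ hi')) := by
          intro v hv1 hv2
          obtain ⟨r, hr, t, ht, rfl, -⟩ := exists_slab_eq hg hx hy hv1 hv2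
          exact h r hr t ht
        have hab := (slabMin_lt_slabMax (g := g) hx hy).le
        generalize slabMin g x0 x1 y0 = a at *
        generalize slabMax g x0 x1 y1 = b at *
        simp only [SlabMisses, not_or, not_lt] at hm hm'
        obtain ⟨h1, h2, h3⟩ := hm
        obtain ⟨h1', h2', h3'⟩ := hm'
        -- The extreme points of each trace are tested against the other interval. This yields `lo'
        -- ≤ max lo a` and `lo ≤ max lo' a`, and likewise for the upper ends.
        have k1 := (key (max lo a) (le_max_right _ _) (max_le h3 hab)).1
          ⟨le_max_left _ _, max_le h1 h2⟩
        have k2 := (key (max lo' a) (le_max_right _ _) (max_le h3' hab)).2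
          ⟨le_max_left _ _, max_le h1' h2'⟩
        have k3 := (key (min hi b) (le_min h2 hab) (min_le_right _ _)).1
          ⟨le_min h1 h3, min_le_left _ _⟩
        have k4 := (key (min hi' b) (le_min h2' hab) (min_le_right _ _)).2
          ⟨le_min h1' h3', min_le_left _ _⟩
        constructor
        · have k1 := k1.1
          have k2 := k2.1
          rw [le_max_iff] at k1 k2
          rcases k1 with k1 | k1 <;> rcases k2 with k2 | k2
          · exact Or.inl (le_antisymm k2 k1)
          · exact Or.inr ⟨k2, k1.trans k2⟩
          · exact Or.inr ⟨k2.trans k1, k1⟩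
          · exact Or.inr ⟨k2, k1⟩
        · have k3 := k3.2
          have k4 := k4.2
          rw [min_le_iff] at k3 k4
          rcases k3 with k3 | k3 <;> rcases k4 with k4 | k4
          · exact Or.inl (le_antisymm k3 k4)
          · exact Or.inr ⟨k4, k4.trans k3⟩
          · exact Or.inr ⟨k3.trans k4, k3⟩
          · exact Or.inr ⟨k4, k3⟩
      · left
        obtain rfl : g' = -g := by
          rcases hg with rfl | rfl <;> rcases hg' with rfl | rfl <;> first | exact absurd rfl hgg | norm_num
        have hc := slabCovers_of_agree_neg hg hx hy h hm
        refine ⟨hc, ?_⟩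
        rw [slabCovers_iff hg' hx hy]
        intro r hr t ht
        exact (h r hr t ht).1 ((slabCovers_iff hg hx hy).1 hc r hr t ht)

end Slabs

/-! ## Slabs next to a grid line -/

/-- Moving from the value `v` with velocity `k = ±1` one leaves `[lo, hi]` at once. -/
def Exits (k lo hi v : ℝ) : Prop := (k < 0 ∧ v ≤ lo) ∨ (0 < k ∧ hi ≤ v)

/-- `Exits` is thereby expressed by the colors along a short segment. So it can be transferred
between any two descriptions of the same coloring, here a slab and the free space of the curves. -/
theorem exits_iff_forall {k lo hi v d : ℝ} (hk : k = 1 ∨ k = -1) (hd : 0 < d) (h1 : lo ≤ v)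
    (h2 : v ≤ hi) :
    Exits k lo hi v ↔ ∀ δ, 0 < δ → δ ≤ d → ¬ (lo ≤ v + k * δ ∧ v + k * δ ≤ hi) := by
  constructor
  · rintro h δ h0 - ⟨h3, h4⟩
    rcases hk with rfl | rfl <;> rcases h with ⟨h, h'⟩ | ⟨h, h'⟩ <;> linarith
  · intro h
    by_contra hc
    simp only [Exits, not_or, not_and, not_le] at hc
    rcases hk with rfl | rfl
    · have h3 := hc.2 one_pos
      have h4 := lt_min hd (sub_pos.2 h3)
      have h5 := min_le_right d (hi - v)
      exact h _ h4 (min_le_left _ _) ⟨by linarith, by linarith⟩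
    · have h3 := hc.1 (by norm_num)
      have h4 := lt_min hd (sub_pos.2 h3)
      have h5 := min_le_right d (v - lo)
      exact h _ h4 (min_le_left _ _) ⟨by linarith, by linarith⟩

theorem exits_iff_exits {k k' lo hi v lo' hi' v' d : ℝ} (hk : k = 1 ∨ k = -1)
    (hk' : k' = 1 ∨ k' = -1) (hd : 0 < d) (h1 : lo ≤ v) (h2 : v ≤ hi)
    (h : ∀ δ, 0 ≤ δ → δ ≤ d →
      ((lo ≤ v + k * δ ∧ v + k * δ ≤ hi) ↔ (lo' ≤ v' + k' * δ ∧ v' + k' * δ ≤ hi'))) :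
    Exits k lo hi v ↔ Exits k' lo' hi' v' := by
  have h0 := (h 0 le_rfl hd.le).1 (by simpa using ⟨h1, h2⟩)
  simp only [mul_zero, add_zero] at h0
  rw [exits_iff_forall hk hd h1 h2, exits_iff_forall hk' hd h0.1 h0.2]
  exact forall_congr' fun δ => forall_congr' fun a => forall_congr' fun b => not_congr (h δ a.le b)

/-- The point `(x, y)` on the common side `{x} × [y0, y1]` of two cells, with slabs given by
`ga, la, ha` to the left and by `gb, lb, hb` to the right, is white and a limit of gray points of
the two cells. -/
def Crossing (ga la ha gb lb hb x y y0 y1 : ℝ) : Prop :=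
  (y0 ≤ y ∧ y ≤ y1) ∧ (la ≤ y - ga * x ∧ y - ga * x ≤ ha) ∧ (lb ≤ y - gb * x ∧ y - gb * x ≤ hb) ∧
  (Exits ga la ha (y - ga * x) ∨ Exits (-gb) lb hb (y - gb * x) ∨
    (y < y1 ∧ (ha ≤ y - ga * x ∨ hb ≤ y - gb * x)) ∨
    (y0 < y ∧ (y - ga * x ≤ la ∨ y - gb * x ≤ lb)))

/-- At a crossing, the points immediately to the left and to the right have different colors. -/
def ColorChange (ga la ha gb lb hb x y : ℝ) : Prop :=
  ¬ (Exits ga la ha (y - ga * x) ↔ Exits (-gb) lb hb (y - gb * x))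

/-- The possible ordinates of crossings. -/
def crossingCandidates (ga la ha gb lb hb x : ℝ) : List ℝ :=
  [la + ga * x, ha + ga * x, lb + gb * x, hb + gb * x]

/-- `F` is the difference of the curves at `(x, y0)`, and `s`, `s'`, `τ` are the directions of the
segments involved. At the crossing the difference `f` is `ε` or `-ε`. Moving left changes it with
velocity `-s`, moving right with velocity `s'`. Exactly one of these moves leaves `[-ε, ε]` iff the
velocities have opposite signs, that is, iff `s = s'`. -/
theorem turn_of_crossing {ε ga la ha gb lb hb x0 x x2 y y0 y1 s s' τ F : ℝ} (hε : 0 < ε)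
    (hga : ga = 1 ∨ ga = -1) (hgb : gb = 1 ∨ gb = -1) (hs : s = 1 ∨ s = -1)
    (hs' : s' = 1 ∨ s' = -1) (hτ : τ = 1 ∨ τ = -1) (h0 : x0 < x) (h2 : x < x2)
    (hL : ∀ r ∈ Set.Icc x0 x, ∀ t ∈ Set.Icc y0 y1,
      (la ≤ t - ga * r ∧ t - ga * r ≤ ha) ↔ |F + s * (r - x) - τ * (t - y0)| ≤ ε)
    (hR : ∀ r ∈ Set.Icc x x2, ∀ t ∈ Set.Icc y0 y1,
      (lb ≤ t - gb * r ∧ t - gb * r ≤ hb) ↔ |F + s' * (r - x) - τ * (t - y0)| ≤ ε)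
    (hc : Crossing ga la ha gb lb hb x y y0 y1) :
    (ColorChange ga la ha gb lb hb x y → s * s' = 1) ∧
      (¬ ColorChange ga la ha gb lb hb x y → s * s' = -1) := by
  obtain ⟨⟨hy0, hy1⟩, ⟨ha1, ha2⟩, ⟨hb1, hb2⟩, hex⟩ := hc
  simp only [abs_le] at hL hR
  have neg : ∀ {a : ℝ}, a = 1 ∨ a = -1 → -a = 1 ∨ -a = -1 := by
    rintro a (rfl | rfl) <;> norm_num
  set f := F - τ * (y - y0) with hf
  have eL : Exits ga la ha (y - ga * x) ↔ Exits (-s) (-ε) ε f := by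
    refine exits_iff_exits hga (neg hs) (sub_pos.2 h0) ha1 ha2 fun δ d0 d1 => ?_
    have := hL (x - δ) ⟨by linarith, by linarith⟩ y ⟨hy0, hy1⟩
    convert this using 2 <;> ((try rw [hf]); ring_nf)
  have eR : Exits (-gb) lb hb (y - gb * x) ↔ Exits s' (-ε) ε f := by
    refine exits_iff_exits (neg hgb) hs' (sub_pos.2 h2) hb1 hb2 fun δ d0 d1 => ?_
    have := hR (x + δ) ⟨by linarith, by linarith⟩ y ⟨hy0, hy1⟩
    convert this using 2 <;> ((try rw [hf]); ring_nf)
  -- A white point from which some direction leads to gray at once has an extreme value; each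
  -- alternative of `Crossing` supplies such a direction.
  have bd : f = ε ∨ f = -ε := by
    have hff : -ε ≤ f ∧ f ≤ ε := by
      have := (hL x ⟨h0.le, le_rfl⟩ y ⟨hy0, hy1⟩).1 ⟨ha1, ha2⟩
      rw [hf]; constructor <;> linarith [this.1, this.2]
    have gen : ∀ k, Exits k (-ε) ε f → f = ε ∨ f = -ε := by
      rintro k (⟨-, h⟩ | ⟨-, h⟩)
      · exact Or.inr (le_antisymm h hff.1)
      · exact Or.inl (le_antisymm hff.2 h)
    rcases hex with h | h | ⟨hy, h⟩ | ⟨hy, h⟩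
    · exact gen _ (eL.1 h)
    · exact gen _ (eR.1 h)
    -- Along the grid line the slab value has velocity `1` upwards, and the difference of the curves
    -- has velocity `-τ`.
    · refine gen (-τ) ?_
      rcases h with h | h
      · refine (exits_iff_exits (Or.inl rfl) (neg hτ) (sub_pos.2 hy) ha1 ha2
          fun δ d0 d1 => ?_).1 (Or.inr ⟨one_pos, h⟩)
        have := hL x ⟨h0.le, le_rfl⟩ (y + δ) ⟨by linarith, by linarith⟩
        convert this using 2 <;> ((try rw [hf]); ring_nf)
      · refine (exits_iff_exits (Or.inl rfl) (neg hτ) (sub_pos.2 hy) hb1 hb2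
          fun δ d0 d1 => ?_).1 (Or.inr ⟨one_pos, h⟩)
        have := hR x ⟨le_rfl, h2.le⟩ (y + δ) ⟨by linarith, by linarith⟩
        convert this using 2 <;> ((try rw [hf]); ring_nf)
    · refine gen τ ?_
      rcases h with h | h
      · refine (exits_iff_exits (Or.inr rfl) hτ (sub_pos.2 hy) ha1 ha2
          fun δ d0 d1 => ?_).1 (Or.inl ⟨by norm_num, h⟩)
        have := hL x ⟨h0.le, le_rfl⟩ (y - δ) ⟨by linarith, by linarith⟩
        convert this using 2 <;> ((try rw [hf]); ring_nf)
      · refine (exits_iff_exits (Or.inr rfl) hτ (sub_pos.2 hy) hb1 hb2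
          fun δ d0 d1 => ?_).1 (Or.inl ⟨by norm_num, h⟩)
        have := hR x ⟨le_rfl, h2.le⟩ (y - δ) ⟨by linarith, by linarith⟩
        convert this using 2 <;> ((try rw [hf]); ring_nf)
  have n1 : ¬ (ε ≤ -ε) := by linarith
  rw [ColorChange, eL, eR]
  simp only [Exits]
  rcases bd with h | h <;> rw [h] <;> rcases hs with rfl | rfl <;> rcases hs' with rfl | rfl <;>
    norm_num [n1]

/-- A white point of a cell that is a limit of gray points of the cell lies on the boundary of the
slab, and a coordinate direction leads to gray points of the cell. -/
theorem boundary_of_mem_closure {g lo hi x0 x1 y0 y1 r t : ℝ} (hg : g = 1 ∨ g = -1)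
    (hlo : lo ≤ t - g * r) (hhi : t - g * r ≤ hi)
    (h : (r, t) ∈ closure {z : ℝ × ℝ | z.1 ∈ Set.Icc x0 x1 ∧ z.2 ∈ Set.Icc y0 y1 ∧
      ¬ (lo ≤ z.2 - g * z.1 ∧ z.2 - g * z.1 ≤ hi)}) :
    (hi ≤ t - g * r ∧ (t < y1 ∨ (0 < g ∧ x0 < r) ∨ (g < 0 ∧ r < x1))) ∨
    (t - g * r ≤ lo ∧ (y0 < t ∨ (0 < g ∧ r < x1) ∨ (g < 0 ∧ x0 < r))) := by
  by_contra hc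
  rw [not_or, not_and_or, not_and_or, not_le, not_le] at hc
  obtain ⟨hc1, hc2⟩ := hc
  have c : Continuous fun z : ℝ × ℝ => z.2 - g * z.1 := by fun_prop
  have E1 : ∀ᶠ z : ℝ × ℝ in nhds (r, t),
      z.1 ∈ Set.Icc x0 x1 → z.2 ∈ Set.Icc y0 y1 → z.2 - g * z.1 ≤ hi := by
    rcases hc1 with hc1 | hc1
    · filter_upwards [(c.tendsto (r, t)).eventually_lt_const hc1] with z hz _ _
      exact hz.le
    -- If no coordinate direction increases the value, the point is the corner of the cell where the
    -- value is maximal, so `hi` is respected in the whole cell.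
    · simp only [not_or, not_and, not_lt] at hc1
      obtain ⟨a1, a2, a3⟩ := hc1
      refine Filter.Eventually.of_forall fun z hz1 hz2 => hhi.trans' ?_
      rcases hg with rfl | rfl
      · linarith [a2 one_pos, hz1.1, hz2.2]
      · linarith [a3 (by norm_num), hz1.2, hz2.2]
  have E2 : ∀ᶠ z : ℝ × ℝ in nhds (r, t),
      z.1 ∈ Set.Icc x0 x1 → z.2 ∈ Set.Icc y0 y1 → lo ≤ z.2 - g * z.1 := by
    rcases hc2 with hc2 | hc2
    · filter_upwards [(c.tendsto (r, t)).eventually_const_lt hc2] with z hz _ _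
      exact hz.le
    · simp only [not_or, not_and, not_lt] at hc2
      obtain ⟨a1, a2, a3⟩ := hc2
      refine Filter.Eventually.of_forall fun z hz1 hz2 => hlo.trans ?_
      rcases hg with rfl | rfl
      · linarith [a2 one_pos, hz1.2, hz2.1]
      · linarith [a3 (by norm_num), hz1.1, hz2.1]
  obtain ⟨z, ⟨hz1, hz2, hz3⟩, h1, h2⟩ :=
    ((mem_closure_iff_frequently.1 h).and_eventually (E1.and E2)).exists
  exact hz3 ⟨h2 hz1 hz2, h1 hz1 hz2⟩

/-- The converse of a boundary point being a crossing, for the cell to the right. -/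
theorem crossing_of_mem_closure_right {ga la ha gb lb hb x x2 y0 y1 t : ℝ} (hgb : gb = 1 ∨ gb = -1)
    (ht : t ∈ Set.Icc y0 y1)
    (hA : la ≤ t - ga * x ∧ t - ga * x ≤ ha) (hB : lb ≤ t - gb * x ∧ t - gb * x ≤ hb)
    (h : (x, t) ∈ closure {z : ℝ × ℝ | z.1 ∈ Set.Icc x x2 ∧ z.2 ∈ Set.Icc y0 y1 ∧
      ¬ (lb ≤ z.2 - gb * z.1 ∧ z.2 - gb * z.1 ≤ hb)}) :
    ∃ y ∈ crossingCandidates ga la ha gb lb hb x, Crossing ga la ha gb lb hb x y y0 y1 := by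
  refine ⟨t, ?_, ht, hA, hB, ?_⟩
  all_goals
    rcases boundary_of_mem_closure hgb hB.1 hB.2 h with ⟨h1, h2⟩ | ⟨h1, h2⟩
  · have : t = hb + gb * x := by linarith [hB.2]
    simp [crossingCandidates, ← this]
  · have : t = lb + gb * x := by linarith [hB.1]
    simp [crossingCandidates, ← this]
  · rcases h2 with h2 | ⟨h2, h3⟩ | ⟨h2, h3⟩
    · exact Or.inr (Or.inr (Or.inl ⟨h2, Or.inr h1⟩))
    · exact absurd h3 (lt_irrefl _)
    · exact Or.inr (Or.inl (Or.inr ⟨by linarith, h1⟩))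
  · rcases h2 with h2 | ⟨h2, h3⟩ | ⟨h2, h3⟩
    · exact Or.inr (Or.inr (Or.inr ⟨h2, Or.inr h1⟩))
    · exact Or.inr (Or.inl (Or.inl ⟨by linarith, h1⟩))
    · exact absurd h3 (lt_irrefl _)

/-- The converse of a boundary point being a crossing, for the cell to the left. -/
theorem crossing_of_mem_closure_left {ga la ha gb lb hb x0 x y0 y1 t : ℝ} (hga : ga = 1 ∨ ga = -1)
    (ht : t ∈ Set.Icc y0 y1)
    (hA : la ≤ t - ga * x ∧ t - ga * x ≤ ha) (hB : lb ≤ t - gb * x ∧ t - gb * x ≤ hb)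
    (h : (x, t) ∈ closure {z : ℝ × ℝ | z.1 ∈ Set.Icc x0 x ∧ z.2 ∈ Set.Icc y0 y1 ∧
      ¬ (la ≤ z.2 - ga * z.1 ∧ z.2 - ga * z.1 ≤ ha)}) :
    ∃ y ∈ crossingCandidates ga la ha gb lb hb x, Crossing ga la ha gb lb hb x y y0 y1 := by
  refine ⟨t, ?_, ht, hA, hB, ?_⟩
  all_goals
    rcases boundary_of_mem_closure hga hA.1 hA.2 h with ⟨h1, h2⟩ | ⟨h1, h2⟩
  · have : t = ha + ga * x := by linarith [hA.2]
    simp [crossingCandidates, ← this]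
  · have : t = la + ga * x := by linarith [hA.1]
    simp [crossingCandidates, ← this]
  · rcases h2 with h2 | ⟨h2, h3⟩ | ⟨h2, h3⟩
    · exact Or.inr (Or.inr (Or.inl ⟨h2, Or.inl h1⟩))
    · exact Or.inl (Or.inr ⟨h2, h1⟩)
    · exact absurd h3 (lt_irrefl _)
  · rcases h2 with h2 | ⟨h2, h3⟩ | ⟨h2, h3⟩
    · exact Or.inr (Or.inr (Or.inr ⟨h2, Or.inl h1⟩))
    · exact absurd h3 (lt_irrefl _)
    · exact Or.inl (Or.inl ⟨h2, h1⟩)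

/-! ## Diagrams as arrays -/

/-- The data of an input diagram as arrays: `n` columns, `m` rows, the lengths `len` of the `n`
columns followed by the `m` rows, and for each cell the slope `±1` and the bounds of its slab. -/
structure CellData where
  n : ℕ
  m : ℕ
  eps : ℝ
  len : ℕ → ℝ
  slope : ℕ → ℕ → ℝ
  lo : ℕ → ℕ → ℝ
  hi : ℕ → ℕ → ℝ

namespace CellData

variable (d : CellData)

/-- Sum of the first `l` lengths. -/
def pos (l : ℕ) : ℝ := ∑ k ∈ Finset.range l, d.len k

/-- Abscissas of the vertical grid lines. -/
def x (i : ℕ) : ℝ := d.pos i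

/-- Ordinates of the horizontal grid lines. -/
def y (j : ℕ) : ℝ := d.pos (d.n + j) - d.pos d.n

theorem pos_succ (l : ℕ) : d.pos (l + 1) = d.pos l + d.len l := Finset.sum_range_succ _ _

theorem x_succ (i : ℕ) : d.x (i + 1) = d.x i + d.len i := d.pos_succ i

theorem y_succ (j : ℕ) : d.y (j + 1) = d.y j + d.len (d.n + j) := by
  simp only [y, ← add_assoc, pos_succ]; ring

/-- The side conditions on the arrays. -/
structure Regular : Prop where
  n_pos : 0 < d.n
  m_pos : 0 < d.m
  eps_pos : 0 < d.eps
  len_pos : ∀ l < d.n + d.m, 0 < d.len l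
  slope_eq : ∀ i < d.n, ∀ j < d.m, d.slope i j = 1 ∨ d.slope i j = -1

variable {d}

theorem Regular.x_lt (h : d.Regular) {i : ℕ} (hi : i < d.n) : d.x i < d.x (i + 1) := by
  rw [x_succ]; linarith [h.len_pos i (by omega)]

theorem Regular.y_lt (h : d.Regular) {j : ℕ} (hj : j < d.m) : d.y j < d.y (j + 1) := by
  rw [y_succ]; linarith [h.len_pos (d.n + j) (by omega)]

theorem Regular.pos_mono (h : d.Regular) {k l : ℕ} (hkl : k ≤ l) (hl : l ≤ d.n + d.m) :
    d.pos k ≤ d.pos l := by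
  induction l, hkl using Nat.le_induction with
  | base => rfl
  | succ l _ ih => rw [pos_succ]; linarith [ih (by omega), h.len_pos l (by omega)]

theorem Regular.pos_lt (h : d.Regular) {k l : ℕ} (hkl : k < l) (hl : l ≤ d.n + d.m) :
    d.pos k < d.pos l :=
  lt_of_lt_of_le (by rw [pos_succ]; linarith [h.len_pos k (by omega)])
    (h.pos_mono (Nat.succ_le_of_lt hkl) hl)

variable (d)

/-- `d.Slab i j r t` says that `(r, t)` lies in the slab of the cell in column `i` and row `j`. -/
def Slab (i j : ℕ) (r t : ℝ) : Prop :=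
  d.lo i j ≤ t - d.slope i j * r ∧ t - d.slope i j * r ≤ d.hi i j

/-! ### Curves from turns -/

/-- The direction `±1` of segment `l - 1`, if `τ k = ±1` tells whether the direction is kept between
segments `k - 1` and `k`. The segments of the second curve follow those of the first one. -/
def dir (τ : ℕ → ℝ) (l : ℕ) : ℝ := ∏ k ∈ Finset.range l, τ k

/-- The vertices of the concatenation of the two curves, starting at `0`. -/
def walk (τ : ℕ → ℝ) (l : ℕ) : ℝ := ∑ k ∈ Finset.range l, dir τ (k + 1) * d.len k

theorem dir_succ (τ : ℕ → ℝ) (l : ℕ) : dir τ (l + 1) = dir τ l * τ l := Finset.prod_range_succ _ _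

theorem walk_succ (τ : ℕ → ℝ) (l : ℕ) :
    d.walk τ (l + 1) = d.walk τ l + dir τ (l + 1) * d.len l := Finset.sum_range_succ _ _

theorem dir_eq {τ : ℕ → ℝ} {N : ℕ} (hτ : ∀ l < N, τ l = 1 ∨ τ l = -1) {l : ℕ} (hl : l ≤ N) :
    dir τ l = 1 ∨ dir τ l = -1 := by
  induction l with
  | zero => simp [dir]
  | succ l ih =>
    rw [dir_succ]
    rcases ih (by omega) with h | h <;> rcases hτ l (by omega) with h' | h' <;> rw [h, h'] <;>
      norm_num

/-- The difference of the two curves at a point of the cell in column `i` and row `j`, if the first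
curve starts at `c`. -/
def diff (τ : ℕ → ℝ) (c : ℝ) (i j : ℕ) (r t : ℝ) : ℝ :=
  (d.walk τ i + c + dir τ (i + 1) * (r - d.x i)) -
    (d.walk τ (d.n + j) + dir τ (d.n + j + 1) * (t - d.y j))

/-- The curves with turns `τ` and offset `c` have the right free space in the given cell. -/
def CellOK (τ : ℕ → ℝ) (c : ℝ) (i j : ℕ) : Prop :=
  ∀ r ∈ Set.Icc (d.x i) (d.x (i + 1)), ∀ t ∈ Set.Icc (d.y j) (d.y (j + 1)),
    d.Slab i j r t ↔ |d.diff τ c i j r t| ≤ d.eps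

/-- The curves with turns `τ` and offset `c` have the right free space. -/
def Realizes (τ : ℕ → ℝ) (c : ℝ) : Prop := ∀ i < d.n, ∀ j < d.m, d.CellOK τ c i j

/-- All turns are `±1`. -/
def IsTurns (τ : ℕ → ℝ) : Prop := ∀ l < d.n + d.m, τ l = 1 ∨ τ l = -1

variable {d}

theorem IsTurns.dir {τ : ℕ → ℝ} (hτ : d.IsTurns τ) {l : ℕ} (hl : l ≤ d.n + d.m) :
    dir τ l = 1 ∨ dir τ l = -1 := dir_eq hτ hl

/-! ### Forced turns -/

variable (d)

/-- Lower bound of the slab with the coordinates exchanged. -/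
noncomputable def loT (i j : ℕ) : ℝ :=
  -d.slope i j * ((d.lo i j + d.hi i j) / 2) - (d.hi i j - d.lo i j) / 2

/-- Upper bound of the slab with the coordinates exchanged. -/
noncomputable def hiT (i j : ℕ) : ℝ :=
  -d.slope i j * ((d.lo i j + d.hi i j) / 2) + (d.hi i j - d.lo i j) / 2

/-- `Crossing` for the vertical line between columns `i` and `i + 1` in row `j`. -/
def VCrossing (i j : ℕ) (t : ℝ) : Prop :=
  Crossing (d.slope i j) (d.lo i j) (d.hi i j) (d.slope (i + 1) j) (d.lo (i + 1) j)
    (d.hi (i + 1) j) (d.x (i + 1)) t (d.y j) (d.y (j + 1))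

/-- `ColorChange` for the vertical line between columns `i` and `i + 1` in row `j`. -/
def VChange (i j : ℕ) (t : ℝ) : Prop :=
  ColorChange (d.slope i j) (d.lo i j) (d.hi i j) (d.slope (i + 1) j) (d.lo (i + 1) j)
    (d.hi (i + 1) j) (d.x (i + 1)) t

/-- The candidates for crossings of the vertical line between columns `i` and `i + 1` in row `j`. -/
def vCandidates (i j : ℕ) : List ℝ :=
  crossingCandidates (d.slope i j) (d.lo i j) (d.hi i j) (d.slope (i + 1) j) (d.lo (i + 1) j)
    (d.hi (i + 1) j) (d.x (i + 1))

/-- `Crossing` for the horizontal line between rows `j` and `j + 1` in column `i`. -/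
def HCrossing (i j : ℕ) (r : ℝ) : Prop :=
  Crossing (d.slope i j) (d.loT i j) (d.hiT i j) (d.slope i (j + 1)) (d.loT i (j + 1))
    (d.hiT i (j + 1)) (d.y (j + 1)) r (d.x i) (d.x (i + 1))

/-- `ColorChange` for the horizontal line between rows `j` and `j + 1` in column `i`. -/
def HChange (i j : ℕ) (r : ℝ) : Prop :=
  ColorChange (d.slope i j) (d.loT i j) (d.hiT i j) (d.slope i (j + 1)) (d.loT i (j + 1))
    (d.hiT i (j + 1)) (d.y (j + 1)) r

/-- The candidates for crossings of the horizontal line between rows `j` and `j + 1` in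
column `i`. -/
noncomputable def hCandidates (i j : ℕ) : List ℝ :=
  crossingCandidates (d.slope i j) (d.loT i j) (d.hiT i j) (d.slope i (j + 1)) (d.loT i (j + 1))
    (d.hiT i (j + 1)) (d.y (j + 1))

variable {d}

/-- Exchanging the coordinates turns `[lo, hi]` into `[-hi, -lo]` for slope `1` and keeps it for
slope `-1`. Writing the interval by midpoint and half length covers both cases without a branch. -/
theorem slabT_iff {i j : ℕ} (hg : d.slope i j = 1 ∨ d.slope i j = -1) (r t : ℝ) :
    (d.loT i j ≤ r - d.slope i j * t ∧ r - d.slope i j * t ≤ d.hiT i j) ↔ d.Slab i j r t := by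
  simp only [loT, hiT, Slab]
  rcases hg with h | h <;> rw [h] <;> constructor <;> rintro ⟨h1, h2⟩ <;> constructor <;> linarith

theorem Regular.turn_of_vCrossing (hd : d.Regular) {τ : ℕ → ℝ} {c : ℝ} (hτ : d.IsTurns τ)
    (h : d.Realizes τ c) {i j : ℕ} (hi : i + 1 < d.n) (hj : j < d.m) {t : ℝ}
    (hc : d.VCrossing i j t) :
    (d.VChange i j t → τ (i + 1) = 1) ∧ (¬ d.VChange i j t → τ (i + 1) = -1) := by
  have hs := hτ.dir (l := i + 1) (by omega)
  -- The difference of the curves at the point of the line in the lower corner of row `j`.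
  have := turn_of_crossing (F := d.walk τ (i + 1) + c - d.walk τ (d.n + j))
    (τ := dir τ (d.n + j + 1)) hd.eps_pos
    (hd.slope_eq i (by omega) j hj) (hd.slope_eq (i + 1) (by omega) j hj) hs
    (hτ.dir (l := i + 2) (by omega)) (hτ.dir (l := d.n + j + 1) (by omega))
    (hd.x_lt (i := i) (by omega)) (hd.x_lt (i := i + 1) (by omega)) ?_ ?_ hc
  · rw [dir_succ τ (i + 1)] at this
    rcases hs with h | h <;> rw [h] at this
    · simpa [VChange] using this
    · simpa [VChange] using this
  · intro r hr t ht
    refine (h i (by omega) j hj r hr t ht).trans ?_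
    rw [diff, walk_succ, x_succ]
    ring_nf
  · intro r hr t ht
    refine (h (i + 1) (by omega) j hj r hr t ht).trans ?_
    rw [diff]
    ring_nf

theorem Regular.turn_of_hCrossing (hd : d.Regular) {τ : ℕ → ℝ} {c : ℝ} (hτ : d.IsTurns τ)
    (h : d.Realizes τ c) {i j : ℕ} (hi : i < d.n) (hj : j + 1 < d.m) {t : ℝ}
    (hc : d.HCrossing i j t) :
    (d.HChange i j t → τ (d.n + j + 1) = 1) ∧ (¬ d.HChange i j t → τ (d.n + j + 1) = -1) := by
  have hs := hτ.dir (l := d.n + j + 1) (by omega)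
  have s1 := hd.slope_eq i hi j (by omega)
  have s2 := hd.slope_eq i hi (j + 1) (by omega)
  -- The difference is taken with the opposite sign, so that the second curve plays the role of the
  -- first; absolute values do not change.
  have := turn_of_crossing (F := d.walk τ (d.n + j + 1) - (d.walk τ i + c))
    (τ := dir τ (i + 1)) hd.eps_pos s1 s2 hs
    (hτ.dir (l := d.n + j + 2) (by omega)) (hτ.dir (l := i + 1) (by omega))
    (hd.y_lt (j := j) (by omega)) (hd.y_lt (j := j + 1) (by omega)) ?_ ?_ hc
  · rw [dir_succ τ (d.n + j + 1)] at this
    rcases hs with h | h <;> rw [h] at this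
    · simpa [HChange] using this
    · simpa [HChange] using this
  · intro r hr t ht
    refine (slabT_iff s1 t r).trans ((h i (by omega) j (by omega) t ht r hr).trans ?_)
    rw [diff, walk_succ, y_succ, abs_sub_comm]
    ring_nf
  · intro r hr t ht
    refine (slabT_iff s2 t r).trans ((h i (by omega) (j + 1) (by omega) t ht r hr).trans ?_)
    rw [diff, abs_sub_comm]
    ring_nf

/-! ### Verification of a cell -/

variable (d)

/-- Minimum over a cell of `t - g * r`. -/
noncomputable def vmin (g : ℝ) (i j : ℕ) : ℝ := slabMin g (d.x i) (d.x (i + 1)) (d.y j)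

/-- Maximum over a cell of `t - g * r`. -/
noncomputable def vmax (g : ℝ) (i j : ℕ) : ℝ := slabMax g (d.x i) (d.x (i + 1)) (d.y (j + 1))

/-- The slope of the free space of the curves with turns `τ` in a cell. -/
def freeSlope (τ : ℕ → ℝ) (i j : ℕ) : ℝ := dir τ (i + 1) * dir τ (d.n + j + 1)

/-- The middle line of the free space of the curves in a cell. -/
def center (τ : ℕ → ℝ) (c : ℝ) (i j : ℕ) : ℝ :=
  d.y j - d.freeSlope τ i j * d.x i +
    dir τ (d.n + j + 1) * (d.walk τ i + c - d.walk τ (d.n + j))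

/-- The test for `CellOK`. -/
def CellTest (τ : ℕ → ℝ) (c : ℝ) (i j : ℕ) : Prop :=
  SlabsAgree (d.slope i j) (d.vmin (d.slope i j) i j) (d.vmax (d.slope i j) i j) (d.lo i j)
    (d.hi i j) (d.freeSlope τ i j) (d.vmin (d.freeSlope τ i j) i j)
    (d.vmax (d.freeSlope τ i j) i j) (d.center τ c i j - d.eps) (d.center τ c i j + d.eps)

variable {d}

theorem IsTurns.freeSlope {τ : ℕ → ℝ} (hτ : d.IsTurns τ) {i j : ℕ} (hi : i < d.n) (hj : j < d.m) :
    d.freeSlope τ i j = 1 ∨ d.freeSlope τ i j = -1 := by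
  rw [CellData.freeSlope]
  rcases hτ.dir (l := i + 1) (by omega) with h | h <;>
    rcases hτ.dir (l := d.n + j + 1) (by omega) with h' | h' <;> rw [h, h'] <;> norm_num

/-- In a cell the difference of the curves is affine with both slopes `±1`. Up to sign it equals the
deviation of `t - g * r` from `center`, so the free space is the slab of half width `ε` around
`center`, and slabs can be compared. -/
theorem Regular.cellOK_iff (hd : d.Regular) {τ : ℕ → ℝ} {c : ℝ} (hτ : d.IsTurns τ) {i j : ℕ}
    (hi : i < d.n) (hj : j < d.m) : d.CellOK τ c i j ↔ d.CellTest τ c i j := by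
  rw [CellTest, vmin, vmin, vmax, vmax, slabsAgree_iff (hd.slope_eq i hi j hj)
    (hτ.freeSlope hi hj) (hd.x_lt hi) (hd.y_lt hj), CellOK]
  refine forall₂_congr fun r _ => forall₂_congr fun t _ => ?_
  rw [Slab]
  refine iff_congr Iff.rfl ?_
  rw [abs_le]
  have key : t - d.freeSlope τ i j * r =
      d.center τ c i j - dir τ (d.n + j + 1) * d.diff τ c i j r t := by
    simp only [CellData.freeSlope, center, diff]
    rcases hτ.dir (l := d.n + j + 1) (by omega) with h | h <;> rw [h] <;> ring
  rw [key]
  rcases hτ.dir (l := d.n + j + 1) (by omega) with h | h <;> rw [h] <;> constructor <;>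
    rintro ⟨h1, h2⟩ <;> constructor <;> linarith

/-! ### Candidates for the offset -/

variable (d)

/-- The cell is neither missed nor covered by its slab. -/
def Mixed (i j : ℕ) : Prop :=
  ¬ SlabMisses (d.vmin (d.slope i j) i j) (d.vmax (d.slope i j) i j) (d.lo i j) (d.hi i j) ∧
  ¬ SlabCovers (d.vmin (d.slope i j) i j) (d.vmax (d.slope i j) i j) (d.lo i j) (d.hi i j)

open Classical in
/-- The middle line that the free space must have in a mixed cell, less its value at the lower left
corner. -/
noncomputable def mixedCenter (i j : ℕ) : ℝ :=
  (if d.vmin (d.slope i j) i j < d.lo i j then d.lo i j + d.eps else d.hi i j - d.eps) -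
    d.y j + d.slope i j * d.x i

/-- The offset determined by a mixed cell. -/
noncomputable def mixedOffset (τ : ℕ → ℝ) (i j : ℕ) : ℝ :=
  dir τ (d.n + j + 1) * d.mixedCenter i j - d.walk τ i + d.walk τ (d.n + j)

variable {d}

/-- In a mixed cell at least one bounding line of the slab is visible, and it must coincide with the
corresponding line of the free space. This gives `center` as `lo + ε` or `hi - ε`, a linear equation
for `c` with coefficient `±1`. -/
theorem Regular.offset_of_mixed (hd : d.Regular) {τ : ℕ → ℝ} {c : ℝ} (hτ : d.IsTurns τ) {i j : ℕ}
    (hi : i < d.n) (hj : j < d.m) (hm : d.Mixed i j) (h : d.CellOK τ c i j) :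
    c = d.mixedOffset τ i j := by
  rw [hd.cellOK_iff hτ hi hj] at h
  obtain ⟨hm1, hm2⟩ := hm
  rcases h with ⟨h, -⟩ | ⟨h, -⟩ | ⟨-, -, hg, h1, h2⟩
  · exact absurd h hm1
  · exact absurd h hm2
  · have hc : d.center τ c i j = d.mixedCenter i j + d.y j - d.slope i j * d.x i := by
      rw [mixedCenter]
      split_ifs with hlt
      · rcases h1 with h1 | h1
        · linarith
        · exact absurd h1.1 (not_le.2 hlt)
      · rcases h2 with h2 | h2
        · linarith
        · exact absurd ⟨not_lt.1 hlt, h2.1⟩ hm2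
    rw [center, ← hg] at hc
    rw [mixedOffset]
    rcases hτ.dir (l := d.n + j + 1) (by omega) with h | h <;> rw [h] at hc ⊢ <;> linarith

/-- If no cell is mixed, then all cells are missed or all cells are covered. -/
theorem Regular.covers_of_not_mixed (hd : d.Regular) {W : ℝ → ℝ → Prop}
    (hW : ∀ i < d.n, ∀ j < d.m, ∀ r ∈ Set.Icc (d.x i) (d.x (i + 1)),
      ∀ t ∈ Set.Icc (d.y j) (d.y (j + 1)), d.Slab i j r t ↔ W r t)
    (hm : ∀ i < d.n, ∀ j < d.m, ¬ d.Mixed i j) :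
    (∀ i < d.n, ∀ j < d.m, ∀ r ∈ Set.Icc (d.x i) (d.x (i + 1)),
      ∀ t ∈ Set.Icc (d.y j) (d.y (j + 1)), ¬ d.Slab i j r t) ∨
    (∀ i < d.n, ∀ j < d.m, ∀ r ∈ Set.Icc (d.x i) (d.x (i + 1)),
      ∀ t ∈ Set.Icc (d.y j) (d.y (j + 1)), d.Slab i j r t) := by
  -- A cell that is not mixed has the color of its lower left corner. These corners are compared
  -- along the bottom row and then up the columns, each next one lying in the preceding closed cell.
  have mono : ∀ i < d.n, ∀ j < d.m, ∀ r ∈ Set.Icc (d.x i) (d.x (i + 1)),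
      ∀ t ∈ Set.Icc (d.y j) (d.y (j + 1)), (W r t ↔ W (d.x i) (d.y j)) := by
    intro i hi j hj r hr t ht
    have hx := hd.x_lt hi
    have hy := hd.y_lt hj
    have h0 := hW i hi j hj (d.x i) ⟨le_rfl, hx.le⟩ (d.y j) ⟨le_rfl, hy.le⟩
    rw [← h0, ← hW i hi j hj r hr t ht]
    have := hm i hi j hj
    rw [Mixed, not_and_or, not_not, not_not] at this
    rcases this with h | h
    · refine iff_of_false (fun hh => ?_) (fun hh => ?_)
      · exact (not_slabMisses_iff (hd.slope_eq i hi j hj) hx hy).2 ⟨r, hr, t, ht, hh⟩ h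
      · exact (not_slabMisses_iff (hd.slope_eq i hi j hj) hx hy).2
          ⟨_, ⟨le_rfl, hx.le⟩, _, ⟨le_rfl, hy.le⟩, hh⟩ h
    · have := (slabCovers_iff (hd.slope_eq i hi j hj) hx hy).1 h
      exact iff_of_true (this r hr t ht) (this _ ⟨le_rfl, hx.le⟩ _ ⟨le_rfl, hy.le⟩)
  have row : ∀ i < d.n, W (d.x i) (d.y 0) ↔ W (d.x 0) (d.y 0) := by
    intro i
    induction i with
    | zero => simp
    | succ i ih =>
      intro hi
      rw [← ih (by omega)]
      exact mono i (by omega) 0 hd.m_pos _ ⟨(hd.x_lt (by omega)).le, le_rfl⟩ _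
        ⟨le_rfl, (hd.y_lt hd.m_pos).le⟩
  have all : ∀ i < d.n, ∀ j < d.m, W (d.x i) (d.y j) ↔ W (d.x 0) (d.y 0) := by
    intro i hi j
    induction j with
    | zero => exact fun _ => row i hi
    | succ j ih =>
      intro hj
      rw [← ih (by omega)]
      exact mono i hi j (by omega) _ ⟨le_rfl, (hd.x_lt hi).le⟩ _
        ⟨(hd.y_lt (by omega)).le, le_rfl⟩
  by_cases h : W (d.x 0) (d.y 0)
  · right
    intro i hi j hj r hr t ht
    rw [hW i hi j hj r hr t ht, mono i hi j hj r hr t ht]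
    exact (all i hi j hj).2 h
  · left
    intro i hi j hj r hr t ht
    rw [hW i hi j hj r hr t ht, mono i hi j hj r hr t ht]
    exact fun hh => h ((all i hi j hj).1 hh)

end CellData

/-! ### Offsets that suffice for given turns -/

namespace CellData

variable {d : CellData}

/-- Each segment stays between its endpoints, so bounds for the vertices are bounds for the whole
curve. -/
theorem walk_interpolate {τ : ℕ → ℝ} (hτ : d.IsTurns τ) {l : ℕ}
    (hl : l < d.n + d.m) {s : ℝ} (h0 : 0 ≤ s) (h1 : s ≤ d.len l) :
    (d.walk τ l ≤ d.walk τ l + dir τ (l + 1) * s ∧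
      d.walk τ l + dir τ (l + 1) * s ≤ d.walk τ (l + 1)) ∨
    (d.walk τ (l + 1) ≤ d.walk τ l + dir τ (l + 1) * s ∧
      d.walk τ l + dir τ (l + 1) * s ≤ d.walk τ l) := by
  rw [walk_succ]
  rcases hτ.dir (l := l + 1) (by omega) with h | h <;> rw [h]
  · left; constructor <;> linarith
  · right; constructor <;> linarith

theorem Regular.abs_walk_le (hd : d.Regular) {τ : ℕ → ℝ} (hτ : d.IsTurns τ) {l : ℕ}
    (hl : l ≤ d.n + d.m) : |d.walk τ l| ≤ d.pos (d.n + d.m) := by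
  refine le_trans ?_ (hd.pos_mono hl le_rfl)
  induction l with
  | zero => simp [walk, pos]
  | succ l ih =>
    rw [walk_succ, pos_succ]
    refine (abs_add_le _ _).trans (add_le_add (ih (by omega)) ?_)
    rcases hτ.dir (l := l + 1) (by omega) with h | h <;>
      simp [h, abs_of_pos (hd.len_pos l (by omega))]

/-- If all cells are covered and the curves are close together for some offset, then they are so for
the largest possible offset. -/
theorem Regular.realizes_of_covers (hd : d.Regular) {τ : ℕ → ℝ} {c M N : ℝ} (hτ : d.IsTurns τ)
    (hc : ∀ i < d.n, ∀ j < d.m, ∀ r ∈ Set.Icc (d.x i) (d.x (i + 1)),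
      ∀ t ∈ Set.Icc (d.y j) (d.y (j + 1)), d.Slab i j r t)
    (h : d.Realizes τ c) (hM : ∀ i ≤ d.n, d.walk τ i ≤ M) (hM' : ∃ i ≤ d.n, M = d.walk τ i)
    (hN : ∀ j ≤ d.m, N ≤ d.walk τ (d.n + j)) (hN' : ∃ j ≤ d.m, N = d.walk τ (d.n + j)) :
    d.Realizes τ (d.eps - M + N) := by
  have vert : ∀ i ≤ d.n, ∀ j ≤ d.m, d.walk τ i + c - d.walk τ (d.n + j) ≤ d.eps := by
    intro i hi j hj
    -- Every vertex is the start of a segment except the last one, which is the end of segment `n -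
    -- 1`.
    obtain ⟨i', hi', hii⟩ : ∃ i' < d.n, i = i' ∨ i = i' + 1 := by
      rcases Nat.lt_or_ge i d.n with h | h
      · exact ⟨i, h, Or.inl rfl⟩
      · exact ⟨d.n - 1, by have := hd.n_pos; omega, by have := hd.n_pos; omega⟩
    obtain ⟨j', hj', hjj⟩ : ∃ j' < d.m, j = j' ∨ j = j' + 1 := by
      rcases Nat.lt_or_ge j d.m with h | h
      · exact ⟨j, h, Or.inl rfl⟩
      · exact ⟨d.m - 1, by have := hd.m_pos; omega, by have := hd.m_pos; omega⟩
    have hx := (hd.x_lt hi').le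
    have hy := (hd.y_lt hj').le
    obtain ⟨r, hr, er⟩ : ∃ r ∈ Set.Icc (d.x i') (d.x (i' + 1)),
        d.walk τ i = d.walk τ i' + dir τ (i' + 1) * (r - d.x i') := by
      rcases hii with rfl | rfl
      · exact ⟨_, ⟨le_rfl, hx⟩, by simp⟩
      · exact ⟨_, ⟨hx, le_rfl⟩, by rw [walk_succ, x_succ]; ring⟩
    obtain ⟨t, ht, et⟩ : ∃ t ∈ Set.Icc (d.y j') (d.y (j' + 1)),
        d.walk τ (d.n + j) = d.walk τ (d.n + j') + dir τ (d.n + j' + 1) * (t - d.y j') := by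
      rcases hjj with rfl | rfl
      · exact ⟨_, ⟨le_rfl, hy⟩, by simp⟩
      · exact ⟨_, ⟨hy, le_rfl⟩, by rw [y_succ, ← add_assoc, walk_succ]; ring⟩
    have := (abs_le.1 ((h i' hi' j' hj' r hr t ht).1 (hc i' hi' j' hj' r hr t ht))).2
    rw [diff] at this
    rw [er, et]
    linarith
  obtain ⟨i₀, hi₀, rfl⟩ := hM'
  obtain ⟨j₀, hj₀, rfl⟩ := hN'
  -- This says that `c` is at most the new offset. Hence the lower bound for the difference
  -- persists, and the upper bound holds because the new offset makes the largest difference of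
  -- vertices equal to `ε`.
  have hv := vert i₀ hi₀ j₀ hj₀
  intro i hi j hj r hr t ht
  refine iff_of_true (hc i hi j hj r hr t ht) ?_
  have h1 := (abs_le.1 ((h i hi j hj r hr t ht).1 (hc i hi j hj r hr t ht))).1
  rw [diff] at h1 ⊢
  have hr' := hr.2
  have ht' := ht.2
  rw [x_succ] at hr'
  rw [y_succ] at ht'
  have a := walk_interpolate hτ (l := i) (by omega) (s := r - d.x i) (by linarith [hr.1])
    (by linarith)
  have b := walk_interpolate hτ (l := d.n + j) (by omega) (s := t - d.y j) (by linarith [ht.1])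
    (by linarith)
  have a1 := hM i hi.le
  have a2 := hM (i + 1) hi
  have b1 := hN j hj.le
  have b2 := hN (j + 1) hj
  rw [← add_assoc] at b2
  rw [abs_le]
  constructor
  · linarith
  · rcases a with a | a <;> rcases b with b | b <;> linarith [a.1, a.2, b.1, b.2]

/-- If all cells are missed, then a large offset works. -/
theorem Regular.realizes_of_misses (hd : d.Regular) {τ : ℕ → ℝ} (hτ : d.IsTurns τ)
    (hc : ∀ i < d.n, ∀ j < d.m, ∀ r ∈ Set.Icc (d.x i) (d.x (i + 1)),
      ∀ t ∈ Set.Icc (d.y j) (d.y (j + 1)), ¬ d.Slab i j r t) :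
    d.Realizes τ (d.eps + 1 + 2 * d.pos (d.n + d.m)) := by
  intro i hi j hj r hr t ht
  refine iff_of_false (hc i hi j hj r hr t ht) fun h => ?_
  have h1 := (abs_le.1 h).2
  rw [diff] at h1
  have hr' := hr.2
  have ht' := ht.2
  rw [x_succ] at hr'
  rw [y_succ] at ht'
  have a := walk_interpolate hτ (l := i) (by omega) (s := r - d.x i) (by linarith [hr.1])
    (by linarith)
  have b := walk_interpolate hτ (l := d.n + j) (by omega) (s := t - d.y j) (by linarith [ht.1])
    (by linarith)
  -- Without the offset, both curves stay within the total length of `0`, so the chosen offset keeps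
  -- the difference at least `ε + 1`.
  have a1 := (abs_le.1 (hd.abs_walk_le hτ (l := i) (by omega))).1
  have a2 := (abs_le.1 (hd.abs_walk_le hτ (l := i + 1) (by omega))).1
  have b1 := (abs_le.1 (hd.abs_walk_le hτ (l := d.n + j) (by omega))).2
  have b2 := (abs_le.1 (hd.abs_walk_le hτ (l := d.n + j + 1) (by omega))).2
  rcases a with a | a <;> rcases b with b | b <;> linarith [a.1, a.2, b.1, b.2]

/-- The offsets that have to be tried. -/
theorem Regular.realizes_candidate (hd : d.Regular) {W : ℝ → ℝ → Prop}
    (hW : ∀ i < d.n, ∀ j < d.m, ∀ r ∈ Set.Icc (d.x i) (d.x (i + 1)),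
      ∀ t ∈ Set.Icc (d.y j) (d.y (j + 1)), d.Slab i j r t ↔ W r t)
    {i₀ j₀ : ℕ} (h₀ : (∃ i < d.n, ∃ j < d.m, d.Mixed i j) → i₀ < d.n ∧ j₀ < d.m ∧ d.Mixed i₀ j₀)
    {τ : ℕ → ℝ} {c M N : ℝ} (hτ : d.IsTurns τ)
    (h : d.Realizes τ c) (hM : ∀ i ≤ d.n, d.walk τ i ≤ M) (hM' : ∃ i ≤ d.n, M = d.walk τ i)
    (hN : ∀ j ≤ d.m, N ≤ d.walk τ (d.n + j)) (hN' : ∃ j ≤ d.m, N = d.walk τ (d.n + j)) :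
    d.Realizes τ (d.mixedOffset τ i₀ j₀) ∨ d.Realizes τ (d.eps - M + N) ∨
      d.Realizes τ (d.eps + 1 + 2 * d.pos (d.n + d.m)) := by
  by_cases hm : ∃ i < d.n, ∃ j < d.m, d.Mixed i j
  · obtain ⟨hi, hj, hmix⟩ := h₀ hm
    left
    rwa [← hd.offset_of_mixed hτ hi hj hmix (h _ hi _ hj)]
  · push Not at hm
    right
    rcases hd.covers_of_not_mixed hW hm with hc | hc
    · exact Or.inr (hd.realizes_of_misses hτ hc)
    · exact Or.inl (hd.realizes_of_covers hτ hc h hM hM' hN hN')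

end CellData

/-! ## Input diagrams -/

theorem partialSum_eq_sum_range {n : ℕ} (f : Fin n → ℝ) (F : ℕ → ℝ) (h : ∀ i : Fin n, f i = F i)
    (i : Fin (n + 1)) : Fin.partialSum f i = ∑ k ∈ Finset.range i, F k := by
  induction i using Fin.induction with
  | zero => simp
  | succ i ih =>
    rw [Fin.partialSum_succ, ih, h i, Fin.val_succ, Finset.sum_range_succ, Fin.val_castSucc]

theorem exists_mem_Icc_succ (f : ℕ → ℝ) {n : ℕ} (hn : 0 < n) {r : ℝ} (h : r ∈ Set.Icc (f 0) (f n)) :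
    ∃ i < n, r ∈ Set.Icc (f i) (f (i + 1)) := by
  induction n with
  | zero => omega
  | succ n ih =>
    by_cases hr : f n ≤ r
    · exact ⟨n, by omega, hr, h.2⟩
    · rcases Nat.eq_zero_or_pos n with rfl | hn'
      · exact absurd h.1 hr
      · obtain ⟨i, hi, hi'⟩ := ih hn' ⟨h.1, (not_le.1 hr).le⟩
        exact ⟨i, by omega, hi'⟩

namespace InputDiagram

variable {n m : ℕ} (D : InputDiagram n m)

open Classical in
/-- The arrays describing an input diagram. -/
noncomputable def cellData : CellData where
  n := n
  m := m
  eps := D.eps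
  len l := if l < n then RealRAM.vec D.width l else RealRAM.vec D.height (l - n)
  slope i j := if h : i < n ∧ j < m then (if D.up ⟨i, h.1⟩ ⟨j, h.2⟩ then 1 else -1) else 1
  lo i j := if h : i < n ∧ j < m then D.lo ⟨i, h.1⟩ ⟨j, h.2⟩ else 0
  hi i j := if h : i < n ∧ j < m then D.hi ⟨i, h.1⟩ ⟨j, h.2⟩ else 0

theorem cellData_len_width (i : Fin n) : D.cellData.len i = D.width i := by
  simp [cellData, RealRAM.vec]

theorem cellData_len_height (j : Fin m) : D.cellData.len (n + j) = D.height j := by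
  simp [cellData, RealRAM.vec]

theorem regular_cellData (hn : 0 < n) (hm : 0 < m) : D.cellData.Regular where
  n_pos := hn
  m_pos := hm
  eps_pos := D.eps_pos
  len_pos := by
    intro l hl
    change l < n + m at hl
    by_cases h : l < n
    · rw [D.cellData_len_width ⟨l, h⟩]; exact D.width_pos _
    · obtain ⟨j, rfl⟩ := Nat.exists_eq_add_of_le (not_lt.1 h)
      rw [D.cellData_len_height ⟨j, by omega⟩]; exact D.height_pos _
  slope_eq := by
    intro i hi j hj
    have hi : i < n := hi
    have hj : j < m := hj
    simp only [cellData, hi, hj, and_self, dite_true]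
    split_ifs <;> simp

theorem xPos_eq (i : Fin (n + 1)) : D.xPos i = D.cellData.x i :=
  partialSum_eq_sum_range _ _ (fun i => (D.cellData_len_width i).symm) i

theorem yPos_eq (j : Fin (m + 1)) : D.yPos j = D.cellData.y j := by
  have := partialSum_eq_sum_range D.height (fun j => D.cellData.len (n + j))
    (fun j => (D.cellData_len_height j).symm) j
  rw [Diagram.yPos, this, CellData.y, CellData.pos, CellData.pos, Finset.sum_range_add]
  simp [cellData]

theorem mem_cell_iff (i : Fin n) (j : Fin m) (z : ℝ × ℝ) : z ∈ D.cell i j ↔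
    z.1 ∈ Set.Icc (D.cellData.x i) (D.cellData.x (i + 1)) ∧
      z.2 ∈ Set.Icc (D.cellData.y j) (D.cellData.y (j + 1)) := by
  rw [Diagram.cell, Set.mem_prod, D.xPos_eq, D.xPos_eq, D.yPos_eq, D.yPos_eq]
  simp

theorem mem_slab_iff (i : Fin n) (j : Fin m) (z : ℝ × ℝ) :
    z ∈ slab (D.up i j) (D.lo i j) (D.hi i j) ↔ D.cellData.Slab i j z.1 z.2 := by
  simp only [slab, CellData.Slab, cellData, Set.mem_ofPred_eq, Fin.is_lt, and_self, dite_true,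
    Fin.eta, Set.mem_Icc]
  cases D.up i j <;> simp

theorem mem_white_iff (i : Fin n) (j : Fin m) {z : ℝ × ℝ} (hz : z ∈ D.cell i j) :
    z ∈ D.white ↔ D.cellData.Slab i j z.1 z.2 := by
  rw [← mem_slab_iff]
  have := Set.ext_iff.1 (D.white_inter_cell i j) z
  simpa [hz] using this

theorem slab_iff_white : ∀ i < D.cellData.n, ∀ j < D.cellData.m,
    ∀ r ∈ Set.Icc (D.cellData.x i) (D.cellData.x (i + 1)),
      ∀ t ∈ Set.Icc (D.cellData.y j) (D.cellData.y (j + 1)),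
        D.cellData.Slab i j r t ↔ (r, t) ∈ D.white := by
  intro i hi j hj r hr t ht
  exact (D.mem_white_iff ⟨i, hi⟩ ⟨j, hj⟩ (z := (r, t))
    ((D.mem_cell_iff ⟨i, hi⟩ ⟨j, hj⟩ _).2 ⟨hr, ht⟩)).symm

theorem exists_mem_cell (hn : 0 < n) (hm : 0 < m) {z : ℝ × ℝ} (hz : z ∈ D.rect) :
    ∃ i j, z ∈ D.cell i j := by
  rw [Diagram.rect, Set.mem_prod, xPos_eq, yPos_eq] at hz
  have hx0 : D.cellData.x 0 = 0 := by simp [CellData.x, CellData.pos]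
  have hy0 : D.cellData.y 0 = 0 := by simp [CellData.y]
  obtain ⟨i, hi, h1⟩ := exists_mem_Icc_succ D.cellData.x hn (r := z.1) (by simpa [hx0] using hz.1)
  obtain ⟨j, hj, h2⟩ := exists_mem_Icc_succ D.cellData.y hm (r := z.2) (by simpa [hy0] using hz.2)
  exact ⟨⟨i, hi⟩, ⟨j, hj⟩, (D.mem_cell_iff _ _ _).2 ⟨h1, h2⟩⟩

theorem cell_subset_rect (hn : 0 < n) (hm : 0 < m) (i : Fin n) (j : Fin m) :
    D.cell i j ⊆ D.rect := by
  have hd := D.regular_cellData hn hm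
  intro z hz
  rw [mem_cell_iff] at hz
  rw [Diagram.rect, Set.mem_prod, xPos_eq, yPos_eq]
  have e : D.cellData.n = n := rfl
  have em : D.cellData.m = m := rfl
  have x0 : (0 : ℝ) ≤ D.cellData.x i := by
    have := hd.pos_mono (k := 0) (l := i) (by omega) (by omega)
    simpa [CellData.x, CellData.pos] using this
  have x1 : D.cellData.x (i + 1) ≤ D.cellData.x n := hd.pos_mono (by omega) (by omega)
  have y0 : (0 : ℝ) ≤ D.cellData.y j := by
    have := hd.pos_mono (k := D.cellData.n) (l := D.cellData.n + j) (by omega) (by omega)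
    simpa [CellData.y] using this
  have y1 : D.cellData.y (j + 1) ≤ D.cellData.y m := by
    have := hd.pos_mono (k := D.cellData.n + (j + 1)) (l := D.cellData.n + m) (by omega) (by omega)
    simpa [CellData.y] using this
  exact ⟨⟨x0.trans hz.1.1, hz.1.2.trans x1⟩, ⟨y0.trans hz.2.1, hz.2.2.trans y1⟩⟩

/-! ### Realization -/

/-- The cells cover the rectangle and the white set lies in it, so the two colorings may be compared
one cell at a time. -/
theorem realizedBy_iff (hn : 0 < n) (hm : 0 < m) {P : Curve n} {Q : Curve m}
    (hP : P.segLength = D.width) (hQ : Q.segLength = D.height) :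
    D.RealizedBy P Q ↔ ∀ (i : Fin n) (j : Fin m), ∀ z ∈ D.cell i j,
      D.cellData.Slab i j z.1 z.2 ↔ |P.param z.1 - Q.param z.2| ≤ D.eps := by
  have hw : (freeSpaceDiagram D.eps P Q).white =
      {z | z ∈ D.rect ∧ |P.param z.1 - Q.param z.2| ≤ D.eps} := by
    simp only [freeSpaceDiagram, hP, hQ, Diagram.rect, Diagram.xPos, Diagram.yPos]
  constructor
  · intro h i j z hz
    rw [← D.mem_white_iff i j hz]
    rw [RealizedBy] at h
    rw [← h, hw]
    simp [D.cell_subset_rect hn hm i j hz]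
  · intro h
    refine Diagram.ext hP hQ ?_
    rw [hw]
    ext z
    constructor
    · rintro ⟨hz, hz'⟩
      obtain ⟨i, j, hij⟩ := D.exists_mem_cell hn hm hz
      rw [D.mem_white_iff i j hij, h i j z hij]
      exact hz'
    · intro hz
      have hz' := D.white_subset hz
      obtain ⟨i, j, hij⟩ := D.exists_mem_cell hn hm hz'
      rw [D.mem_white_iff i j hij, h i j z hij] at hz
      exact ⟨hz', hz⟩

theorem _root_.Curve.param_eq {n : ℕ} (P : Curve n) (F σ : ℕ → ℝ) (hF : ∀ i : Fin n, 0 < F i)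
    (hσ : ∀ i : Fin n, P i.succ - P i.castSucc = σ i * F i) (hlen : ∀ i : Fin n, P.segLength i = F i)
    (i : Fin n) {r : ℝ} (h0 : ∑ k ∈ Finset.range i, F k ≤ r)
    (h1 : r ≤ ∑ k ∈ Finset.range (i + 1), F k) :
    P.param r = P i.castSucc + σ i * (r - ∑ k ∈ Finset.range i, F k) := by
  have hp := partialSum_eq_sum_range P.segLength F hlen i.castSucc
  rw [Fin.val_castSucc] at hp
  rw [Finset.sum_range_succ] at h1
  have hi := hF i
  have := P.param_segment (fun i => (hlen i).symm ▸ hF i) i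
    (s := (r - ∑ k ∈ Finset.range i, F k) / F i) (div_nonneg (by linarith) hi.le)
    ((div_le_one hi).2 (by linarith))
  rw [hp, hlen, div_mul_cancel₀ _ hi.ne', hσ, add_sub_cancel] at this
  rw [this]
  field_simp

/-- Curves whose segments have the directions given by `τ` realize the diagram iff the difference of
their starting points is right. -/
theorem realizedBy_iff_realizes (hn : 0 < n) (hm : 0 < m) {τ : ℕ → ℝ} (hτ : D.cellData.IsTurns τ)
    {P : Curve n} {Q : Curve m} {a b : ℝ} (hP : ∀ i, P i = D.cellData.walk τ i + a)
    (hQ : ∀ j, Q j = D.cellData.walk τ (n + j) + b) :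
    D.RealizedBy P Q ↔ D.cellData.Realizes τ (a - b) := by
  have en : D.cellData.n = n := rfl
  have em : D.cellData.m = m := rfl
  have eeps : D.cellData.eps = D.eps := rfl
  have hd := D.regular_cellData hn hm
  have hP' : ∀ i : Fin n, P i.succ - P i.castSucc =
      CellData.dir τ (i + 1) * D.cellData.len i := by
    intro i
    rw [hP, hP, Fin.val_succ, Fin.val_castSucc, CellData.walk_succ]; ring
  have hQ' : ∀ j : Fin m, Q j.succ - Q j.castSucc =
      CellData.dir τ (n + j + 1) * D.cellData.len (n + j) := by
    intro i
    rw [hQ, hQ, Fin.val_succ, Fin.val_castSucc, ← add_assoc, CellData.walk_succ]; ring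
  have lP : ∀ i : Fin n, P.segLength i = D.cellData.len i := by
    intro i
    have h0 := hd.len_pos i (by omega)
    rw [Curve.segLength, hP']
    rcases hτ.dir (l := i + 1) (by omega) with h | h <;> rw [h] <;> simp [abs_of_pos h0]
  have lQ : ∀ j : Fin m, Q.segLength j = D.cellData.len (n + j) := by
    intro j
    have h0 := hd.len_pos (n + j) (by omega)
    rw [Curve.segLength, hQ']
    rcases hτ.dir (l := n + j + 1) (by omega) with h | h <;> rw [h] <;> simp [abs_of_pos h0]
  rw [D.realizedBy_iff hn hm (funext fun i => (lP i).trans (D.cellData_len_width i))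
    (funext fun j => (lQ j).trans (D.cellData_len_height j))]
  have ySum : ∀ j, D.cellData.y j = ∑ k ∈ Finset.range j, D.cellData.len (n + k) := by
    intro j
    rw [CellData.y, CellData.pos, CellData.pos, Finset.sum_range_add]
    simp [en]
  have key : ∀ (i : Fin n) (j : Fin m) (z : ℝ × ℝ), z ∈ D.cell i j →
      P.param z.1 - Q.param z.2 = D.cellData.diff τ (a - b) i j z.1 z.2 := by
    intro i j z hz
    rw [mem_cell_iff] at hz
    obtain ⟨⟨h1, h2⟩, h3, h4⟩ := hz
    rw [ySum] at h3 h4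
    rw [P.param_eq D.cellData.len (fun i => CellData.dir τ (i + 1))
        (fun i => hd.len_pos i (by omega)) hP' lP i h1 h2,
      Q.param_eq (fun j => D.cellData.len (n + j)) (fun j => CellData.dir τ (n + j + 1))
        (fun j => hd.len_pos (n + j) (by omega)) hQ' lQ j h3 h4, hP, hQ, CellData.diff, ySum]
    simp only [Fin.val_castSucc, en, CellData.x, CellData.pos]
    ring
  constructor
  · intro h i hi j hj r hr t ht
    have hz : (r, t) ∈ D.cell ⟨i, hi⟩ ⟨j, hj⟩ := (D.mem_cell_iff _ _ _).2 ⟨hr, ht⟩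
    rw [h ⟨i, hi⟩ ⟨j, hj⟩ _ hz, key _ _ _ hz, eeps]
  · intro h i j z hz
    rw [key i j z hz]
    have hz' := (D.mem_cell_iff _ _ _).1 hz
    exact h i i.2 j j.2 z.1 hz'.1 z.2 hz'.2

/-- Every realization comes from turns. -/
theorem exists_turns (hn : 0 < n) (hm : 0 < m) {P : Curve n} {Q : Curve m}
    (h : D.RealizedBy P Q) :
    ∃ τ c, (∀ l, τ l = 1 ∨ τ l = -1) ∧ D.cellData.Realizes τ c := by
  have hd := D.regular_cellData hn hm
  have hsP : ∀ i : Fin n, |P i.succ - P i.castSucc| = D.cellData.len i := fun i =>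
    (congrFun (congrArg Diagram.width h) i).trans (D.cellData_len_width i).symm
  have hsQ : ∀ j : Fin m, |Q j.succ - Q j.castSucc| = D.cellData.len (n + j) := fun j =>
    (congrFun (congrArg Diagram.height h) j).trans (D.cellData_len_height j).symm
  have abs_sign : ∀ a : ℝ, ∃ s : ℝ, (s = 1 ∨ s = -1) ∧ a = s * |a| := by
    intro a
    rcases abs_cases a with ⟨h, -⟩ | ⟨h, -⟩
    · exact ⟨1, Or.inl rfl, by linarith⟩
    · exact ⟨-1, Or.inr rfl, by linarith⟩
  obtain ⟨σ, hσ, hσP, hσQ⟩ : ∃ σ : ℕ → ℝ, (∀ l, σ l = 1 ∨ σ l = -1) ∧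
      (∀ i : Fin n, P i.succ - P i.castSucc = σ i * D.cellData.len i) ∧
      (∀ j : Fin m, Q j.succ - Q j.castSucc = σ (n + j) * D.cellData.len (n + j)) := by
    choose s hs hs' using abs_sign
    refine ⟨fun l => if h : l < n then
        s (P (⟨l, h⟩ : Fin n).succ - P (⟨l, h⟩ : Fin n).castSucc) else
        if h : l - n < m then s (Q (⟨l - n, h⟩ : Fin m).succ - Q (⟨l - n, h⟩ : Fin m).castSucc)
        else 1, ?_, ?_, ?_⟩
    · intro l
      dsimp only
      split_ifs
      · exact hs _
      · exact hs _
      · exact Or.inl rfl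
    · intro i
      simp only [Fin.is_lt, dite_true, Fin.eta, ← hsP i]
      exact hs' _
    · intro j
      simp only [add_tsub_cancel_left, Fin.is_lt, dite_true, Fin.eta, ← hsQ j,
        not_lt.2 (Nat.le_add_right n j), dite_false]
      exact hs' _
  have hσσ : ∀ l, σ l * σ l = 1 := fun l => by rcases hσ l with h | h <;> rw [h] <;> norm_num
  -- A turn is the product of consecutive signs; `τ 0` is the first sign itself. At index `n` the
  -- turn relates the last segment of `P` to the first one of `Q`.
  set τ : ℕ → ℝ := fun l => Nat.casesOn l (σ 0) fun k => σ k * σ (k + 1) with hτ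
  have hτ1 : ∀ l, τ l = 1 ∨ τ l = -1 := by
    intro l
    cases l with
    | zero => exact hσ 0
    | succ k =>
      change σ k * σ (k + 1) = 1 ∨ σ k * σ (k + 1) = -1
      rcases hσ k with h | h <;> rcases hσ (k + 1) with h' | h' <;> rw [h, h'] <;> norm_num
  have hdir : ∀ l, CellData.dir τ (l + 1) = σ l := by
    intro l
    induction l with
    | zero => simp [CellData.dir, hτ]
    | succ l ih =>
      rw [CellData.dir_succ, ih]
      change σ l * (σ l * σ (l + 1)) = σ (l + 1)
      rw [← mul_assoc, hσσ, one_mul]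
  -- In the concatenated walk the second curve starts at `walk τ n`, and this has to be taken off
  -- its actual starting point.
  refine ⟨τ, P 0 - (Q 0 - D.cellData.walk τ n), hτ1, ?_⟩
  refine (D.realizedBy_iff_realizes hn hm (fun l _ => hτ1 l) ?_ ?_).1 h
  · intro i
    induction i using Fin.induction with
    | zero => simp [CellData.walk]
    | succ i ih =>
      rw [Fin.val_castSucc] at ih
      rw [Fin.val_succ, CellData.walk_succ, hdir, ← hσP]
      linarith
  · intro j
    induction j using Fin.induction with
    | zero => simp
    | succ j ih =>
      rw [Fin.val_castSucc] at ih
      rw [Fin.val_succ, ← add_assoc, CellData.walk_succ, hdir, ← hσQ]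
      linarith

/-! ### Lines that meet the boundary -/

theorem isClosed_white (hn : 0 < n) (hm : 0 < m) : IsClosed D.white := by
  have : D.white = ⋃ i, ⋃ j, {z | z ∈ D.cell i j ∧ D.cellData.Slab i j z.1 z.2} := by
    ext z
    simp only [Set.mem_iUnion, Set.mem_ofPred_eq]
    constructor
    · intro hz
      obtain ⟨i, j, h⟩ := D.exists_mem_cell hn hm (D.white_subset hz)
      exact ⟨i, j, h, (D.mem_white_iff i j h).1 hz⟩
    · rintro ⟨i, j, h, h'⟩
      exact (D.mem_white_iff i j h).2 h'
  rw [this]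
  refine isClosed_iUnion_of_finite fun i => isClosed_iUnion_of_finite fun j => ?_
  refine IsClosed.inter (isClosed_Icc.prod isClosed_Icc) ?_
  have c : Continuous fun z : ℝ × ℝ => z.2 - D.cellData.slope i j * z.1 := by fun_prop
  exact (isClosed_le continuous_const c).inter (isClosed_le c continuous_const)

/-- A boundary point is white and a limit of gray points of some cell. -/
theorem exists_cell_of_mem_boundary (hn : 0 < n) (hm : 0 < m) {z : ℝ × ℝ}
    (hz : z ∈ D.whiteBoundary) : z ∈ D.white ∧ ∃ (i : Fin n) (j : Fin m), z ∈ D.cell i j ∧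
      z ∈ closure {z | z.1 ∈ Set.Icc (D.cellData.x i) (D.cellData.x (i + 1)) ∧
        z.2 ∈ Set.Icc (D.cellData.y j) (D.cellData.y (j + 1)) ∧
        ¬ D.cellData.Slab i j z.1 z.2} := by
  obtain ⟨h1, h2⟩ := hz
  rw [(D.isClosed_white hn hm).closure_eq] at h1
  refine ⟨h1, ?_⟩
  have : D.rect \ D.white ⊆ ⋃ i : Fin n, ⋃ j : Fin m,
      {z | z.1 ∈ Set.Icc (D.cellData.x i) (D.cellData.x (i + 1)) ∧
        z.2 ∈ Set.Icc (D.cellData.y j) (D.cellData.y (j + 1)) ∧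
        ¬ D.cellData.Slab i j z.1 z.2} := by
    rintro z ⟨hz, hz'⟩
    obtain ⟨i, j, h⟩ := D.exists_mem_cell hn hm hz
    simp only [Set.mem_iUnion]
    have h'' := (D.mem_cell_iff i j z).1 h
    exact ⟨i, j, h''.1, h''.2, fun hh => hz' ((D.mem_white_iff i j h).2 hh)⟩
  -- Closure commutes with finite unions, so the gray points approaching `z` may be taken in a
  -- single cell.
  have h3 := closure_mono this h2
  rw [closure_iUnion_of_finite] at h3
  simp only [closure_iUnion_of_finite, Set.mem_iUnion] at h3
  obtain ⟨i, j, h⟩ := h3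
  refine ⟨i, j, ?_, h⟩
  refine closure_minimal ?_ (isClosed_Icc.prod isClosed_Icc) h
  rintro w ⟨hw1, hw2, -⟩
  exact (D.mem_cell_iff i j w).2 ⟨hw1, hw2⟩

/-- The gray points approaching the boundary point can be taken in one cell. This closed cell meets
the line, so it lies next to it, and the boundary point itself is a candidate that passes the test.
-/
theorem exists_vCrossing (hm : 0 < m) {i : ℕ} (hi : i + 1 < n)
    (h : ¬ Disjoint (D.vLine ⟨i + 1, by omega⟩) D.whiteBoundary) :
    ∃ j < m, ∃ t ∈ D.cellData.vCandidates i j, D.cellData.VCrossing i j t := by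
  have hn : 0 < n := by omega
  have hd := D.regular_cellData hn hm
  have en : D.cellData.n = n := rfl
  have em : D.cellData.m = m := rfl
  rw [Set.not_disjoint_iff] at h
  obtain ⟨⟨r, t⟩, hz, hb⟩ := h
  obtain ⟨hw, i', j, hc, hcl⟩ := D.exists_cell_of_mem_boundary hn hm hb
  have hr : r = D.cellData.x (i + 1) := by
    have := hz.1
    rwa [D.xPos_eq] at this
  subst hr
  obtain ⟨hc1, hc2⟩ := (D.mem_cell_iff _ _ _).1 hc
  have i1 : (i' : ℕ) ≤ i + 1 := by
    by_contra hh
    exact absurd hc1.1 (not_le.2 (hd.pos_lt (not_le.1 hh) (by omega)))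
  have i2 : i ≤ (i' : ℕ) := by
    by_contra hh
    have := hd.pos_lt (k := i' + 1) (l := i + 1) (by omega) (by omega)
    exact absurd hc1.2 (not_le.2 this)
  have hx := hd.x_lt (i := i) (by omega)
  have hx' := hd.x_lt (i := i + 1) (by omega)
  -- The white point belongs to both closed cells next to the line in its row, hence to both slabs.
  have sA := (D.slab_iff_white i (by omega) j (by omega) _ ⟨hx.le, le_rfl⟩ t hc2).2 hw
  have sB := (D.slab_iff_white (i + 1) (by omega) j (by omega) _ ⟨le_rfl, hx'.le⟩ t hc2).2 hw
  refine ⟨j, j.2, ?_⟩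
  rcases (show (i' : ℕ) = i ∨ (i' : ℕ) = i + 1 by omega) with e | e <;> rw [e] at hcl
  · exact crossing_of_mem_closure_left (hd.slope_eq i (by omega) j (by omega)) hc2 sA sB hcl
  · exact crossing_of_mem_closure_right (hd.slope_eq (i + 1) (by omega) j (by omega)) hc2 sA sB hcl

theorem exists_hCrossing (hn : 0 < n) {j : ℕ} (hj : j + 1 < m)
    (h : ¬ Disjoint (D.hLine ⟨j + 1, by omega⟩) D.whiteBoundary) :
    ∃ i < n, ∃ r ∈ D.cellData.hCandidates i j, D.cellData.HCrossing i j r := by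
  have hm : 0 < m := by omega
  have hd := D.regular_cellData hn hm
  have en : D.cellData.n = n := rfl
  have em : D.cellData.m = m := rfl
  rw [Set.not_disjoint_iff] at h
  obtain ⟨⟨r, t⟩, hz, hb⟩ := h
  obtain ⟨hw, i, j', hc, hcl⟩ := D.exists_cell_of_mem_boundary hn hm hb
  have ht : t = D.cellData.y (j + 1) := by
    have := hz.2
    rwa [D.yPos_eq] at this
  subst ht
  obtain ⟨hc1, hc2⟩ := (D.mem_cell_iff _ _ _).1 hc
  have j1 : (j' : ℕ) ≤ j + 1 := by
    by_contra hh
    have := hd.pos_lt (k := n + (j + 1)) (l := n + j') (by omega) (by omega)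
    exact absurd hc2.1 (not_le.2 (sub_lt_sub_right this _))
  have j2 : j ≤ (j' : ℕ) := by
    by_contra hh
    have := hd.pos_lt (k := n + (j' + 1)) (l := n + (j + 1)) (by omega) (by omega)
    exact absurd hc2.2 (not_le.2 (sub_lt_sub_right this _))
  have hy := hd.y_lt (j := j) (by omega)
  have hy' := hd.y_lt (j := j + 1) (by omega)
  have s1 := hd.slope_eq i (by omega) j (by omega)
  have s2 := hd.slope_eq i (by omega) (j + 1) (by omega)
  have sA := (CellData.slabT_iff s1 r _).2
    ((D.slab_iff_white i (by omega) j (by omega) r hc1 _ ⟨hy.le, le_rfl⟩).2 hw)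
  have sB := (CellData.slabT_iff s2 r _).2
    ((D.slab_iff_white i (by omega) (j + 1) (by omega) r hc1 _ ⟨le_rfl, hy'.le⟩).2 hw)
  refine ⟨i, i.2, ?_⟩
  -- Exchanging the coordinates is a homeomorphism, which reduces a horizontal line to the criterion
  -- for vertical lines.
  have hcl' : (D.cellData.y (j + 1), r) ∈ closure {z : ℝ × ℝ |
      z.1 ∈ Set.Icc (D.cellData.y j') (D.cellData.y (j' + 1)) ∧
        z.2 ∈ Set.Icc (D.cellData.x i) (D.cellData.x (i + 1)) ∧
        ¬ D.cellData.Slab i j' z.2 z.1} := by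
    have := (Homeomorph.prodComm ℝ ℝ).preimage_closure {z : ℝ × ℝ |
      z.1 ∈ Set.Icc (D.cellData.x i) (D.cellData.x (i + 1)) ∧
        z.2 ∈ Set.Icc (D.cellData.y j') (D.cellData.y (j' + 1)) ∧
        ¬ D.cellData.Slab i j' z.1 z.2}
    have h' : (D.cellData.y (j + 1), r) ∈ (Homeomorph.prodComm ℝ ℝ) ⁻¹' (closure {z : ℝ × ℝ |
      z.1 ∈ Set.Icc (D.cellData.x i) (D.cellData.x (i + 1)) ∧
        z.2 ∈ Set.Icc (D.cellData.y j') (D.cellData.y (j' + 1)) ∧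
        ¬ D.cellData.Slab i j' z.1 z.2}) := hcl
    rw [this] at h'
    refine closure_mono ?_ h'
    rintro z ⟨z1, z2, z3⟩
    exact ⟨z2, z1, z3⟩
  rcases (show (j' : ℕ) = j ∨ (j' : ℕ) = j + 1 by omega) with e | e <;> rw [e] at hcl'
  · simp only [← CellData.slabT_iff s1] at hcl'
    exact crossing_of_mem_closure_left s1 hc1 sA sB hcl'
  · simp only [← CellData.slabT_iff s2] at hcl'
    exact crossing_of_mem_closure_right s2 hc1 sA sB hcl'

/-- If all turns at lines with crossings are forced, then the number of the others is bounded by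
the number of lines that do not meet the boundary. -/
theorem card_unforced_le (hn : 0 < n) (hm : 0 < m) (forced : ℕ → Prop) [DecidablePred forced]
    (hV : ∀ i, i + 1 < n → ∀ j < m, ∀ t ∈ D.cellData.vCandidates i j, D.cellData.VCrossing i j t →
      forced (i + 1))
    (hH : ∀ i < n, ∀ j, j + 1 < m → ∀ t ∈ D.cellData.hCandidates i j, D.cellData.HCrossing i j t →
      forced (n + j + 1)) :
    ((Finset.range (n + m)).filter fun l => ¬ forced l).card ≤ D.freeLines + 2 := by
  classical
  set V : Finset (Fin (n + 1)) := Finset.univ.filter fun i => Disjoint (D.vLine i) D.whiteBoundary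
  set H : Finset (Fin (m + 1)) := Finset.univ.filter fun j => Disjoint (D.hLine j) D.whiteBoundary
  have hfree : D.freeLines = V.card + H.card := by
    rw [Diagram.freeLines, ← Set.ncard_coe_finset, ← Set.ncard_coe_finset]
    simp [V, H]
  -- The turns `0` and `n` do not belong to inner grid lines: one is the initial direction, the
  -- other links the two curves. They account for the summand `2`.
  have hsub : ((Finset.range (n + m)).filter fun l => ¬ forced l) ⊆
      ({0, n} : Finset ℕ) ∪ (V.image (fun i : Fin (n + 1) => (i : ℕ)) ∪ H.image fun j : Fin (m + 1) => n + (j : ℕ)) := by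
    intro l hl
    rw [Finset.mem_filter, Finset.mem_range] at hl
    obtain ⟨hl, hf⟩ := hl
    simp only [Finset.mem_union, Finset.mem_insert, Finset.mem_singleton, Finset.mem_image]
    by_cases h0 : l = 0
    · exact Or.inl (Or.inl h0)
    by_cases hln : l = n
    · exact Or.inl (Or.inr hln)
    right
    rcases lt_or_gt_of_ne hln with h | h
    · left
      obtain ⟨i, rfl⟩ := Nat.exists_eq_succ_of_ne_zero h0
      refine ⟨⟨i + 1, by omega⟩, ?_, rfl⟩
      rw [Finset.mem_filter]
      refine ⟨Finset.mem_univ _, ?_⟩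
      by_contra hh
      obtain ⟨j, hj, t, ht, hc⟩ := D.exists_vCrossing hm h hh
      exact hf (hV i h j hj t ht hc)
    · right
      obtain ⟨j, rfl⟩ := Nat.exists_eq_add_of_lt h
      refine ⟨⟨j + 1, by omega⟩, ?_, by simp [add_assoc]⟩
      rw [Finset.mem_filter]
      refine ⟨Finset.mem_univ _, ?_⟩
      by_contra hh
      obtain ⟨i, hi, t, ht, hc⟩ := D.exists_hCrossing hn (by omega) hh
      exact hf (hH i hi j (by omega) t ht hc)
  refine (Finset.card_le_card hsub).trans ?_
  refine (Finset.card_union_le _ _).trans ?_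
  have h1 : ({0, n} : Finset ℕ).card ≤ 2 := Finset.card_le_two
  have h2 := Finset.card_union_le (V.image (fun i : Fin (n + 1) => (i : ℕ))) (H.image fun j : Fin (m + 1) => n + (j : ℕ))
  have h3 : (V.image (fun i : Fin (n + 1) => (i : ℕ))).card ≤ V.card := Finset.card_image_le
  have h4 : (H.image fun j : Fin (m + 1) => n + (j : ℕ)).card ≤ H.card := Finset.card_image_le
  omega

end InputDiagram

/-! ## Reasoning about real RAM programs -/

namespace RealRAM

namespace Memory

variable (s : Memory)

theorem setNat_nat_same (a i v k : ℕ) :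
    (s.setNat a i v).nat a k = if k = i then v else s.nat a k := by
  simp [setNat, Function.update_apply]

theorem setNat_nat_ne {a b : ℕ} (h : b ≠ a) (i v : ℕ) : (s.setNat a i v).nat b = s.nat b := by
  simp [setNat, h]

theorem setNat_real (a i v : ℕ) : (s.setNat a i v).real = s.real := rfl

theorem setReal_real_same (a i : ℕ) (v : ℝ) (k : ℕ) :
    (s.setReal a i v).real a k = if k = i then v else s.real a k := by
  simp [setReal, Function.update_apply]

theorem setReal_real_ne {a b : ℕ} (h : b ≠ a) (i : ℕ) (v : ℝ) :
    (s.setReal a i v).real b = s.real b := by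
  simp [setReal, h]

theorem setReal_nat (a i : ℕ) (v : ℝ) : (s.setReal a i v).nat = s.nat := rfl

end Memory

namespace Program

/-- The arrays of natural numbers to which a program may write. -/
def natMods : Program → List ℕ
  | skip => []
  | assignNat a _ _ => [a]
  | assignReal _ _ _ => []
  | seq p q => p.natMods ++ q.natMods
  | branch _ p q => p.natMods ++ q.natMods
  | loop _ p => p.natMods

/-- The arrays of real numbers to which a program may write. -/
def realMods : Program → List ℕ
  | skip => []
  | assignNat _ _ _ => []
  | assignReal a _ _ => [a]
  | seq p q => p.realMods ++ q.realMods
  | branch _ p q => p.realMods ++ q.realMods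
  | loop _ p => p.realMods

/-- The memories agree outside the arrays to which `p` may write. -/
def Frame (p : Program) (s s' : Memory) : Prop :=
  (∀ a, a ∉ p.natMods → s'.nat a = s.nat a) ∧ (∀ a, a ∉ p.realMods → s'.real a = s.real a)

theorem Frame.refl (p : Program) (s : Memory) : p.Frame s s := ⟨fun _ _ => rfl, fun _ _ => rfl⟩

theorem Frame.trans {p : Program} {s s' s'' : Memory} (h : p.Frame s s') (h' : p.Frame s' s'') :
    p.Frame s s'' :=
  ⟨fun a ha => (h'.1 a ha).trans (h.1 a ha), fun a ha => (h'.2 a ha).trans (h.2 a ha)⟩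

theorem Frame.mono {p q : Program} {s s' : Memory} (h : p.Frame s s')
    (h1 : p.natMods ⊆ q.natMods) (h2 : p.realMods ⊆ q.realMods) : q.Frame s s' :=
  ⟨fun a ha => h.1 a fun h => ha (h1 h), fun a ha => h.2 a fun h => ha (h2 h)⟩

/-- There are no loops in the program. -/
def loopFree : Program → Bool
  | skip => true
  | assignNat _ _ _ => true
  | assignReal _ _ _ => true
  | seq p q => p.loopFree && q.loopFree
  | branch _ p q => p.loopFree && q.loopFree
  | loop _ _ => false

/-- A bound for the time of a program without loops. -/
def bound : Program → ℕ
  | skip => 1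
  | assignNat _ i e => i.cost + e.cost + 1
  | assignReal _ i e => i.cost + e.cost + 1
  | seq p q => p.bound + q.bound
  | branch b p q => b.cost + (p.bound + q.bound) + 1
  | loop _ _ => 0

open Classical in
/-- The effect of a program without loops. -/
noncomputable def run : Program → Memory → Memory
  | skip, s => s
  | assignNat a i e, s => s.setNat a (i.eval s) (e.eval s)
  | assignReal a i e, s => s.setReal a (i.eval s) (e.eval s)
  | seq p q, s => q.run (p.run s)
  | branch b p q, s => if b.Holds s then p.run s else q.run s
  | loop _ _, s => s

theorem exists_runs_run (p : Program) (hp : p.loopFree = true) (s : Memory) :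
    ∃ t ≤ p.bound, Runs p s t (p.run s) := by
  induction p generalizing s with
  | skip => exact ⟨_, le_rfl, Runs.skip s⟩
  | assignNat a i e => exact ⟨_, le_rfl, Runs.assignNat a i e s⟩
  | assignReal a i e => exact ⟨_, le_rfl, Runs.assignReal a i e s⟩
  | seq p q ihp ihq =>
    simp only [loopFree, Bool.and_eq_true] at hp
    obtain ⟨t, ht, h⟩ := ihp hp.1 s
    obtain ⟨u, hu, h'⟩ := ihq hp.2 (p.run s)
    exact ⟨_, add_le_add ht hu, h.seq h'⟩
  | branch b p q ihp ihq =>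
    simp only [loopFree, Bool.and_eq_true] at hp
    by_cases hb : b.Holds s
    · obtain ⟨t, ht, h⟩ := ihp hp.1 s
      refine ⟨_, ?_, by simpa [run, hb] using Runs.branch_true (q := q) hb h⟩
      simp only [bound]; omega
    · obtain ⟨t, ht, h⟩ := ihq hp.2 s
      refine ⟨_, ?_, by simpa [run, hb] using Runs.branch_false (p := p) hb h⟩
      simp only [bound]; omega
  | loop b p _ => simp [loopFree] at hp

end Program

/-- Which arrays a program may change is thus a syntactic matter, and preservation of data reduces
to membership in a list of numbers. -/
theorem Runs.frame {p : Program} {s s' : Memory} {t : ℕ} (h : Runs p s t s') : p.Frame s s' := by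
  induction h with
  | skip s => exact Program.Frame.refl _ _
  | assignNat a i e s =>
    refine ⟨fun b hb => ?_, fun _ _ => rfl⟩
    exact Memory.setNat_nat_ne _ (by simpa [Program.natMods] using hb) _ _
  | assignReal a i e s =>
    refine ⟨fun _ _ => rfl, fun b hb => ?_⟩
    exact Memory.setReal_real_ne _ (by simpa [Program.realMods] using hb) _ _
  | seq _ _ ih1 ih2 =>
    exact (ih1.mono (List.subset_append_left _ _) (List.subset_append_left _ _)).trans
      (ih2.mono (List.subset_append_right _ _) (List.subset_append_right _ _))
  | branch_true _ _ ih =>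
    exact ih.mono (List.subset_append_left _ _) (List.subset_append_left _ _)
  | branch_false _ _ ih =>
    exact ih.mono (List.subset_append_right _ _) (List.subset_append_right _ _)
  | loop_false _ => exact Program.Frame.refl _ _
  | loop_true _ _ _ ih1 ih2 => exact (show Program.Frame (.loop _ _) _ _ from ih1).trans ih2

/-- Started with memory `s`, the program halts after time at most `T` with a memory satisfying
`Q`. -/
def Ensures (p : Program) (s : Memory) (T : ℕ) (Q : Memory → Prop) : Prop :=
  ∃ t ≤ T, ∃ s', Runs p s t s' ∧ Q s'

namespace Ensures

variable {p q : Program} {s : Memory} {T U : ℕ} {Q R : Memory → Prop}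

theorem mono (h : Ensures p s T Q) (hT : T ≤ U) (hQ : ∀ s', p.Frame s s' → Q s' → R s') :
    Ensures p s U R := by
  obtain ⟨t, ht, s', hr, hq⟩ := h
  exact ⟨t, ht.trans hT, s', hr, hQ s' hr.frame hq⟩

theorem seq (h : Ensures p s T fun s' => p.Frame s s' → Ensures q s' U Q) :
    Ensures (p.seq q) s (T + U) Q := by
  obtain ⟨t, ht, s', hr, hq⟩ := h
  obtain ⟨u, hu, s'', hr', hq'⟩ := hq hr.frame
  exact ⟨_, add_le_add ht hu, s'', hr.seq hr', hq'⟩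

theorem of_loopFree (hp : p.loopFree = true) (h : p.Frame s (p.run s) → Q (p.run s)) :
    Ensures p s p.bound Q := by
  obtain ⟨t, ht, hr⟩ := p.exists_runs_run hp s
  exact ⟨t, ht, _, hr, h hr.frame⟩

theorem branch {b : Test} (h1 : b.Holds s → Ensures p s T Q) (h2 : ¬ b.Holds s → Ensures q s U Q) :
    Ensures (.branch b p q) s (T + U + b.cost + 1) Q := by
  by_cases hb : b.Holds s
  · obtain ⟨t, ht, s', hr, hq⟩ := h1 hb
    exact ⟨_, by omega, s', hr.branch_true hb, hq⟩
  · obtain ⟨t, ht, s', hr, hq⟩ := h2 hb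
    exact ⟨_, by omega, s', hr.branch_false hb, hq⟩

end Ensures

/-! ### Counting loops -/

/-- `for c := 0 to e - 1 do body`, with the counter in entry `0` of array `c`. -/
def forUp (c : ℕ) (e : NatExpr) (body : Program) : Program :=
  .seq (.assignNat c (.const 0) (.const 0))
    (.loop (.natLE (.add (.read c (.const 0)) (.const 1)) e)
      (.seq body (.assignNat c (.const 0) (.add (.read c (.const 0)) (.const 1)))))

theorem Ensures.forUp {c : ℕ} {e : NatExpr} {body : Program} {s : Memory} {T : ℕ}
    {Q : Memory → Prop} (N : ℕ) (I : ℕ → Memory → Prop) (hc : c ∉ body.natMods)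
    (he : ∀ s', (forUp c e body).Frame s s' → e.eval s' = N)
    (hI : ∀ k s' v, I k s' → I k (s'.setNat c 0 v)) (h0 : I 0 s)
    (step : ∀ k < N, ∀ s', (RealRAM.forUp c e body).Frame s s' → s'.nat c 0 = k → I k s' →
      Ensures body s' T (I (k + 1)))
    (hQ : ∀ s', (RealRAM.forUp c e body).Frame s s' → I N s' → Q s') :
    Ensures (forUp c e body) s (N * (T + e.cost + 20) + (e.cost + 20)) Q := by
  set p := RealRAM.forUp c e body with hp
  have hcp : ∀ s' s'' v, p.Frame s' s'' → p.Frame s' (s''.setNat c 0 v) := by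
    intro s' s'' v h
    refine ⟨fun a ha => ?_, h.2⟩
    rw [Memory.setNat_nat_ne, h.1 a ha]
    rintro rfl
    exact ha (by simp [p, RealRAM.forUp, Program.natMods])
  have hbp : ∀ s' s'', body.Frame s' s'' → p.Frame s' s'' := by
    intro s' s'' h
    refine h.mono (fun a ha => ?_) (fun a ha => ?_)
    · simp [p, RealRAM.forUp, Program.natMods, ha]
    · simp [p, RealRAM.forUp, Program.realMods, ha]
  -- Induction on the number `r` of remaining iterations.
  have main : ∀ r k, k + r = N → ∀ s', p.Frame s s' → s'.nat c 0 = k → I k s' →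
      Ensures (.loop (.natLE (.add (.read c (.const 0)) (.const 1)) e)
        (.seq body (.assignNat c (.const 0) (.add (.read c (.const 0)) (.const 1))))) s'
        (r * (T + e.cost + 20) + (e.cost + 10)) Q := by
    intro r
    induction r with
    | zero =>
      intro k hk s' hF hck hIk
      refine ⟨_, ?_, s', Runs.loop_false ?_, hQ s' hF ?_⟩
      · simp only [Test.cost, NatExpr.cost]; omega
      · simp only [Test.Holds, NatExpr.eval, he s' hF]; omega
      · rwa [← hk]
    | succ r ih =>
      intro k hk s' hF hck hIk
      obtain ⟨t, ht, s1, hr1, hI1⟩ := step k (by omega) s' hF hck hIk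
      have hF1 := hF.trans (hbp _ _ hr1.frame)
      have hc1 : s1.nat c 0 = k := by rw [hr1.frame.1 c hc, hck]
      obtain ⟨u, hu, s2, hr2, hq2⟩ := ih (k + 1) (by omega) (s1.setNat c 0 (k + 1))
        (hcp _ _ _ hF1) (by simp [Memory.setNat_nat_same]) (hI _ _ _ hI1)
      have hr3 := Runs.assignNat c (.const 0) (.add (.read c (.const 0)) (.const 1)) s1
      simp only [NatExpr.eval, hc1] at hr3
      have hb : (Test.natLE (.add (.read c (.const 0)) (.const 1)) e).Holds s' := by
        simp only [Test.Holds, NatExpr.eval, he s' hF]; omega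
      refine ⟨_, ?_, s2, Runs.loop_true hb (hr1.seq hr3) hr2, hq2⟩
      simp only [Test.cost, NatExpr.cost]
      have : (r + 1) * (T + e.cost + 20) = r * (T + e.cost + 20) + (T + e.cost + 20) := by ring
      omega
  obtain ⟨t, ht, s', hr, hq⟩ := main N 0 (by omega) (s.setNat c 0 0)
    (hcp _ _ _ (Program.Frame.refl _ _)) (by simp [Memory.setNat_nat_same]) (hI _ _ _ h0)
  refine ⟨_, ?_, s', (Runs.assignNat c (.const 0) (.const 0) s).seq hr, hq⟩
  simp only [NatExpr.cost]
  omega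

/-- `Ensures.forUp` with a time bound proportional to `M`. -/
theorem Ensures.forUp_linear {c : ℕ} {e : NatExpr} {body : Program} {s : Memory} {T : ℕ}
    {Q : Memory → Prop} {M : ℕ} (N : ℕ) (hM : 0 < M) (hN : N ≤ 2 * M)
    (I : ℕ → Memory → Prop) (hc : c ∉ body.natMods)
    (he : ∀ s', (RealRAM.forUp c e body).Frame s s' → e.eval s' = N)
    (hI : ∀ k s' v, I k s' → I k (s'.setNat c 0 v)) (h0 : I 0 s)
    (step : ∀ k < N, ∀ s', (RealRAM.forUp c e body).Frame s s' → s'.nat c 0 = k → I k s' →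
      Ensures body s' T (I (k + 1)))
    (hQ : ∀ s', (RealRAM.forUp c e body).Frame s s' → I N s' → Q s') :
    Ensures (RealRAM.forUp c e body) s ((2 * (T + e.cost + 20) + (e.cost + 20)) * M) Q := by
  refine (Ensures.forUp N I hc he hI h0 step hQ).mono ?_ fun _ _ h => h
  have h1 : N * (T + e.cost + 20) ≤ 2 * M * (T + e.cost + 20) := Nat.mul_le_mul_right _ hN
  have h2 : (e.cost + 20) * 1 ≤ (e.cost + 20) * M := Nat.mul_le_mul_left _ hM
  nlinarith

/-- `Ensures.forUp_linear` for a body without loops. -/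
theorem Ensures.forUp_run {c : ℕ} {e : NatExpr} {body : Program} {s : Memory}
    {Q : Memory → Prop} {M : ℕ} (N : ℕ) (hM : 0 < M) (hN : N ≤ 2 * M)
    (I : ℕ → Memory → Prop) (hb : body.loopFree = true) (hc : c ∉ body.natMods)
    (he : ∀ s', (RealRAM.forUp c e body).Frame s s' → e.eval s' = N)
    (hI : ∀ k s' v, I k s' → I k (s'.setNat c 0 v)) (h0 : I 0 s)
    (step : ∀ k < N, ∀ s', (RealRAM.forUp c e body).Frame s s' → s'.nat c 0 = k → I k s' →
      body.Frame s' (body.run s') → I (k + 1) (body.run s'))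
    (hQ : ∀ s', (RealRAM.forUp c e body).Frame s s' → I N s' → Q s') :
    Ensures (RealRAM.forUp c e body) s ((2 * (body.bound + e.cost + 20) + (e.cost + 20)) * M) Q :=
  Ensures.forUp_linear N hM hN I hc he hI h0
    (fun k hk s' hF hc hIk => Ensures.of_loopFree hb (step k hk s' hF hc hIk)) hQ

theorem Ensures.seq_run {p q : Program} {s : Memory} {K M : ℕ} {Q : Memory → Prop}
    (hp : p.loopFree = true) (hM : 0 < M)
    (h : p.Frame s (p.run s) → Ensures q (p.run s) (K * M) Q) :
    Ensures (p.seq q) s ((p.bound + K) * M) Q := by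
  refine (Ensures.seq (Ensures.of_loopFree hp fun h1 _ => h h1)).mono ?_ fun _ _ h => h
  rw [Nat.add_mul]
  exact Nat.add_le_add_right (Nat.le_mul_of_pos_right _ hM) _

/-- The number of columns. -/
def nE : NatExpr := .read 0 (.const 0)

/-- The number of rows. -/
def mE : NatExpr := .read 0 (.const 1)

/-- The column counter. -/
def iE : NatExpr := .read 4 (.const 0)

/-- The row counter. -/
def jE : NatExpr := .read 5 (.const 0)

/-- Loop over all cells. -/
def forCells (body : Program) : Program := forUp 4 nE (forUp 5 mE body)

/-- Loop over all cells: `Inv` is an invariant, and `Done i j` is established at the cell in column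
`i` and row `j` and is never destroyed. -/
theorem Ensures.forCells {n m : ℕ} {body : Program} {s : Memory} {T : ℕ} {Q : Memory → Prop}
    (hn : 0 < n) (hm : 0 < m) (Inv : Memory → Prop) (Done : ℕ → ℕ → Memory → Prop)
    (hb0 : 0 ∉ body.natMods) (hb4 : 4 ∉ body.natMods) (hb5 : 5 ∉ body.natMods)
    (hsn : s.nat 0 0 = n) (hsm : s.nat 0 1 = m)
    (hI4 : ∀ s' v, Inv s' → Inv (s'.setNat 4 0 v)) (hI5 : ∀ s' v, Inv s' → Inv (s'.setNat 5 0 v))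
    (hD4 : ∀ i j s' v, Done i j s' → Done i j (s'.setNat 4 0 v))
    (hD5 : ∀ i j s' v, Done i j s' → Done i j (s'.setNat 5 0 v))
    (h0 : Inv s)
    (step : ∀ i < n, ∀ j < m, ∀ s', (RealRAM.forCells body).Frame s s' → s'.nat 4 0 = i →
      s'.nat 5 0 = j → Inv s' → Ensures body s' T fun s'' =>
        Inv s'' ∧ Done i j s'' ∧ ∀ i' < n, ∀ j' < m, Done i' j' s' → Done i' j' s'')
    (hQ : ∀ s', (RealRAM.forCells body).Frame s s' → Inv s' → (∀ i < n, ∀ j < m, Done i j s') →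
      Q s') :
    Ensures (RealRAM.forCells body) s ((T + 150) * (n * m)) Q := by
  have sub : ∀ s' s'', (RealRAM.forUp 5 mE body).Frame s' s'' →
      (RealRAM.forCells body).Frame s' s'' := fun s' s'' h => h.mono
    (fun a ha => by
      simp only [RealRAM.forCells, RealRAM.forUp, Program.natMods, List.mem_append] at ha ⊢; tauto)
    (fun a ha => by
      simp only [RealRAM.forCells, RealRAM.forUp, Program.realMods, List.mem_append] at ha ⊢; tauto)
  have fr0 : ∀ s' s'', (RealRAM.forCells body).Frame s' s'' → s''.nat 0 = s'.nat 0 :=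
    fun s' s'' h => h.1 0 (by simp [RealRAM.forCells, RealRAM.forUp, Program.natMods, hb0])
  refine (Ensures.forUp (T := m * (T + mE.cost + 20) + (mE.cost + 20)) n
    (fun i s' => Inv s' ∧ ∀ i' < i, ∀ j' < m, Done i' j' s') ?_ ?_ ?_ ⟨h0, by simp⟩ ?_ ?_).mono ?_
    fun _ _ h => h
  · simp [RealRAM.forUp, Program.natMods, hb4]
  · intro s' h
    rw [nE, NatExpr.eval, NatExpr.eval, fr0 s s' h, hsn]
  · exact fun k s' v h => ⟨hI4 _ _ h.1, fun i' hi' j' hj' => hD4 _ _ _ _ (h.2 i' hi' j' hj')⟩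
  · intro i hi s' hF hs' hinv
    refine Ensures.forUp m (fun j s'' => Inv s'' ∧ (∀ i' < i, ∀ j' < m, Done i' j' s'') ∧
      ∀ j' < j, Done i j' s'') hb5 ?_ ?_ ⟨hinv.1, hinv.2, by simp⟩ ?_ ?_
    · intro s'' h
      have h' := hF.trans (sub _ _ h)
      rw [mE, NatExpr.eval, NatExpr.eval, fr0 s s'' h', hsm]
    · exact fun k s' v h => ⟨hI5 _ _ h.1, fun i' hi' j' hj' => hD5 _ _ _ _ (h.2.1 i' hi' j' hj'),
        fun j' hj' => hD5 _ _ _ _ (h.2.2 j' hj')⟩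
    · intro j hj s'' hF'' hj'' hinv''
      have h4 : s''.nat 4 0 = i := by
        rw [hF''.1 4 (by simp [RealRAM.forUp, Program.natMods, hb4]), hs']
      refine (step i hi j hj s'' (hF.trans (sub _ _ hF'')) h4 hj'' hinv''.1).mono le_rfl ?_
      rintro s3 - ⟨h1, h2, h3⟩
      refine ⟨h1, fun i' hi' j' hj' => h3 i' (by omega) j' hj' (hinv''.2.1 i' hi' j' hj'),
        fun j' hj' => ?_⟩
      rcases Nat.lt_succ_iff_lt_or_eq.1 hj' with h | rfl
      · exact h3 i hi j' (by omega) (hinv''.2.2 j' h)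
      · exact h2
    · intro s'' _ h
      refine ⟨h.1, fun i' hi' j' hj' => ?_⟩
      rcases Nat.lt_succ_iff_lt_or_eq.1 hi' with h' | rfl
      · exact h.2.1 i' h' j' hj'
      · exact h.2.2 j' hj'
  · exact fun s' hF h => hQ s' hF h.1 h.2
  · simp only [nE, mE, NatExpr.cost]
    have h1 : n * 1 ≤ n * m := Nat.mul_le_mul_left _ hm
    have h2 : 1 ≤ n * m := Nat.mul_pos hn hm
    nlinarith

/-- `Ensures.forCells` for a body without loops. -/
theorem Ensures.forCells_run {n m : ℕ} {body : Program} {s : Memory} {Q : Memory → Prop}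
    (hn : 0 < n) (hm : 0 < m) (Inv : Memory → Prop) (Done : ℕ → ℕ → Memory → Prop)
    (hb : body.loopFree = true)
    (hb0 : 0 ∉ body.natMods) (hb4 : 4 ∉ body.natMods) (hb5 : 5 ∉ body.natMods)
    (hsn : s.nat 0 0 = n) (hsm : s.nat 0 1 = m)
    (hI4 : ∀ s' v, Inv s' → Inv (s'.setNat 4 0 v)) (hI5 : ∀ s' v, Inv s' → Inv (s'.setNat 5 0 v))
    (hD4 : ∀ i j s' v, Done i j s' → Done i j (s'.setNat 4 0 v))
    (hD5 : ∀ i j s' v, Done i j s' → Done i j (s'.setNat 5 0 v))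
    (h0 : Inv s)
    (step : ∀ i < n, ∀ j < m, ∀ s', (RealRAM.forCells body).Frame s s' → s'.nat 4 0 = i →
      s'.nat 5 0 = j → Inv s' → body.Frame s' (body.run s') →
        Inv (body.run s') ∧ Done i j (body.run s') ∧
          ∀ i' < n, ∀ j' < m, Done i' j' s' → Done i' j' (body.run s'))
    (hQ : ∀ s', (RealRAM.forCells body).Frame s s' → Inv s' → (∀ i < n, ∀ j < m, Done i j s') →
      Q s') :
    Ensures (RealRAM.forCells body) s ((body.bound + 150) * (n * m)) Q :=
  Ensures.forCells hn hm Inv Done hb0 hb4 hb5 hsn hsm hI4 hI5 hD4 hD5 h0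
    (fun i hi j hj s' hF hc hc' hIk => Ensures.of_loopFree hb (step i hi j hj s' hF hc hc' hIk)) hQ

end RealRAM

namespace RealRAM

/-! ## Preparation of the input -/

/-- The number of segments. -/
def lenE : NatExpr := .add nE mE

/-- The index `i * m + j` of a cell in the arrays of cells. -/
def cellIx (i j : NatExpr) : NatExpr := .add (.read 3 i) j

/-- Copies the widths to array `5` of real numbers. -/
def copyWidths : Program := forUp 4 nE (.assignReal 5 iE (.read 1 iE))

/-- Copies the heights to array `5` of real numbers, after the widths. -/
def copyHeights : Program := forUp 4 mE (.assignReal 5 (.add nE iE) (.read 2 iE))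

/-- Computes the partial sums of array `5` of real numbers in array `6`. -/
def sumLengths : Program :=
  forUp 4 lenE (.assignReal 6 (.add iE (.const 1)) (.add (.read 6 iE) (.read 5 iE)))

/-- Computes the multiples of `m` in array `3` of natural numbers. -/
def rowOffsets : Program :=
  forUp 4 nE (.assignNat 3 (.add iE (.const 1)) (.add (.read 3 iE) mE))

/-- Computes the slopes of the cells in array `7` of real numbers. -/
def slopes : Program :=
  forCells (.branch (.natLE (.const 1) (.read 1 (cellIx iE jE)))
    (.assignReal 7 (cellIx iE jE) (.const 1)) (.assignReal 7 (cellIx iE jE) (.const (-1))))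

/-- Prepares the arrays that are used in the computation. -/
def prepare : Program :=
  copyWidths.seq (copyHeights.seq (sumLengths.seq (rowOffsets.seq slopes)))

/-- The memory contains the arrays of `d`. -/
structure Ready (d : CellData) (s : Memory) : Prop where
  n_eq : s.nat 0 0 = d.n
  m_eq : s.nat 0 1 = d.m
  row : ∀ i ≤ d.n, s.nat 3 i = i * d.m
  eps : s.real 0 0 = d.eps
  len : ∀ l < d.n + d.m, s.real 5 l = d.len l
  pos : ∀ l ≤ d.n + d.m, s.real 6 l = d.pos l
  slope : ∀ i < d.n, ∀ j < d.m, s.real 7 (i * d.m + j) = d.slope i j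
  lo : ∀ i < d.n, ∀ j < d.m, s.real 3 (i * d.m + j) = d.lo i j
  hi : ∀ i < d.n, ∀ j < d.m, s.real 4 (i * d.m + j) = d.hi i j

/-- The program does not write to the arrays that `Ready` is about. -/
def Program.keepsReady (p : Program) : Bool :=
  (p.natMods.all fun a => a != 0 && a != 3) &&
    p.realMods.all fun a => a != 0 && a != 3 && a != 4 && a != 5 && a != 6 && a != 7

theorem Ready.frame {d : CellData} {s s' : Memory} {p : Program} (h : Ready d s)
    (hF : p.Frame s s') (hp : p.keepsReady = true) : Ready d s' := by
  simp only [Program.keepsReady, Bool.and_eq_true, List.all_eq_true, bne_iff_ne] at hp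
  obtain ⟨hp1, hp2⟩ := hp
  obtain ⟨h1, h2⟩ := hF
  have n0 := h1 0 fun hh => (hp1 0 hh).1 rfl
  have n3 := h1 3 fun hh => (hp1 3 hh).2 rfl
  have r0 := h2 0 fun hh => (hp2 0 hh).1.1.1.1.1 rfl
  have r3 := h2 3 fun hh => (hp2 3 hh).1.1.1.1.2 rfl
  have r4 := h2 4 fun hh => (hp2 4 hh).1.1.1.2 rfl
  have r5 := h2 5 fun hh => (hp2 5 hh).1.1.2 rfl
  have r6 := h2 6 fun hh => (hp2 6 hh).1.2 rfl
  have r7 := h2 7 fun hh => (hp2 7 hh).2 rfl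
  constructor <;> simp only [n0, n3, r0, r3, r4, r5, r6, r7]
  exacts [h.n_eq, h.m_eq, h.row, h.eps, h.len, h.pos, h.slope, h.lo, h.hi]

theorem mat_apply {α : Type} [Zero α] {n m : ℕ} (f : Fin n → Fin m → α) (i : Fin n) (j : Fin m) :
    mat f (i * m + j) = f i j := by
  have hlt : (i : ℕ) * m + j < n * m := by
    have := Nat.mul_le_mul_right m (Nat.succ_le_of_lt i.2)
    have := j.2
    rw [Nat.succ_mul] at *
    omega
  have hm : 0 < m := by have := j.2; omega
  rw [mat, vec, dif_pos hlt]
  congr 1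
  · ext
    simp only [Fin.divNat]
    rw [Nat.mul_comm, Nat.mul_add_div hm, Nat.div_eq_of_lt j.2, add_zero]
  · ext
    simp only [Fin.modNat]
    rw [Nat.mul_comm, Nat.mul_add_mod, Nat.mod_eq_of_lt j.2]

theorem eval_nE (s : Memory) : nE.eval s = s.nat 0 0 := rfl

theorem eval_mE (s : Memory) : mE.eval s = s.nat 0 1 := rfl

theorem eval_iE (s : Memory) : iE.eval s = s.nat 4 0 := rfl

theorem eval_jE (s : Memory) : jE.eval s = s.nat 5 0 := rfl

theorem eval_lenE (s : Memory) : lenE.eval s = s.nat 0 0 + s.nat 0 1 := rfl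

theorem eval_cellIx (s : Memory) (i j : NatExpr) :
    (cellIx i j).eval s = s.nat 3 (i.eval s) + j.eval s := rfl

theorem copyWidths_spec : ∃ K, ∀ {n m : ℕ}, 0 < n → 0 < m → ∀ s : Memory, s.nat 0 0 = n →
    Ensures copyWidths s (K * (n * m)) fun s' => ∀ l < n, s'.real 5 l = s.real 1 l := by
  -- The constant is found by unification with the bound of `Ensures.forUp_run`. It depends only on
  -- the text of the program, since the number of iterations is at most `2 * (n * m)`.
  refine ⟨_, fun {n m} hn hm s hsn => Ensures.forUp_run n
    (Nat.mul_pos hn hm) (by nlinarith) (fun k s' => ∀ l < k, s'.real 5 l = s.real 1 l)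
    rfl (by decide) (fun s' h => ?_) (fun _ _ _ h => h) (by simp) (fun k hk s' hF hc h _ => ?_)
    (fun s' _ h => h)⟩
  · rw [eval_nE, h.1 0 (by decide), hsn]
  · intro l hl
    simp only [Program.run, eval_iE, RealExpr.eval, Memory.setReal_real_same, hc]
    split_ifs with he
    · rw [hF.2 1 (by decide), he]
    · exact h l (by omega)

theorem copyHeights_spec : ∃ K, ∀ {n m : ℕ}, 0 < n → 0 < m → ∀ s : Memory, s.nat 0 0 = n →
    s.nat 0 1 = m → Ensures copyHeights s (K * (n * m)) fun s' =>
      (∀ l < n, s'.real 5 l = s.real 5 l) ∧ ∀ l < m, s'.real 5 (n + l) = s.real 2 l := by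
  refine ⟨_, fun {n m} hn hm s hsn hsm => Ensures.forUp_run m
    (Nat.mul_pos hn hm) (by nlinarith) (fun k s' => (∀ l < n, s'.real 5 l = s.real 5 l) ∧
      ∀ l < k, s'.real 5 (n + l) = s.real 2 l)
    rfl (by decide) (fun s' h => ?_) (fun _ _ _ h => h) (by simp) (fun k hk s' hF hc h _ => ?_)
    (fun s' _ h => h)⟩
  · rw [eval_mE, h.1 0 (by decide), hsm]
  · have hn' : s'.nat 0 0 = n := by rw [hF.1 0 (by decide), hsn]
    simp only [Program.run, eval_iE, eval_nE, NatExpr.eval, RealExpr.eval,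
      Memory.setReal_real_same, hc, hn']
    refine ⟨fun l hl => ?_, fun l hl => ?_⟩
    · rw [if_neg (by omega), h.1 l hl]
    · split_ifs with he
      · rw [hF.2 2 (by decide), Nat.add_left_cancel he]
      · exact h.2 l (by omega)

theorem sumLengths_spec : ∃ K, ∀ {n m : ℕ}, 0 < n → 0 < m → ∀ s : Memory, s.nat 0 0 = n →
    s.nat 0 1 = m → s.real 6 0 = 0 → Ensures sumLengths s (K * (n * m)) fun s' =>
      ∀ l ≤ n + m, s'.real 6 l = ∑ k ∈ Finset.range l, s.real 5 k := by
  refine ⟨_, fun {n m} hn hm s hsn hsm hs0 => Ensures.forUp_run (n + m)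
    (Nat.mul_pos hn hm) (by nlinarith)
    (fun k s' => ∀ l ≤ k, s'.real 6 l = ∑ k ∈ Finset.range l, s.real 5 k)
    rfl (by decide) (fun s' h => ?_) (fun _ _ _ h => h) ?_ (fun k hk s' hF hc h _ => ?_)
    (fun s' _ h => h)⟩
  · rw [eval_lenE, h.1 0 (by decide), hsn, hsm]
  · intro l hl
    obtain rfl : l = 0 := by omega
    simpa using hs0
  · intro l hl
    simp only [Program.run, eval_iE, NatExpr.eval, RealExpr.eval, Memory.setReal_real_same, hc]
    split_ifs with he
    · rw [he, Finset.sum_range_succ, h k le_rfl, hF.2 5 (by decide)]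
    · exact h l (by omega)

/-- The machine cannot multiply natural numbers, so the row starts needed for the indices `i * m +
j` are obtained by repeated addition. -/
theorem rowOffsets_spec : ∃ K, ∀ {n m : ℕ}, 0 < n → 0 < m → ∀ s : Memory, s.nat 0 0 = n →
    s.nat 0 1 = m → s.nat 3 0 = 0 → Ensures rowOffsets s (K * (n * m)) fun s' =>
      ∀ i ≤ n, s'.nat 3 i = i * m := by
  refine ⟨_, fun {n m} hn hm s hsn hsm hs0 => Ensures.forUp_run n
    (Nat.mul_pos hn hm) (by nlinarith) (fun k s' => ∀ i ≤ k, s'.nat 3 i = i * m)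
    rfl (by decide) (fun s' h => ?_) (fun _ _ _ h => h) ?_ (fun k hk s' hF hc h _ => ?_)
    (fun s' _ h => h)⟩
  · rw [eval_nE, h.1 0 (by decide), hsn]
  · intro l hl
    obtain rfl : l = 0 := by omega
    simpa using hs0
  · intro l hl
    have hm' : s'.nat 0 1 = m := by rw [hF.1 0 (by decide), hsm]
    simp only [Program.run, eval_iE, eval_mE, NatExpr.eval, Memory.setNat_nat_same, hc, hm']
    split_ifs with he
    · rw [he, h k le_rfl]; ring
    · exact h l (by omega)

theorem slopes_spec : ∃ K, ∀ {n m : ℕ}, 0 < n → 0 < m → ∀ s : Memory, s.nat 0 0 = n →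
    s.nat 0 1 = m → (∀ i ≤ n, s.nat 3 i = i * m) → Ensures slopes s (K * (n * m)) fun s' =>
      ∀ i < n, ∀ j < m, s'.real 7 (i * m + j) = if 1 ≤ s.nat 1 (i * m + j) then 1 else -1 := by
  refine ⟨_, fun {n m} hn hm s hsn hsm hs3 => Ensures.forCells_run hn hm
    (fun _ => True) (fun i j s' => s'.real 7 (i * m + j) =
      if 1 ≤ s.nat 1 (i * m + j) then 1 else -1) rfl (by decide) (by decide) (by decide) hsn hsm
    (fun _ _ _ => trivial) (fun _ _ _ => trivial) (fun _ _ _ _ h => h) (fun _ _ _ _ h => h) trivial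
    (fun i hi j hj s' hF hci hcj _ _ => ⟨trivial, ?_⟩) (fun s' _ _ h => h)⟩
  have h3 : s'.nat 3 i = i * m := by rw [hF.1 3 (by decide), hs3 i hi.le]
  have h1 : s'.nat 1 = s.nat 1 := hF.1 1 (by decide)
  simp only [Program.run, Test.Holds, eval_iE, eval_jE, eval_cellIx, NatExpr.eval, RealExpr.eval,
    hci, hcj, h3, h1, Rat.cast_one, Rat.cast_neg]
  split_ifs with hb <;> simp only [Memory.setReal_real_same, if_true, true_and]
  · intro i' _ j' _ h
    split_ifs with e1 e2 e2
    · rfl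
    · exact absurd (e1 ▸ hb) e2
    · simpa [e2] using h
    · simpa [e2] using h
  · intro i' _ j' _ h
    split_ifs with e1 e2 e2
    · exact absurd (e1 ▸ e2) hb
    · rfl
    · simpa [e2] using h
    · simpa [e2] using h

theorem prepare_spec : ∃ K, ∀ {n m : ℕ} (D : InputDiagram n m), 0 < n → 0 < m →
    Ensures prepare (load D) (K * (n * m)) (Ready D.cellData) := by
  obtain ⟨K1, h1⟩ := copyWidths_spec
  obtain ⟨K2, h2⟩ := copyHeights_spec
  obtain ⟨K3, h3⟩ := sumLengths_spec
  obtain ⟨K4, h4⟩ := rowOffsets_spec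
  obtain ⟨K5, h5⟩ := slopes_spec
  refine ⟨K1 + (K2 + (K3 + (K4 + K5))), fun {n m} D hn hm => ?_⟩
  simp only [Nat.add_mul]
  have n0 : (load D).nat 0 0 = n := rfl
  have m0 : (load D).nat 0 1 = m := rfl
  refine ((h1 hn hm _ n0).mono le_rfl fun s1 _ g1 F1 => ?_).seq
  have e1 := F1.1 0 (by decide)
  refine ((h2 hn hm s1 (by rw [e1, n0]) (by rw [e1, m0])).mono le_rfl fun s2 _ g2 F2 => ?_).seq
  have e2 := F2.1 0 (by decide)
  refine ((h3 hn hm s2 (by rw [e2, e1, n0]) (by rw [e2, e1, m0]) ?_).mono le_rfl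
    fun s3 _ g3 F3 => ?_).seq
  · rw [F2.2 6 (by decide), F1.2 6 (by decide)]; rfl
  have e3 := F3.1 0 (by decide)
  refine ((h4 hn hm s3 (by rw [e3, e2, e1, n0]) (by rw [e3, e2, e1, m0]) ?_).mono le_rfl
    fun s4 _ g4 F4 => ?_).seq
  · rw [F3.1 3 (by decide), F2.1 3 (by decide), F1.1 3 (by decide)]; rfl
  have e4 := F4.1 0 (by decide)
  refine (h5 hn hm s4 (by rw [e4, e3, e2, e1, n0]) (by rw [e4, e3, e2, e1, m0]) g4).mono le_rfl
    fun s5 F5 g5 => ?_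
  have e5 := F5.1 0 (by decide)
  have up4 : s4.nat 1 = (load D).nat 1 := by
    rw [F4.1 1 (by decide), F3.1 1 (by decide), F2.1 1 (by decide), F1.1 1 (by decide)]
  have cell : ∀ a, a = 0 ∨ a = 3 ∨ a = 4 → s5.real a = (load D).real a := by
    rintro a (rfl | rfl | rfl) <;> rw [F5.2 _ (by decide), F4.2 _ (by decide), F3.2 _ (by decide),
      F2.2 _ (by decide), F1.2 _ (by decide)]
  have len2 : ∀ l < n + m, s2.real 5 l = D.cellData.len l := by
    intro l hl
    by_cases hln : l < n
    · rw [g2.1 l hln, g1 l hln]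
      simp [InputDiagram.cellData, hln, load]
    · obtain ⟨j, rfl⟩ := Nat.exists_eq_add_of_le (not_lt.1 hln)
      rw [g2.2 j (by omega), F1.2 2 (by decide)]
      simp [InputDiagram.cellData, load]
  constructor
  · rw [e5, e4, e3, e2, e1]; rfl
  · rw [e5, e4, e3, e2, e1]; rfl
  · intro i hi
    rw [F5.1 3 (by decide)]
    exact g4 i hi
  · rw [cell 0 (by simp)]
    simp [load, vec, InputDiagram.cellData]
  · intro l hl
    rw [F5.2 5 (by decide), F4.2 5 (by decide), F3.2 5 (by decide)]
    exact len2 l hl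
  · intro l hl
    rw [F5.2 6 (by decide), F4.2 6 (by decide), g3 l hl]
    have hl : l ≤ n + m := hl
    refine Finset.sum_congr rfl fun k hk => len2 k ?_
    have := Finset.mem_range.1 hk
    omega
  · intro i hi j hj
    have hi : i < n := hi
    have hj : j < m := hj
    refine (g5 i hi j hj).trans ?_
    have h1 : s4.nat 1 (i * m + j) = if D.up ⟨i, hi⟩ ⟨j, hj⟩ then 1 else 0 := by
      rw [up4]
      exact mat_apply (fun i j => if D.up i j then 1 else 0) ⟨i, hi⟩ ⟨j, hj⟩
    simp only [h1]
    simp only [InputDiagram.cellData, hi, hj, and_self, dite_true]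
    cases D.up ⟨i, hi⟩ ⟨j, hj⟩ <;> simp
  · intro i hi j hj
    have hi : i < n := hi
    have hj : j < m := hj
    rw [cell 3 (by simp)]
    have := mat_apply D.lo ⟨i, hi⟩ ⟨j, hj⟩
    refine this.trans ?_
    simp [InputDiagram.cellData, hi, hj]
  · intro i hi j hj
    have hi : i < n := hi
    have hj : j < m := hj
    rw [cell 4 (by simp)]
    have := mat_apply D.hi ⟨i, hi⟩ ⟨j, hj⟩
    refine this.trans ?_
    simp [InputDiagram.cellData, hi, hj]

end RealRAM

namespace RealRAM

/-! ## Expressions for the data of a cell -/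

/-- The number `ε`. -/
def epsE : RealExpr := .read 0 (.const 0)

/-- Abscissa of a vertical line. -/
def xE (i : NatExpr) : RealExpr := .read 6 i

/-- Ordinate of a horizontal line. -/
def yE (j : NatExpr) : RealExpr := .sub (.read 6 (.add nE j)) (.read 6 nE)

/-- Slope of a cell. -/
def slopeE (i j : NatExpr) : RealExpr := .read 7 (cellIx i j)

/-- Lower bound of the slab of a cell. -/
def loE (i j : NatExpr) : RealExpr := .read 3 (cellIx i j)

/-- Upper bound of the slab of a cell. -/
def hiE (i j : NatExpr) : RealExpr := .read 4 (cellIx i j)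

/-- Lower bound of the slab of a cell with the coordinates exchanged. -/
def loTE (i j : NatExpr) : RealExpr :=
  .sub (.mul (.sub (.const 0) (slopeE i j)) (.div (.add (loE i j) (hiE i j)) (.const 2)))
    (.div (.sub (hiE i j) (loE i j)) (.const 2))

/-- Upper bound of the slab of a cell with the coordinates exchanged. -/
def hiTE (i j : NatExpr) : RealExpr :=
  .add (.mul (.sub (.const 0) (slopeE i j)) (.div (.add (loE i j) (hiE i j)) (.const 2)))
    (.div (.sub (hiE i j) (loE i j)) (.const 2))

namespace Ready

variable {d : CellData} {s : Memory} {iX jX : NatExpr} {i j : ℕ}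

theorem setNat (h : Ready d s) {a : ℕ} (h0 : a ≠ 0) (h3 : a ≠ 3) (k v : ℕ) :
    Ready d (s.setNat a k v) := by
  constructor <;> simp only [Memory.setNat_nat_ne _ h0.symm, Memory.setNat_nat_ne _ h3.symm,
    Memory.setNat_real]
  exacts [h.n_eq, h.m_eq, h.row, h.eps, h.len, h.pos, h.slope, h.lo, h.hi]

theorem setReal (h : Ready d s) {a : ℕ} (ha : 8 ≤ a) (k : ℕ) (v : ℝ) :
    Ready d (s.setReal a k v) := by
  constructor <;> simp only [Memory.setReal_real_ne _ (show 0 ≠ a by omega),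
    Memory.setReal_real_ne _ (show 3 ≠ a by omega), Memory.setReal_real_ne _ (show 4 ≠ a by omega),
    Memory.setReal_real_ne _ (show 5 ≠ a by omega), Memory.setReal_real_ne _ (show 6 ≠ a by omega),
    Memory.setReal_real_ne _ (show 7 ≠ a by omega), Memory.setReal_nat]
  exacts [h.n_eq, h.m_eq, h.row, h.eps, h.len, h.pos, h.slope, h.lo, h.hi]

theorem eval_epsE (h : Ready d s) : epsE.eval s = d.eps := h.eps

theorem eval_xE (h : Ready d s) (hi : iX.eval s = i) (hi' : i ≤ d.n) : (xE iX).eval s = d.x i := by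
  simp only [xE, RealExpr.eval, hi]
  exact h.pos i (by omega)

theorem eval_yE (h : Ready d s) (hj : jX.eval s = j) (hj' : j ≤ d.m) : (yE jX).eval s = d.y j := by
  simp only [yE, RealExpr.eval, NatExpr.eval, eval_nE, h.n_eq, hj]
  rw [h.pos _ (by omega), h.pos _ (by omega), CellData.y]

theorem eval_cellIx (h : Ready d s) (hi : iX.eval s = i) (hj : jX.eval s = j) (hi' : i < d.n) :
    (cellIx iX jX).eval s = i * d.m + j := by
  rw [RealRAM.eval_cellIx, hi, hj, h.row i hi'.le]

theorem eval_slopeE (h : Ready d s) (hi : iX.eval s = i) (hj : jX.eval s = j) (hi' : i < d.n)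
    (hj' : j < d.m) : (slopeE iX jX).eval s = d.slope i j := by
  rw [slopeE, RealExpr.eval, h.eval_cellIx hi hj hi', h.slope i hi' j hj']

theorem eval_loE (h : Ready d s) (hi : iX.eval s = i) (hj : jX.eval s = j) (hi' : i < d.n)
    (hj' : j < d.m) : (loE iX jX).eval s = d.lo i j := by
  rw [loE, RealExpr.eval, h.eval_cellIx hi hj hi', h.lo i hi' j hj']

theorem eval_hiE (h : Ready d s) (hi : iX.eval s = i) (hj : jX.eval s = j) (hi' : i < d.n)
    (hj' : j < d.m) : (hiE iX jX).eval s = d.hi i j := by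
  rw [hiE, RealExpr.eval, h.eval_cellIx hi hj hi', h.hi i hi' j hj']

theorem eval_loTE (h : Ready d s) (hi : iX.eval s = i) (hj : jX.eval s = j) (hi' : i < d.n)
    (hj' : j < d.m) : (loTE iX jX).eval s = d.loT i j := by
  simp [loTE, RealExpr.eval, h.eval_loE hi hj hi' hj', h.eval_hiE hi hj hi' hj',
    h.eval_slopeE hi hj hi' hj', CellData.loT]

theorem eval_hiTE (h : Ready d s) (hi : iX.eval s = i) (hj : jX.eval s = j) (hi' : i < d.n)
    (hj' : j < d.m) : (hiTE iX jX).eval s = d.hiT i j := by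
  simp [hiTE, RealExpr.eval, h.eval_loE hi hj hi' hj', h.eval_hiE hi hj hi' hj',
    h.eval_slopeE hi hj hi' hj', CellData.hiT]

end Ready

/-! ## Tests -/

/-- Disjunction. -/
def Test.disj (b c : Test) : Test := .neg (.conj (.neg b) (.neg c))

theorem Test.holds_disj (s : Memory) (b c : Test) :
    (b.disj c).Holds s ↔ b.Holds s ∨ c.Holds s := by
  simp only [disj, Holds]; tauto

/-- The test `e < f`. -/
def Test.realLT (e f : RealExpr) : Test := .neg (.realLE f e)

theorem Test.holds_realLT (s : Memory) (e f : RealExpr) :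
    (Test.realLT e f).Holds s ↔ e.eval s < f.eval s := by
  simp only [realLT, Holds, not_le]

/-- The test for `Exits`. -/
def exitsT (k lo hi v : RealExpr) : Test :=
  .disj (.conj (.realLT k (.const 0)) (.realLE v lo)) (.conj (.realLT (.const 0) k) (.realLE hi v))

theorem holds_exitsT (s : Memory) (k lo hi v : RealExpr) :
    (exitsT k lo hi v).Holds s ↔ Exits (k.eval s) (lo.eval s) (hi.eval s) (v.eval s) := by
  simp [exitsT, Exits, Test.holds_disj, Test.holds_realLT, Test.Holds, RealExpr.eval]

/-- The test for `Crossing`. -/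
def crossingT (ga la ha gb lb hb x y y0 y1 : RealExpr) : Test :=
  .conj (.conj (.realLE y0 y) (.realLE y y1)) <|
  .conj (.conj (.realLE la (.sub y (.mul ga x))) (.realLE (.sub y (.mul ga x)) ha)) <|
  .conj (.conj (.realLE lb (.sub y (.mul gb x))) (.realLE (.sub y (.mul gb x)) hb)) <|
  .disj (exitsT ga la ha (.sub y (.mul ga x))) <|
  .disj (exitsT (.sub (.const 0) gb) lb hb (.sub y (.mul gb x))) <|
  .disj (.conj (.realLT y y1)
    (.disj (.realLE ha (.sub y (.mul ga x))) (.realLE hb (.sub y (.mul gb x)))))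
    (.conj (.realLT y0 y)
      (.disj (.realLE (.sub y (.mul ga x)) la) (.realLE (.sub y (.mul gb x)) lb)))

theorem holds_crossingT (s : Memory) (ga la ha gb lb hb x y y0 y1 : RealExpr) :
    (crossingT ga la ha gb lb hb x y y0 y1).Holds s ↔
      Crossing (ga.eval s) (la.eval s) (ha.eval s) (gb.eval s) (lb.eval s) (hb.eval s) (x.eval s)
        (y.eval s) (y0.eval s) (y1.eval s) := by
  simp [crossingT, Crossing, Test.holds_disj, Test.holds_realLT, Test.Holds, RealExpr.eval,
    holds_exitsT]

/-- The test for `ColorChange`. -/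
def colorChangeT (ga la ha gb lb hb x y : RealExpr) : Test :=
  .disj (.conj (exitsT ga la ha (.sub y (.mul ga x)))
      (.neg (exitsT (.sub (.const 0) gb) lb hb (.sub y (.mul gb x)))))
    (.conj (.neg (exitsT ga la ha (.sub y (.mul ga x))))
      (exitsT (.sub (.const 0) gb) lb hb (.sub y (.mul gb x))))

theorem holds_colorChangeT (s : Memory) (ga la ha gb lb hb x y : RealExpr) :
    (colorChangeT ga la ha gb lb hb x y).Holds s ↔
      ColorChange (ga.eval s) (la.eval s) (ha.eval s) (gb.eval s) (lb.eval s) (hb.eval s)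
        (x.eval s) (y.eval s) := by
  simp only [colorChangeT, ColorChange, Test.holds_disj, Test.Holds, RealExpr.eval,
    holds_exitsT, Rat.cast_zero, zero_sub]
  tauto

/-! ## Detection of forced turns -/

/-- The turn `l` is `v` in all realizations. -/
def ForcedTurn (d : CellData) (l : ℕ) (v : ℝ) : Prop :=
  (v = 1 ∨ v = -1) ∧ ∀ τ c, d.IsTurns τ → d.Realizes τ c → τ l = v

/-- Array `2` of natural numbers marks turns that are forced to the values in array `8` of real
numbers. -/
def Sound (d : CellData) (s : Memory) : Prop :=
  ∀ l, s.nat 2 l = 0 ∨ (s.nat 2 l = 1 ∧ ForcedTurn d l (s.real 8 l))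

/-- The memory contains the arrays of `d`, and the counters are at `i` and `j`. -/
def AtCell (d : CellData) (i j : ℕ) (s : Memory) : Prop :=
  Ready d s ∧ iE.eval s = i ∧ jE.eval s = j

/-- If `b` holds, mark the turn `l` as forced, to `1` if `c` holds and to `-1` otherwise. -/
def markIf (b c : Test) (l : NatExpr) : Program :=
  .branch b (.seq (.assignNat 2 l (.const 1))
    (.branch c (.assignReal 8 l (.const 1)) (.assignReal 8 l (.const (-1))))) .skip

/-- A later mark may overwrite the value of an earlier one. Soundness survives even if they differ,
because `ForcedTurn` quantifies over all realizations and two different forced values mean that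
there are none. -/
theorem markIf_run {d : CellData} {i j l : ℕ} {b c : Test} {lX : NatExpr} {B C : Prop}
    (hb : ∀ s, AtCell d i j s → (b.Holds s ↔ B)) (hc : ∀ s, AtCell d i j s → (c.Holds s ↔ C))
    (hl : ∀ s, AtCell d i j s → lX.eval s = l)
    (hf : B → (C → ForcedTurn d l 1) ∧ (¬ C → ForcedTurn d l (-1)))
    {s : Memory} (hs : AtCell d i j s) (hsound : Sound d s) :
    AtCell d i j ((markIf b c lX).run s) ∧ Sound d ((markIf b c lX).run s) ∧
      (∀ k, s.nat 2 k = 1 → ((markIf b c lX).run s).nat 2 k = 1) ∧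
      (B → ((markIf b c lX).run s).nat 2 l = 1) := by
  -- The mark is written before `c` is evaluated; it does not touch the data of the cell, so `c`
  -- still decides `C`.
  have hs1 : AtCell d i j (s.setNat 2 l 1) :=
    ⟨hs.1.setNat (by decide) (by decide) _ _, hs.2.1, hs.2.2⟩
  have hs2 : ∀ v, AtCell d i j ((s.setNat 2 l 1).setReal 8 l v) := fun v =>
    ⟨hs1.1.setReal le_rfl _ _, hs1.2.1, hs1.2.2⟩
  have hsnd : ∀ v, ForcedTurn d l v → Sound d ((s.setNat 2 l 1).setReal 8 l v) := by
    intro v hv k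
    simp only [Memory.setReal_nat, Memory.setNat_nat_same, Memory.setReal_real_same,
      Memory.setNat_real]
    split_ifs with hk
    · exact Or.inr ⟨rfl, hk ▸ hv⟩
    · exact hsound k
  have hmark : ∀ v, (∀ k, s.nat 2 k = 1 → ((s.setNat 2 l 1).setReal 8 l v).nat 2 k = 1) ∧
      (B → ((s.setNat 2 l 1).setReal 8 l v).nat 2 l = 1) := by
    intro v
    simp only [Memory.setReal_nat, Memory.setNat_nat_same, if_true, implies_true, and_true]
    intro k hk
    rw [hk, ite_self]
  have e1 : (Program.assignNat 2 lX (.const 1)).run s = s.setNat 2 l 1 := by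
    simp only [Program.run, NatExpr.eval, hl s hs]
  by_cases h1 : b.Holds s
  · have e2 : (markIf b c lX).run s = (Program.branch c (.assignReal 8 lX (.const 1))
        (.assignReal 8 lX (.const (-1)))).run (s.setNat 2 l 1) := by
      rw [← e1]; exact if_pos h1
    by_cases h2 : c.Holds (s.setNat 2 l 1)
    · have e3 : (markIf b c lX).run s = (s.setNat 2 l 1).setReal 8 l 1 := by
        rw [e2]
        refine (if_pos h2).trans ?_
        simp only [Program.run, hl _ hs1, RealExpr.eval, Rat.cast_one]
      rw [e3]
      exact ⟨hs2 _, hsnd _ ((hf ((hb s hs).1 h1)).1 ((hc _ hs1).1 h2)), hmark _⟩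
    · have e3 : (markIf b c lX).run s = (s.setNat 2 l 1).setReal 8 l (-1) := by
        rw [e2]
        refine (if_neg h2).trans ?_
        simp only [Program.run, hl _ hs1, RealExpr.eval, Rat.cast_neg, Rat.cast_one]
      rw [e3]
      exact ⟨hs2 _, hsnd _ ((hf ((hb s hs).1 h1)).2 fun h => h2 ((hc _ hs1).2 h)), hmark _⟩
  · have e2 : (markIf b c lX).run s = s := if_neg h1
    rw [e2]
    exact ⟨hs, hsound, fun _ h => h, fun h => absurd ((hb s hs).2 h) h1⟩

/-- Marks the turn `l` as forced if one of the points with ordinates `ys` is a crossing. -/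
def markCrossings (ga la ha gb lb hb x y0 y1 : RealExpr) (l : NatExpr) : List RealExpr → Program
  | [] => .skip
  | y :: ys => .seq (markIf (crossingT ga la ha gb lb hb x y y0 y1)
      (colorChangeT ga la ha gb lb hb x y) l) (markCrossings ga la ha gb lb hb x y0 y1 l ys)

theorem markCrossings_run {d : CellData} {i j l : ℕ}
    {gaX laX haX gbX lbX hbX xX y0X y1X : RealExpr} {lX : NatExpr}
    {ga la ha gb lb hb x y0 y1 : ℝ}
    (hga : ∀ s, AtCell d i j s → gaX.eval s = ga) (hla : ∀ s, AtCell d i j s → laX.eval s = la)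
    (hha : ∀ s, AtCell d i j s → haX.eval s = ha) (hgb : ∀ s, AtCell d i j s → gbX.eval s = gb)
    (hlb : ∀ s, AtCell d i j s → lbX.eval s = lb) (hhb : ∀ s, AtCell d i j s → hbX.eval s = hb)
    (hx : ∀ s, AtCell d i j s → xX.eval s = x) (hy0 : ∀ s, AtCell d i j s → y0X.eval s = y0)
    (hy1 : ∀ s, AtCell d i j s → y1X.eval s = y1) (hl : ∀ s, AtCell d i j s → lX.eval s = l)
    (hf : ∀ y, Crossing ga la ha gb lb hb x y y0 y1 →
      (ColorChange ga la ha gb lb hb x y → ForcedTurn d l 1) ∧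
      (¬ ColorChange ga la ha gb lb hb x y → ForcedTurn d l (-1)))
    (ys : List RealExpr) (hys : ∀ yX ∈ ys, ∃ y, ∀ s, AtCell d i j s → yX.eval s = y)
    {s : Memory} (hs : AtCell d i j s) (hsound : Sound d s) :
    let s' := (markCrossings gaX laX haX gbX lbX hbX xX y0X y1X lX ys).run s
    Sound d s' ∧ (∀ k, s.nat 2 k = 1 → s'.nat 2 k = 1) ∧
      ∀ y, (∃ yX ∈ ys, yX.eval s = y) →
        Crossing ga la ha gb lb hb x y y0 y1 → s'.nat 2 l = 1 := by
  induction ys generalizing s with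
  | nil =>
    exact ⟨hsound, fun _ h => h, fun _ ⟨_, h, _⟩ => absurd h List.not_mem_nil⟩
  | cons yX ys ih =>
    obtain ⟨y, hy⟩ := hys yX (by simp)
    obtain ⟨k1, k2, k3, k4⟩ := markIf_run (b := crossingT gaX laX haX gbX lbX hbX xX yX y0X y1X)
      (c := colorChangeT gaX laX haX gbX lbX hbX xX yX) (lX := lX) (fun s hs => by
        rw [holds_crossingT, hga s hs, hla s hs, hha s hs, hgb s hs, hlb s hs, hhb s hs, hx s hs,
          hy s hs, hy0 s hs, hy1 s hs]) (fun s hs => by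
        rw [holds_colorChangeT, hga s hs, hla s hs, hha s hs, hgb s hs, hlb s hs, hhb s hs, hx s hs,
          hy s hs]) hl (hf y) hs hsound
    obtain ⟨h1, h2, h3⟩ := ih (fun yX h => hys yX (List.mem_cons_of_mem _ h)) k1 k2
    refine ⟨h1, fun k hk => h2 k (k3 k hk), ?_⟩
    rintro y' ⟨yX', hmem, hy'⟩ hc
    rcases List.mem_cons.1 hmem with rfl | hmem
    · rw [hy s hs] at hy'
      exact h2 _ (k4 (hy' ▸ hc))
    -- The candidates are evaluated in changing memories, but their values depend only on the data
    -- of the cell.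
    · refine h3 y' ⟨yX', hmem, ?_⟩ hc
      obtain ⟨y'', hy''⟩ := hys yX' (List.mem_cons_of_mem _ hmem)
      rw [hy'' _ k1, ← hy', hy'' _ hs]

/-- Expressions for the possible ordinates of crossings. -/
def candidatesE (ga la ha gb lb hb x : RealExpr) : List RealExpr :=
  [.add la (.mul ga x), .add ha (.mul ga x), .add lb (.mul gb x), .add hb (.mul gb x)]

/-- Marks all turns that are forced at all possible crossings. -/
def markAllCrossings (ga la ha gb lb hb x y0 y1 : RealExpr) (l : NatExpr) : Program :=
  markCrossings ga la ha gb lb hb x y0 y1 l (candidatesE ga la ha gb lb hb x)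

theorem markAllCrossings_run {d : CellData} {i j l : ℕ}
    {gaX laX haX gbX lbX hbX xX y0X y1X : RealExpr} {lX : NatExpr}
    {ga la ha gb lb hb x y0 y1 : ℝ}
    (hga : ∀ s, AtCell d i j s → gaX.eval s = ga) (hla : ∀ s, AtCell d i j s → laX.eval s = la)
    (hha : ∀ s, AtCell d i j s → haX.eval s = ha) (hgb : ∀ s, AtCell d i j s → gbX.eval s = gb)
    (hlb : ∀ s, AtCell d i j s → lbX.eval s = lb) (hhb : ∀ s, AtCell d i j s → hbX.eval s = hb)
    (hx : ∀ s, AtCell d i j s → xX.eval s = x) (hy0 : ∀ s, AtCell d i j s → y0X.eval s = y0)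
    (hy1 : ∀ s, AtCell d i j s → y1X.eval s = y1) (hl : ∀ s, AtCell d i j s → lX.eval s = l)
    (hf : ∀ y, Crossing ga la ha gb lb hb x y y0 y1 →
      (ColorChange ga la ha gb lb hb x y → ForcedTurn d l 1) ∧
      (¬ ColorChange ga la ha gb lb hb x y → ForcedTurn d l (-1)))
    {s : Memory} (hs : AtCell d i j s) (hsound : Sound d s) :
    let s' := (markAllCrossings gaX laX haX gbX lbX hbX xX y0X y1X lX).run s
    Sound d s' ∧ (∀ k, s.nat 2 k = 1 → s'.nat 2 k = 1) ∧
      ∀ y ∈ crossingCandidates ga la ha gb lb hb x,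
        Crossing ga la ha gb lb hb x y y0 y1 → s'.nat 2 l = 1 := by
  have hval : ∀ s, AtCell d i j s → (candidatesE gaX laX haX gbX lbX hbX xX).map (·.eval s) =
      crossingCandidates ga la ha gb lb hb x := by
    intro s hs
    simp only [candidatesE, crossingCandidates, List.map, RealExpr.eval, hga s hs, hla s hs,
      hha s hs, hgb s hs, hlb s hs, hhb s hs, hx s hs]
  obtain ⟨h1, h2, h3⟩ := markCrossings_run hga hla hha hgb hlb hhb hx hy0 hy1 hl hf
    (candidatesE gaX laX haX gbX lbX hbX xX) (by
      intro yX hyX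
      obtain ⟨k, hk, rfl⟩ := List.getElem_of_mem hyX
      refine ⟨(crossingCandidates ga la ha gb lb hb x)[k]'hk, fun s hs => ?_⟩
      simp only [← hval s hs, List.getElem_map]) hs hsound
  refine ⟨h1, h2, fun y hy => h3 y ?_⟩
  rw [← hval s hs] at hy
  simpa using hy

/-- Marks turns between columns. -/
def detectV : Program :=
  forCells (.branch (.natLE (.add iE (.const 2)) nE)
    (markAllCrossings (slopeE iE jE) (loE iE jE) (hiE iE jE)
      (slopeE (.add iE (.const 1)) jE) (loE (.add iE (.const 1)) jE) (hiE (.add iE (.const 1)) jE)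
      (xE (.add iE (.const 1))) (yE jE) (yE (.add jE (.const 1))) (.add iE (.const 1))) .skip)

/-- Marks turns between rows. -/
def detectH : Program :=
  forCells (.branch (.natLE (.add jE (.const 2)) mE)
    (markAllCrossings (slopeE iE jE) (loTE iE jE) (hiTE iE jE)
      (slopeE iE (.add jE (.const 1))) (loTE iE (.add jE (.const 1)))
      (hiTE iE (.add jE (.const 1)))
      (yE (.add jE (.const 1))) (xE iE) (xE (.add iE (.const 1)))
      (.add (.add nE jE) (.const 1))) .skip)

/-- Detection uses the slabs alone. That a crossing determines the turn in every realization is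
`turn_of_vCrossing`, and four candidates per line and row suffice. -/
theorem detectV_spec : ∃ K, ∀ d : CellData, d.Regular → ∀ s, Ready d s → Sound d s →
    Ensures detectV s (K * (d.n * d.m)) fun s' => Ready d s' ∧ Sound d s' ∧
      ∀ i, i + 1 < d.n → ∀ j < d.m, ∀ t ∈ d.vCandidates i j, d.VCrossing i j t →
        s'.nat 2 (i + 1) = 1 := by
  refine ⟨_, fun d hd s hs hsound => Ensures.forCells_run hd.n_pos hd.m_pos (Sound d)
    (fun i j s' => i + 1 < d.n → ∀ t ∈ d.vCandidates i j, d.VCrossing i j t →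
      s'.nat 2 (i + 1) = 1) rfl (by decide) (by decide) (by decide) hs.n_eq hs.m_eq
    (fun _ _ h => h) (fun _ _ h => h) (fun _ _ _ _ h => h) (fun _ _ _ _ h => h) hsound
    (fun i hi j hj s' hF hci hcj hinv _ => ?_)
    (fun s' hF h h' => ⟨hs.frame hF rfl, h, fun i hi j hj => h' i (by omega) j hj hi⟩)⟩
  have hr : Ready d s' := hs.frame hF rfl
  simp only [Program.run]
  split_ifs with hb
  · simp only [Test.Holds, NatExpr.eval, eval_iE, eval_nE, hci, hr.n_eq] at hb
    have ei : ∀ s, AtCell d i j s → (NatExpr.add iE (.const 1)).eval s = i + 1 := fun s h => by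
      simp only [NatExpr.eval, h.2.1]
    have ej : ∀ s, AtCell d i j s → (NatExpr.add jE (.const 1)).eval s = j + 1 := fun s h => by
      simp only [NatExpr.eval, h.2.2]
    obtain ⟨h1, h2, h3⟩ := markAllCrossings_run (d := d) (i := i) (j := j) (l := i + 1)
      (fun s h => h.1.eval_slopeE h.2.1 h.2.2 hi hj) (fun s h => h.1.eval_loE h.2.1 h.2.2 hi hj)
      (fun s h => h.1.eval_hiE h.2.1 h.2.2 hi hj)
      (fun s h => h.1.eval_slopeE (ei s h) h.2.2 (by omega) hj)
      (fun s h => h.1.eval_loE (ei s h) h.2.2 (by omega) hj)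
      (fun s h => h.1.eval_hiE (ei s h) h.2.2 (by omega) hj)
      (fun s h => h.1.eval_xE (ei s h) (by omega)) (fun s h => h.1.eval_yE h.2.2 hj.le)
      (fun s h => h.1.eval_yE (ej s h) hj) ei
      (fun y hy => ⟨fun h => ⟨Or.inl rfl, fun τ c hτ hr =>
        (hd.turn_of_vCrossing hτ hr (by omega) hj hy).1 h⟩, fun h => ⟨Or.inr rfl, fun τ c hτ hr =>
        (hd.turn_of_vCrossing hτ hr (by omega) hj hy).2 h⟩⟩)
      (s := s') ⟨hr, hci, hcj⟩ hinv
    exact ⟨h1, fun _ => h3, fun i' _ j' _ h hi' t ht hc => h2 _ (h hi' t ht hc)⟩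
  · simp only [Test.Holds, NatExpr.eval, eval_iE, eval_nE, hci, hr.n_eq] at hb
    exact ⟨hinv, fun h => absurd h hb, fun _ _ _ _ h => h⟩

theorem detectH_spec : ∃ K, ∀ d : CellData, d.Regular → ∀ s, Ready d s → Sound d s →
    Ensures detectH s (K * (d.n * d.m)) fun s' => Ready d s' ∧ Sound d s' ∧
      (∀ l, s.nat 2 l = 1 → s'.nat 2 l = 1) ∧
      ∀ i < d.n, ∀ j, j + 1 < d.m → ∀ t ∈ d.hCandidates i j, d.HCrossing i j t →
        s'.nat 2 (d.n + j + 1) = 1 := by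
  refine ⟨_, fun d hd s hs hsound => Ensures.forCells_run hd.n_pos hd.m_pos
    (fun s' => Sound d s' ∧ ∀ l, s.nat 2 l = 1 → s'.nat 2 l = 1)
    (fun i j s' => j + 1 < d.m → ∀ t ∈ d.hCandidates i j, d.HCrossing i j t →
      s'.nat 2 (d.n + j + 1) = 1) rfl (by decide) (by decide) (by decide) hs.n_eq hs.m_eq
    (fun _ _ h => h) (fun _ _ h => h) (fun _ _ _ _ h => h) (fun _ _ _ _ h => h)
    ⟨hsound, fun _ h => h⟩
    (fun i hi j hj s' hF hci hcj hinv _ => ?_)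
    (fun s' hF h h' => ⟨hs.frame hF rfl, h.1, h.2, fun i hi j hj => h' i hi j (by omega) hj⟩)⟩
  have hr : Ready d s' := hs.frame hF rfl
  simp only [Program.run]
  split_ifs with hb
  · simp only [Test.Holds, NatExpr.eval, eval_jE, eval_mE, hcj, hr.m_eq] at hb
    have ei : ∀ s, AtCell d i j s → (NatExpr.add iE (.const 1)).eval s = i + 1 := fun s h => by
      simp only [NatExpr.eval, h.2.1]
    have ej : ∀ s, AtCell d i j s → (NatExpr.add jE (.const 1)).eval s = j + 1 := fun s h => by
      simp only [NatExpr.eval, h.2.2]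
    obtain ⟨h1, h2, h3⟩ := markAllCrossings_run (d := d) (i := i) (j := j) (l := d.n + j + 1)
      (fun s h => h.1.eval_slopeE h.2.1 h.2.2 hi hj) (fun s h => h.1.eval_loTE h.2.1 h.2.2 hi hj)
      (fun s h => h.1.eval_hiTE h.2.1 h.2.2 hi hj)
      (fun s h => h.1.eval_slopeE h.2.1 (ej s h) hi (by omega))
      (fun s h => h.1.eval_loTE h.2.1 (ej s h) hi (by omega))
      (fun s h => h.1.eval_hiTE h.2.1 (ej s h) hi (by omega))
      (fun s h => h.1.eval_yE (ej s h) (by omega)) (fun s h => h.1.eval_xE h.2.1 hi.le)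
      (fun s h => h.1.eval_xE (ei s h) hi)
      (lX := .add (.add nE jE) (.const 1))
      (fun s h => by simp only [NatExpr.eval, eval_nE, h.1.n_eq, h.2.2])
      (fun y hy => ⟨fun h => ⟨Or.inl rfl, fun τ c hτ hr =>
        (hd.turn_of_hCrossing hτ hr hi (by omega) hy).1 h⟩, fun h => ⟨Or.inr rfl, fun τ c hτ hr =>
        (hd.turn_of_hCrossing hτ hr hi (by omega) hy).2 h⟩⟩)
      (s := s') ⟨hr, hci, hcj⟩ hinv.1
    exact ⟨⟨h1, fun l hl => h2 l (hinv.2 l hl)⟩, fun _ => h3,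
      fun i' _ j' _ h hi' t ht hc => h2 _ (h hi' t ht hc)⟩
  · simp only [Test.Holds, NatExpr.eval, eval_jE, eval_mE, hcj, hr.m_eq] at hb
    exact ⟨hinv, fun h => absurd h hb, fun _ _ _ _ h => h⟩

end RealRAM

namespace RealRAM

/-! ## Counting the turns that are not forced -/

/-- The number of combinations of the turns before `l` that are not marked in `F`. -/
def weight (F : ℕ → ℕ) (l : ℕ) : ℕ := 2 ^ ((Finset.range l).filter fun k => ¬ 1 ≤ F k).card

theorem weight_zero (F : ℕ → ℕ) : weight F 0 = 1 := by simp [weight]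

/-- The recursion computes the powers of two by doubling, since only addition is available. -/
theorem weight_succ (F : ℕ → ℕ) (l : ℕ) :
    weight F (l + 1) = if 1 ≤ F l then weight F l else weight F l + weight F l := by
  rw [weight, Finset.range_add_one, Finset.filter_insert]
  by_cases h : 1 ≤ F l
  · rw [if_neg (not_not.2 h), if_pos h, weight]
  · rw [if_pos h, if_neg h, Finset.card_insert_of_notMem (by simp), pow_succ, weight]
    ring

/-- Computes `weight` in array `6` of natural numbers. -/
def powers : Program :=
  .seq (.assignNat 6 (.const 0) (.const 1)) <|
  forUp 4 lenE (.branch (.natLE (.const 1) (.read 2 iE))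
    (.assignNat 6 (.add iE (.const 1)) (.read 6 iE))
    (.assignNat 6 (.add iE (.const 1)) (.add (.read 6 iE) (.read 6 iE))))

theorem powers_spec : ∃ K, ∀ d : CellData, d.Regular → ∀ s, Ready d s →
    Ensures powers s (K * (d.n * d.m)) fun s' =>
      ∀ l ≤ d.n + d.m, s'.nat 6 l = weight (s'.nat 2) l := by
  refine ⟨_, fun d hd s hs => Ensures.seq_run rfl (Nat.mul_pos hd.n_pos hd.m_pos) fun F =>
    Ensures.forUp_run (d.n + d.m) (Nat.mul_pos hd.n_pos hd.m_pos)
      (by nlinarith [hd.n_pos, hd.m_pos]) (fun k s' => ∀ l ≤ k, s'.nat 6 l = weight (s.nat 2) l)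
      rfl (by decide) (fun s' h => ?_) (fun _ _ _ h => h) ?_ (fun k hk s' hF hc h _ => ?_)
      (fun s' F' h => ?_)⟩
  · have := (hs.frame F rfl).frame h rfl
    rw [eval_lenE, this.n_eq, this.m_eq]
  · intro l hl
    obtain rfl : l = 0 := by omega
    simp [Program.run, NatExpr.eval, Memory.setNat_nat_same, weight_zero]
  · intro l hl
    have h2 : s'.nat 2 = s.nat 2 := (hF.1 2 (by decide)).trans (F.1 2 (by decide))
    have hw := weight_succ (s.nat 2) k
    simp only [Program.run, Test.Holds, NatExpr.eval, eval_iE, hc, h2]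
    by_cases hl : l = k + 1
    · subst hl
      rw [hw]
      split_ifs <;> simp [Memory.setNat_nat_same, h k le_rfl]
    · split_ifs <;> simp only [Memory.setNat_nat_same, hl, if_false] <;> exact h l (by omega)
  · rwa [F'.1 2 (by decide), F.1 2 (by decide)]

/-! ## A mixed cell -/

/-- Expression for `slabMin`. -/
def slabMinE (g x0 x1 y0 : RealExpr) : RealExpr :=
  .sub (.sub y0 (.mul g (.div (.add x0 x1) (.const 2)))) (.div (.sub x1 x0) (.const 2))

/-- Expression for `slabMax`. -/
def slabMaxE (g x0 x1 y1 : RealExpr) : RealExpr :=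
  .add (.sub y1 (.mul g (.div (.add x0 x1) (.const 2)))) (.div (.sub x1 x0) (.const 2))

/-- Expression for `CellData.vmin`. -/
def vminE (g : RealExpr) (i j : NatExpr) : RealExpr :=
  slabMinE g (xE i) (xE (.add i (.const 1))) (yE j)

/-- Expression for `CellData.vmax`. -/
def vmaxE (g : RealExpr) (i j : NatExpr) : RealExpr :=
  slabMaxE g (xE i) (xE (.add i (.const 1))) (yE (.add j (.const 1)))

theorem Ready.eval_vminE {d : CellData} {s : Memory} {iX jX : NatExpr} {i j : ℕ} {g : RealExpr}
    (h : Ready d s) (hi : iX.eval s = i) (hj : jX.eval s = j) (hi' : i < d.n) (hj' : j < d.m) :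
    (vminE g iX jX).eval s = d.vmin (g.eval s) i j := by
  have h1 := h.eval_xE (iX := .add iX (.const 1)) (i := i + 1)
    (by simp only [NatExpr.eval, hi]) hi'
  simp only [vminE, slabMinE, CellData.vmin, slabMin, RealExpr.eval, h.eval_xE hi hi'.le, h1,
    h.eval_yE hj hj'.le, Rat.cast_ofNat]

theorem Ready.eval_vmaxE {d : CellData} {s : Memory} {iX jX : NatExpr} {i j : ℕ} {g : RealExpr}
    (h : Ready d s) (hi : iX.eval s = i) (hj : jX.eval s = j) (hi' : i < d.n) (hj' : j < d.m) :
    (vmaxE g iX jX).eval s = d.vmax (g.eval s) i j := by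
  have h1 := h.eval_xE (iX := .add iX (.const 1)) (i := i + 1)
    (by simp only [NatExpr.eval, hi]) hi'
  have h2 := h.eval_yE (jX := .add jX (.const 1)) (j := j + 1)
    (by simp only [NatExpr.eval, hj]) hj'
  simp only [vmaxE, slabMaxE, CellData.vmax, slabMax, RealExpr.eval, h.eval_xE hi hi'.le, h1,
    h2, Rat.cast_ofNat]

/-- The test for `SlabMisses`. -/
def missesT (vn vx lo hi : RealExpr) : Test :=
  .disj (.realLT hi lo) (.disj (.realLT hi vn) (.realLT vx lo))

theorem holds_missesT (s : Memory) (vn vx lo hi : RealExpr) : (missesT vn vx lo hi).Holds s ↔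
    SlabMisses (vn.eval s) (vx.eval s) (lo.eval s) (hi.eval s) := by
  simp only [missesT, SlabMisses, Test.holds_disj, Test.holds_realLT]

/-- The test for `SlabCovers`. -/
def coversT (vn vx lo hi : RealExpr) : Test := .conj (.realLE lo vn) (.realLE vx hi)

theorem holds_coversT (s : Memory) (vn vx lo hi : RealExpr) : (coversT vn vx lo hi).Holds s ↔
    SlabCovers (vn.eval s) (vx.eval s) (lo.eval s) (hi.eval s) := by
  simp only [coversT, SlabCovers, Test.Holds]

/-- The test for `CellData.Mixed`. -/
def mixedT (i j : NatExpr) : Test :=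
  .conj (.neg (missesT (vminE (slopeE i j) i j) (vmaxE (slopeE i j) i j) (loE i j) (hiE i j)))
    (.neg (coversT (vminE (slopeE i j) i j) (vmaxE (slopeE i j) i j) (loE i j) (hiE i j)))

theorem Ready.holds_mixedT {d : CellData} {s : Memory} {iX jX : NatExpr} {i j : ℕ}
    (h : Ready d s) (hi : iX.eval s = i) (hj : jX.eval s = j) (hi' : i < d.n) (hj' : j < d.m) :
    (mixedT iX jX).Holds s ↔ d.Mixed i j := by
  simp only [mixedT, Test.Holds, holds_missesT, holds_coversT, h.eval_vminE hi hj hi' hj',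
    h.eval_vmaxE hi hj hi' hj', h.eval_slopeE hi hj hi' hj', h.eval_loE hi hj hi' hj',
    h.eval_hiE hi hj hi' hj', CellData.Mixed]

/-- The stored column. -/
def i0E : NatExpr := .read 10 (.const 0)

/-- The stored row. -/
def j0E : NatExpr := .read 11 (.const 0)

/-- Stores the column and the row of a mixed cell, if there is one. -/
def findMixed : Program :=
  forCells (.branch (mixedT iE jE)
    (.seq (.assignNat 10 (.const 0) iE) (.assignNat 11 (.const 0) jE)) .skip)

/-- Stores `CellData.mixedCenter` of the stored cell. -/
def storeCenter : Program :=
  .branch (.realLT (vminE (slopeE i0E j0E) i0E j0E) (loE i0E j0E))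
    (.assignReal 12 (.const 0) (.add (.sub (.add (loE i0E j0E) epsE) (yE j0E))
      (.mul (slopeE i0E j0E) (xE i0E))))
    (.assignReal 12 (.const 0) (.add (.sub (.sub (hiE i0E j0E) epsE) (yE j0E))
      (.mul (slopeE i0E j0E) (xE i0E))))

/-- If no cell is mixed, the stored cell remains the initial one. The index bounds are part of the
conclusion so that the offset derived from the stored cell can be computed in any case; it is then
just one more candidate to be refuted or confirmed. -/
theorem findMixed_spec : ∃ K, ∀ d : CellData, d.Regular → ∀ s, Ready d s →
    s.nat 10 0 < d.n → s.nat 11 0 < d.m →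
    Ensures findMixed s (K * (d.n * d.m)) fun s' => s'.nat 10 0 < d.n ∧ s'.nat 11 0 < d.m ∧
      ((∃ i < d.n, ∃ j < d.m, d.Mixed i j) → d.Mixed (s'.nat 10 0) (s'.nat 11 0)) := by
  refine ⟨_, fun d hd s hs h10 h11 => Ensures.forCells_run hd.n_pos hd.m_pos
    (fun s' => s'.nat 10 0 < d.n ∧ s'.nat 11 0 < d.m)
    (fun i j s' => d.Mixed i j → d.Mixed (s'.nat 10 0) (s'.nat 11 0)) rfl (by decide) (by decide)
    (by decide) hs.n_eq hs.m_eq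
    (fun _ _ h => h) (fun _ _ h => h) (fun _ _ _ _ h => h) (fun _ _ _ _ h => h) ⟨h10, h11⟩
    (fun i hi j hj s' hF hci hcj hinv _ => ?_)
    (fun s' _ h h' => ⟨h.1, h.2, fun ⟨i, hi, j, hj, hm⟩ => h' i hi j hj hm⟩)⟩
  have hr : Ready d s' := hs.frame hF rfl
  have ht := hr.holds_mixedT (iX := iE) (jX := jE) hci hcj hi hj
  simp only [Program.run]
  split_ifs with hb
  · rw [ht] at hb
    simp [eval_iE, eval_jE, NatExpr.eval, Memory.setNat_nat_same, Memory.setNat_nat_ne, hci, hcj,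
      hi, hj, hb]
  · rw [ht] at hb
    exact ⟨hinv, fun h => absurd h hb, fun _ _ _ _ h => h⟩

theorem storeCenter_run {d : CellData} {s : Memory} (hs : Ready d s) (hi : s.nat 10 0 < d.n)
    (hj : s.nat 11 0 < d.m) :
    (storeCenter.run s).real 12 0 = d.mixedCenter (s.nat 10 0) (s.nat 11 0) := by
  have e1 : i0E.eval s = s.nat 10 0 := rfl
  have e2 : j0E.eval s = s.nat 11 0 := rfl
  have hv : (Test.realLT (vminE (slopeE i0E j0E) i0E j0E) (loE i0E j0E)).Holds s ↔
      d.vmin (d.slope (s.nat 10 0) (s.nat 11 0)) (s.nat 10 0) (s.nat 11 0) <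
        d.lo (s.nat 10 0) (s.nat 11 0) := by
    rw [Test.holds_realLT, hs.eval_vminE e1 e2 hi hj, hs.eval_slopeE e1 e2 hi hj,
      hs.eval_loE e1 e2 hi hj]
  rw [CellData.mixedCenter]
  simp only [storeCenter, Program.run]
  split_ifs with h1 h2 h2
  · simp only [RealExpr.eval, hs.eval_slopeE e1 e2 hi hj, hs.eval_loE e1 e2 hi hj,
      hs.eval_yE e2 hj.le, hs.eval_xE e1 hi.le, hs.eval_epsE, NatExpr.eval,
      Memory.setReal_real_same, if_true]
  · exact absurd (hv.1 h1) h2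
  · exact absurd (hv.2 h2) h1
  · simp only [RealExpr.eval, hs.eval_slopeE e1 e2 hi hj, hs.eval_hiE e1 e2 hi hj,
      hs.eval_yE e2 hj.le, hs.eval_xE e1 hi.le, hs.eval_epsE, NatExpr.eval,
      Memory.setReal_real_same, if_true]

/-! ## The state before the search -/

/-- All that is computed before the search. -/
structure Prepared (d : CellData) (s : Memory) : Prop where
  ready : Ready d s
  sound : Sound d s
  pow : ∀ l ≤ d.n + d.m, s.nat 6 l = weight (s.nat 2) l
  i0_lt : s.nat 10 0 < d.n
  j0_lt : s.nat 11 0 < d.m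
  mixed : (∃ i < d.n, ∃ j < d.m, d.Mixed i j) → d.Mixed (s.nat 10 0) (s.nat 11 0)
  center : s.real 12 0 = d.mixedCenter (s.nat 10 0) (s.nat 11 0)

/-- The program does not write to the arrays that `Prepared` is about. -/
def Program.keepsPrepared (p : Program) : Bool :=
  p.keepsReady && (p.natMods.all fun a => a != 2 && a != 6 && a != 10 && a != 11) &&
    p.realMods.all fun a => a != 8 && a != 12

theorem Prepared.frame {d : CellData} {s s' : Memory} {p : Program} (h : Prepared d s)
    (hF : p.Frame s s') (hp : p.keepsPrepared = true) : Prepared d s' := by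
  simp only [Program.keepsPrepared, Bool.and_eq_true, List.all_eq_true, bne_iff_ne] at hp
  obtain ⟨⟨hp0, hp1⟩, hp2⟩ := hp
  have n2 := hF.1 2 fun hh => (hp1 2 hh).1.1.1 rfl
  have n6 := hF.1 6 fun hh => (hp1 6 hh).1.1.2 rfl
  have n10 := hF.1 10 fun hh => (hp1 10 hh).1.2 rfl
  have n11 := hF.1 11 fun hh => (hp1 11 hh).2 rfl
  have r8 := hF.2 8 fun hh => (hp2 8 hh).1 rfl
  have r12 := hF.2 12 fun hh => (hp2 12 hh).2 rfl
  constructor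
  · exact h.ready.frame hF hp0
  · intro l
    rw [n2, r8]
    exact h.sound l
  all_goals simp only [n2, n6, n10, n11, r12]
  exacts [h.pow, h.i0_lt, h.j0_lt, h.mixed, h.center]

/-- Prepares the search. -/
def prepareSearch : Program :=
  prepare.seq (detectV.seq (detectH.seq (powers.seq (findMixed.seq storeCenter))))

theorem prepareSearch_spec : ∃ K, ∀ {n m : ℕ} (D : InputDiagram n m), 0 < n → 0 < m →
    Ensures prepareSearch (load D) (K * (n * m)) fun s => Prepared D.cellData s ∧
      weight (s.nat 2) (n + m) ≤ 4 * 2 ^ D.freeLines ∧ s.nat 12 0 = 0 := by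
  obtain ⟨K1, h1⟩ := prepare_spec
  obtain ⟨K2, h2⟩ := detectV_spec
  obtain ⟨K3, h3⟩ := detectH_spec
  obtain ⟨K4, h4⟩ := powers_spec
  obtain ⟨K5, h5⟩ := findMixed_spec
  refine ⟨K1 + (K2 + (K3 + (K4 + (K5 + storeCenter.bound)))), fun {n m} D hn hm => ?_⟩
  have hd := D.regular_cellData hn hm
  have hM : 0 < n * m := Nat.mul_pos hn hm
  simp only [Nat.add_mul]
  refine ((h1 D hn hm).mono le_rfl fun s1 _ r1 F1 => ?_).seq
  refine ((h2 _ hd s1 r1 ?_).mono le_rfl fun s2 _ g2 F2 => ?_).seq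
  · intro l
    rw [F1.1 2 (by decide)]
    exact Or.inl rfl
  obtain ⟨r2, sd2, g2⟩ := g2
  refine ((h3 _ hd s2 r2 sd2).mono le_rfl fun s3 _ g3 F3 => ?_).seq
  obtain ⟨r3, sd3, g3', g3⟩ := g3
  refine ((h4 _ hd s3 r3).mono le_rfl fun s4 _ g4 F4 => ?_).seq
  have r4 := r3.frame F4 rfl
  have z : ∀ a, a = 10 ∨ a = 11 ∨ a = 12 → s4.nat a = fun _ => 0 := by
    rintro a (rfl | rfl | rfl) <;> rw [F4.1 _ (by decide), F3.1 _ (by decide), F2.1 _ (by decide),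
      F1.1 _ (by decide)] <;> rfl
  refine ((h5 _ hd s4 r4 ?_ ?_).mono le_rfl fun s5 F5' g5 F5 => ?_).seq
  · rw [z 10 (by simp)]; exact hn
  · rw [z 11 (by simp)]; exact hm
  have r5 := r4.frame F5 rfl
  refine (Ensures.of_loopFree rfl fun F6 => ?_).mono (Nat.le_mul_of_pos_right _ hM) fun _ _ h => h
  have hc := storeCenter_run r5 g5.1 g5.2.1
  have e2 : (storeCenter.run s5).nat 2 = s3.nat 2 := by
    rw [F6.1 2 (by decide), F5.1 2 (by decide), F4.1 2 (by decide)]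
  have e8 : (storeCenter.run s5).real 8 = s3.real 8 := by
    rw [F6.2 8 (by decide), F5.2 8 (by decide), F4.2 8 (by decide)]
  have e10 : (storeCenter.run s5).nat 10 = s5.nat 10 := F6.1 10 (by decide)
  have e11 : (storeCenter.run s5).nat 11 = s5.nat 11 := F6.1 11 (by decide)
  refine ⟨⟨r5.frame F6 rfl, ?_, ?_, ?_, ?_, ?_, ?_⟩, ?_, ?_⟩
  · intro l
    rw [e2, e8]
    exact sd3 l
  · intro l hl
    rw [e2, F6.1 6 (by decide), F5.1 6 (by decide), g4 l hl, F4.1 2 (by decide)]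
  · rw [e10]; exact g5.1
  · rw [e11]; exact g5.2.1
  · rw [e10, e11]; exact g5.2.2
  · rw [e10, e11]; exact hc
  -- Every line that meets the boundary has been marked by one of the two detections, so at most `k
  -- + 2` turns are unmarked, which gives the factor `4`.
  · have := D.card_unforced_le hn hm (fun l => 1 ≤ s3.nat 2 l)
      (fun i hi j hj t ht hx => (g3' _ (g2 i hi j hj t ht hx)).ge)
      (fun i hi j hj t ht hx => (g3 i hi j hj t ht hx).ge)
    rw [weight, e2]
    calc _ ≤ 2 ^ (D.freeLines + 2) := Nat.pow_le_pow_right (by norm_num) this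
      _ = _ := by rw [pow_add]; ring
  · rw [F6.1 12 (by decide), F5.1 12 (by decide), z 12 (by simp)]

end RealRAM

-- A decoded sequence of turns is controlled only below `n + m`; what the array contains beyond that
-- must not matter.
open CellData in
theorem CellData.Realizes.congr {d : CellData} {τ τ' : ℕ → ℝ} {c : ℝ}
    (hττ : ∀ l < d.n + d.m, τ l = τ' l) (h : d.Realizes τ c) : d.Realizes τ' c := by
  have hdir : ∀ l ≤ d.n + d.m, dir τ l = dir τ' l := fun l hl =>
    Finset.prod_congr rfl fun k hk => hττ k (by have := Finset.mem_range.1 hk; omega)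
  have hwalk : ∀ l ≤ d.n + d.m, d.walk τ l = d.walk τ' l := fun l hl =>
    Finset.sum_congr rfl fun k hk => by
      rw [hdir (k + 1) (by have := Finset.mem_range.1 hk; omega)]
  intro i hi j hj r hr t ht
  have := h i hi j hj r hr t ht
  rwa [diff, hdir (i + 1) (by omega), hdir (d.n + j + 1) (by omega), hwalk i (by omega),
    hwalk (d.n + j) (by omega)] at this

namespace RealRAM

/-! ## Decoding -/

open Classical in
/-- The number that encodes the turns `τ` before `l`. The turns marked in `F` do not count. -/
noncomputable def enc (F : ℕ → ℕ) (τ : ℕ → ℝ) : ℕ → ℕ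
  | 0 => 0
  | l + 1 => if 1 ≤ F l then enc F τ l else if τ l = 1 then enc F τ l + weight F l else enc F τ l

/-- The unmarked turns are binary digits with place values `weight F l`. The bound makes the code
unique, allows greedy decoding from the top, and limits the range of the search. -/
theorem enc_lt (F : ℕ → ℕ) (τ : ℕ → ℝ) (l : ℕ) : enc F τ l < weight F l := by
  induction l with
  | zero => simp [enc, weight_zero]
  | succ l ih =>
    rw [enc, weight_succ]
    split_ifs <;> omega

/-- The turns `τ` have the marked values. -/
def Agrees (d : CellData) (s : Memory) (τ : ℕ → ℝ) : Prop :=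
  ∀ l < d.n + d.m, 1 ≤ s.nat 2 l → τ l = s.real 8 l

/-- The index of the turn that is decoded next. -/
def lastE : NatExpr := .sub (.sub lenE (.const 1)) iE

/-- Writes the turns encoded by entry `0` of array `7` of natural numbers to array `9` of real
numbers. -/
def decode : Program :=
  .seq (.assignNat 8 (.const 0) (.read 7 (.const 0))) <|
  forUp 4 lenE <|
    .branch (.natLE (.const 1) (.read 2 lastE)) (.assignReal 9 lastE (.read 8 lastE)) <|
    .branch (.natLE (.read 6 lastE) (.read 8 (.const 0)))
      (.seq (.assignReal 9 lastE (.const 1))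
        (.assignNat 8 (.const 0) (.sub (.read 8 (.const 0)) (.read 6 lastE))))
      (.assignReal 9 lastE (.const (-1)))

/-- Turns are recovered from the last to the first. After `k` rounds the remainder is the code of
the first `n + m - k` turns. Any number decodes to some turns, whether or not it is the code of the
sequence in question. -/
theorem decode_spec : ∃ K, ∀ d : CellData, d.Regular → ∀ s, Prepared d s →
    Ensures decode s (K * (d.n * d.m)) fun s' => d.IsTurns (s'.real 9) ∧
      ∀ τ, d.IsTurns τ → Agrees d s τ → enc (s.nat 2) τ (d.n + d.m) = s.nat 7 0 →
        ∀ l < d.n + d.m, s'.real 9 l = τ l := by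
  refine ⟨_, fun d hd s hs => Ensures.seq_run rfl (Nat.mul_pos hd.n_pos hd.m_pos) fun F =>
    Ensures.forUp_run (d.n + d.m) (Nat.mul_pos hd.n_pos hd.m_pos)
      (by nlinarith [hd.n_pos, hd.m_pos]) (fun k s' =>
        (∀ l < d.n + d.m, d.n + d.m ≤ l + k → s'.real 9 l = 1 ∨ s'.real 9 l = -1) ∧
        ∀ τ, d.IsTurns τ → Agrees d s τ → enc (s.nat 2) τ (d.n + d.m) = s.nat 7 0 →
          s'.nat 8 0 = enc (s.nat 2) τ (d.n + d.m - k) ∧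
          ∀ l < d.n + d.m, d.n + d.m ≤ l + k → s'.real 9 l = τ l)
      rfl (by decide) (fun s' h => ?_) (fun _ _ _ h => h) ?_ (fun k hk s' hF hc h _ => ?_)
      (fun s' _ h => ⟨fun l hl => h.1 l hl (by omega), fun τ h1 h2 h3 l hl =>
        (h.2 τ h1 h2 h3).2 l hl (by omega)⟩)⟩
  · have := ((hs.frame F rfl).frame h rfl).ready
    rw [eval_lenE, this.n_eq, this.m_eq]
  · refine ⟨fun l hl hl' => absurd hl (by omega), fun τ _ _ h3 =>
      ⟨?_, fun l hl hl' => absurd hl (by omega)⟩⟩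
    simp [Program.run, NatExpr.eval, Memory.setNat_nat_same, h3]
  · have hp : Prepared d s' := (hs.frame F rfl).frame hF rfl
    have h2 : s'.nat 2 = s.nat 2 := (hF.1 2 (by decide)).trans (F.1 2 (by decide))
    have h8 : s'.real 8 = s.real 8 := (hF.2 8 (by decide)).trans (F.2 8 (by decide))
    obtain ⟨q, hq⟩ : ∃ q, d.n + d.m = q + 1 + k := ⟨d.n + d.m - (k + 1), by omega⟩
    have hlast : ∀ s'' : Memory, s''.nat 0 = s'.nat 0 → s''.nat 4 = s'.nat 4 →
        lastE.eval s'' = q := by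
      intro s'' e0 e4
      simp only [lastE, NatExpr.eval, eval_lenE, eval_iE, e0, e4, hp.ready.n_eq, hp.ready.m_eq, hc]
      omega
    have hq0 := hlast s' rfl rfl
    have hw : s'.nat 6 q = weight (s.nat 2) q := by rw [hp.pow q (by omega), h2]
    have e1 : d.n + d.m - k = q + 1 := by omega
    have e2 : d.n + d.m - (k + 1) = q := by omega
    rw [e1] at h
    rw [e2]
    -- All three branches write one turn `v` at `q` and leave a remainder; it suffices to check
    -- these two values.
    have fin : ∀ (v : ℝ) (s'' : Memory), (v = 1 ∨ v = -1) →
        (∀ l, s''.real 9 l = if l = q then v else s'.real 9 l) →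
        (∀ τ, d.IsTurns τ → Agrees d s τ → s'.nat 8 0 = enc (s.nat 2) τ (q + 1) →
          s''.nat 8 0 = enc (s.nat 2) τ q ∧ v = τ q) →
        (∀ l < d.n + d.m, d.n + d.m ≤ l + (k + 1) → s''.real 9 l = 1 ∨ s''.real 9 l = -1) ∧
        ∀ τ, d.IsTurns τ → Agrees d s τ → enc (s.nat 2) τ (d.n + d.m) = s.nat 7 0 →
          s''.nat 8 0 = enc (s.nat 2) τ q ∧
          ∀ l < d.n + d.m, d.n + d.m ≤ l + (k + 1) → s''.real 9 l = τ l := by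
      intro v s'' hv h9 hτ
      refine ⟨fun l hl hl' => ?_, fun τ t1 t2 t3 => ?_⟩
      · rw [h9]
        split_ifs with e
        · exact hv
        · exact h.1 l hl (by omega)
      · obtain ⟨g1, g2⟩ := h.2 τ t1 t2 t3
        refine ⟨(hτ τ t1 t2 g1).1, fun l hl hl' => ?_⟩
        rw [h9]
        split_ifs with e
        · rw [(hτ τ t1 t2 g1).2, e]
        · exact g2 l hl (by omega)
    simp only [Program.run, Test.Holds, NatExpr.eval, hq0, h2, hw]
    split_ifs with b1 b2
    · refine fin (s.real 8 q) _ ?_ (fun l => ?_) (fun τ _ t2 t3 => ⟨?_, ?_⟩)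
      · rcases hs.sound q with h0 | h0
        · omega
        · exact h0.2.1
      · simp [RealExpr.eval, Memory.setReal_real_same, hq0, h8]
      · rw [Memory.setReal_nat, t3, enc, if_pos b1]
      · exact (t2 q (by omega) b1).symm
    · refine fin 1 _ (Or.inl rfl) (fun l => ?_) (fun τ t1 _ t3 => ?_)
      · simp [RealExpr.eval, Memory.setReal_real_same, Memory.setNat_real]
      -- The remainder is at least the place value, which is impossible if the digit is `0`, because
      -- the lower digits add up to less.
      · have hlt := enc_lt (s.nat 2) τ q
        rw [enc, if_neg b1] at t3
        rw [hlast (s'.setReal 9 q (RealExpr.eval s' (.const 1))) rfl rfl]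
        simp only [Memory.setNat_nat_same, if_true, Memory.setReal_nat, hw]
        by_cases h1 : τ q = 1
        · rw [if_pos h1] at t3
          exact ⟨by omega, h1.symm⟩
        · rw [if_neg h1] at t3
          omega
    · refine fin (-1) _ (Or.inr rfl) (fun l => ?_) (fun τ t1 _ t3 => ?_)
      · simp [RealExpr.eval, Memory.setReal_real_same]
      · rw [enc, if_neg b1] at t3
        rw [Memory.setReal_nat]
        by_cases h1 : τ q = 1
        · rw [if_pos h1] at t3
          omega
        · rw [if_neg h1] at t3
          exact ⟨t3, ((t1 q (by omega)).resolve_left h1).symm⟩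

/-! ## Building the curves -/

/-- The directions and the vertices of the curves with turns `τ` are in arrays `10` and `11` of real
numbers. -/
def Built (d : CellData) (τ : ℕ → ℝ) (s : Memory) : Prop :=
  ∀ l ≤ d.n + d.m, s.real 10 l = CellData.dir τ l ∧ s.real 11 l = d.walk τ l

/-- Computes the directions and the vertices. -/
def build : Program :=
  .seq (.seq (.assignReal 10 (.const 0) (.const 1)) (.assignReal 11 (.const 0) (.const 0))) <|
  forUp 4 lenE <|
    .seq (.assignReal 10 (.add iE (.const 1)) (.mul (.read 10 iE) (.read 9 iE)))
      (.assignReal 11 (.add iE (.const 1))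
        (.add (.read 11 iE) (.mul (.read 10 (.add iE (.const 1))) (.read 5 iE))))

theorem build_spec : ∃ K, ∀ d : CellData, d.Regular → ∀ s, Ready d s →
    Ensures build s (K * (d.n * d.m)) (Built d (s.real 9)) := by
  refine ⟨_, fun d hd s hs => Ensures.seq_run rfl (Nat.mul_pos hd.n_pos hd.m_pos) fun F =>
    Ensures.forUp_run (d.n + d.m) (Nat.mul_pos hd.n_pos hd.m_pos)
      (by nlinarith [hd.n_pos, hd.m_pos]) (fun k s' => ∀ l ≤ k,
        s'.real 10 l = CellData.dir (s.real 9) l ∧ s'.real 11 l = d.walk (s.real 9) l)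
      rfl (by decide) (fun s' h => ?_) (fun _ _ _ h => h) ?_ (fun k hk s' hF hc h _ => ?_)
      (fun s' _ h => h)⟩
  · have := (hs.frame F rfl).frame h rfl
    rw [eval_lenE, this.n_eq, this.m_eq]
  · intro l hl
    obtain rfl : l = 0 := by omega
    simp [Program.run, NatExpr.eval, RealExpr.eval, Memory.setReal_real_same,
      Memory.setReal_real_ne, CellData.dir, CellData.walk]
  · have hr : Ready d s' := (hs.frame F rfl).frame hF rfl
    have h9 : s'.real 9 = s.real 9 := (hF.2 9 (by decide)).trans (F.2 9 (by decide))
    obtain ⟨g1, g2⟩ := h k le_rfl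
    intro l hl
    simp only [Program.run, NatExpr.eval, RealExpr.eval, eval_iE, Memory.setReal_real_same,
      Memory.setReal_real_ne _ (show 11 ≠ 10 by decide),
      Memory.setReal_real_ne _ (show 10 ≠ 11 by decide),
      Memory.setReal_real_ne _ (show 5 ≠ 10 by decide), Memory.setReal_nat, hc, h9, if_true]
    by_cases e : l = k + 1
    · subst e
      rw [if_pos rfl, if_pos rfl, CellData.walk_succ, CellData.dir_succ, g1, g2, hr.len k hk]
      exact ⟨rfl, rfl⟩
    · rw [if_neg e, if_neg e]
      exact h l (by omega)

/-- Computes the largest vertex of the first curve. -/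
def maxFirst : Program :=
  .seq (.assignReal 14 (.const 0) (.read 11 (.const 0))) <|
  forUp 4 nE (.branch (.realLE (.read 14 (.const 0)) (.read 11 (.add iE (.const 1))))
    (.assignReal 14 (.const 0) (.read 11 (.add iE (.const 1)))) .skip)

/-- Computes the smallest vertex of the second curve. -/
def minSecond : Program :=
  .seq (.assignReal 15 (.const 0) (.read 11 nE)) <|
  forUp 4 mE (.branch (.realLE (.read 11 (.add nE (.add iE (.const 1)))) (.read 15 (.const 0)))
    (.assignReal 15 (.const 0) (.read 11 (.add nE (.add iE (.const 1))))) .skip)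

theorem maxFirst_spec : ∃ K, ∀ d : CellData, d.Regular → ∀ s, Ready d s →
    Ensures maxFirst s (K * (d.n * d.m)) fun s' => (∀ i ≤ d.n, s.real 11 i ≤ s'.real 14 0) ∧
      ∃ i ≤ d.n, s'.real 14 0 = s.real 11 i := by
  refine ⟨_, fun d hd s hs => Ensures.seq_run rfl (Nat.mul_pos hd.n_pos hd.m_pos) fun F =>
    Ensures.forUp_run d.n (Nat.mul_pos hd.n_pos hd.m_pos)
      (by nlinarith [hd.n_pos, hd.m_pos]) (fun k s' => (∀ i ≤ k, s.real 11 i ≤ s'.real 14 0) ∧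
        ∃ i ≤ k, s'.real 14 0 = s.real 11 i)
      rfl (by decide) (fun s' h => ?_) (fun _ _ _ h => h) ?_ (fun k hk s' hF hc h _ => ?_)
      (fun s' _ h => h)⟩
  · exact ((hs.frame F rfl).frame h rfl).n_eq
  · simp [Program.run, NatExpr.eval, RealExpr.eval, Memory.setReal_real_same]
  · have h11 : s'.real 11 = s.real 11 := (hF.2 11 (by decide)).trans (F.2 11 (by decide))
    obtain ⟨h1, i, hi, h2⟩ := h
    simp only [Program.run, Test.Holds, NatExpr.eval, RealExpr.eval, eval_iE, hc, h11]
    split_ifs with hb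
    · simp only [Memory.setReal_real_same, if_true]
      refine ⟨fun l hl => ?_, k + 1, le_rfl, rfl⟩
      rcases Nat.le_succ_iff.1 hl with hl | rfl
      · exact (h1 l hl).trans hb
      · exact le_rfl
    · refine ⟨fun l hl => ?_, i, by omega, h2⟩
      rcases Nat.le_succ_iff.1 hl with hl | rfl
      · exact h1 l hl
      · exact (not_le.1 hb).le

theorem minSecond_spec : ∃ K, ∀ d : CellData, d.Regular → ∀ s, Ready d s →
    Ensures minSecond s (K * (d.n * d.m)) fun s' =>
      (∀ j ≤ d.m, s'.real 15 0 ≤ s.real 11 (d.n + j)) ∧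
      ∃ j ≤ d.m, s'.real 15 0 = s.real 11 (d.n + j) := by
  refine ⟨_, fun d hd s hs => Ensures.seq_run rfl (Nat.mul_pos hd.n_pos hd.m_pos) fun F =>
    Ensures.forUp_run d.m (Nat.mul_pos hd.n_pos hd.m_pos)
      (by nlinarith [hd.n_pos, hd.m_pos])
      (fun k s' => (∀ j ≤ k, s'.real 15 0 ≤ s.real 11 (d.n + j)) ∧
        ∃ j ≤ k, s'.real 15 0 = s.real 11 (d.n + j))
      rfl (by decide) (fun s' h => ?_) (fun _ _ _ h => h) ?_ (fun k hk s' hF hc h _ => ?_)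
      (fun s' _ h => h)⟩
  · exact ((hs.frame F rfl).frame h rfl).m_eq
  · simp [Program.run, NatExpr.eval, RealExpr.eval, Memory.setReal_real_same, eval_nE, hs.n_eq]
  · have h11 : s'.real 11 = s.real 11 := (hF.2 11 (by decide)).trans (F.2 11 (by decide))
    have hn := ((hs.frame F rfl).frame hF rfl).n_eq
    obtain ⟨h1, i, hi, h2⟩ := h
    simp only [Program.run, Test.Holds, NatExpr.eval, RealExpr.eval, eval_iE, eval_nE, hn, hc, h11]
    split_ifs with hb
    · simp only [Memory.setReal_real_same, if_true]
      refine ⟨fun l hl => ?_, k + 1, le_rfl, rfl⟩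
      rcases Nat.le_succ_iff.1 hl with hl | rfl
      · exact hb.trans (h1 l hl)
      · exact le_rfl
    · refine ⟨fun l hl => ?_, i, by omega, h2⟩
      rcases Nat.le_succ_iff.1 hl with hl | rfl
      · exact h1 l hl
      · exact (not_le.1 hb).le

end RealRAM

namespace RealRAM

/-! ## Verification -/

/-- The test for `SlabsAgree`. -/
def slabsAgreeT (g vn vx lo hi g' vn' vx' lo' hi' : RealExpr) : Test :=
  .disj (.conj (missesT vn vx lo hi) (missesT vn' vx' lo' hi')) <|
  .disj (.conj (coversT vn vx lo hi) (coversT vn' vx' lo' hi')) <|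
  .conj (.neg (missesT vn vx lo hi)) <| .conj (.neg (missesT vn' vx' lo' hi')) <|
  .conj (.conj (.realLE g g') (.realLE g' g)) <|
  .conj (.disj (.conj (.realLE lo lo') (.realLE lo' lo)) (.conj (.realLE lo vn) (.realLE lo' vn)))
    (.disj (.conj (.realLE hi hi') (.realLE hi' hi)) (.conj (.realLE vx hi) (.realLE vx hi')))

theorem holds_slabsAgreeT (s : Memory) (g vn vx lo hi g' vn' vx' lo' hi' : RealExpr) :
    (slabsAgreeT g vn vx lo hi g' vn' vx' lo' hi').Holds s ↔
      SlabsAgree (g.eval s) (vn.eval s) (vx.eval s) (lo.eval s) (hi.eval s) (g'.eval s)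
        (vn'.eval s) (vx'.eval s) (lo'.eval s) (hi'.eval s) := by
  simp only [slabsAgreeT, SlabsAgree, Test.holds_disj, Test.Holds, holds_missesT, holds_coversT,
    le_antisymm_iff]

/-- The direction of the segment of the second curve for row `j`. -/
def rowDirE (j : NatExpr) : RealExpr := .read 10 (.add (.add nE j) (.const 1))

/-- Expression for `CellData.freeSlope`. -/
def freeSlopeE (i j : NatExpr) : RealExpr := .mul (.read 10 (.add i (.const 1))) (rowDirE j)

/-- Expression for `CellData.center`, with the offset in array `13` of real numbers. -/
def centerE (i j : NatExpr) : RealExpr :=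
  .add (.sub (yE j) (.mul (freeSlopeE i j) (xE i)))
    (.mul (rowDirE j) (.sub (.add (.read 11 i) (.read 13 (.const 0))) (.read 11 (.add nE j))))

/-- The test for `CellData.CellTest`. -/
def cellT (i j : NatExpr) : Test :=
  slabsAgreeT (slopeE i j) (vminE (slopeE i j) i j) (vmaxE (slopeE i j) i j) (loE i j) (hiE i j)
    (freeSlopeE i j) (vminE (freeSlopeE i j) i j) (vmaxE (freeSlopeE i j) i j)
    (.sub (centerE i j) epsE) (.add (centerE i j) epsE)

section Eval

variable {d : CellData} {s : Memory} {τ : ℕ → ℝ} {iX jX : NatExpr} {i j : ℕ}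

theorem Built.eval_rowDirE (hb : Built d τ s) (h : Ready d s) (hj : jX.eval s = j)
    (hj' : j < d.m) : (rowDirE jX).eval s = CellData.dir τ (d.n + j + 1) := by
  simp only [rowDirE, RealExpr.eval, NatExpr.eval, eval_nE, h.n_eq, hj]
  exact (hb _ (by omega)).1

theorem Built.eval_freeSlopeE (hb : Built d τ s) (h : Ready d s) (hi : iX.eval s = i)
    (hj : jX.eval s = j) (hi' : i < d.n) (hj' : j < d.m) :
    (freeSlopeE iX jX).eval s = d.freeSlope τ i j := by
  simp only [freeSlopeE, RealExpr.eval, NatExpr.eval, hb.eval_rowDirE h hj hj', hi]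
  rw [(hb _ (by omega)).1, CellData.freeSlope]

theorem Built.eval_centerE (hb : Built d τ s) (h : Ready d s) (hi : iX.eval s = i)
    (hj : jX.eval s = j) (hi' : i < d.n) (hj' : j < d.m) :
    (centerE iX jX).eval s = d.center τ (s.real 13 0) i j := by
  simp only [centerE, RealExpr.eval, NatExpr.eval, hb.eval_rowDirE h hj hj',
    hb.eval_freeSlopeE h hi hj hi' hj', h.eval_yE hj hj'.le, h.eval_xE hi hi'.le, hi, hj, eval_nE,
    h.n_eq]
  rw [(hb i (by omega)).2, (hb (d.n + j) (by omega)).2, CellData.center]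

theorem Built.holds_cellT (hb : Built d τ s) (h : Ready d s) (hi : iX.eval s = i)
    (hj : jX.eval s = j) (hi' : i < d.n) (hj' : j < d.m) :
    (cellT iX jX).Holds s ↔ d.CellTest τ (s.real 13 0) i j := by
  simp only [cellT, holds_slabsAgreeT, RealExpr.eval, h.eval_vminE hi hj hi' hj',
    h.eval_vmaxE hi hj hi' hj', h.eval_slopeE hi hj hi' hj', h.eval_loE hi hj hi' hj',
    h.eval_hiE hi hj hi' hj', hb.eval_freeSlopeE h hi hj hi' hj',
    hb.eval_centerE h hi hj hi' hj', h.eval_epsE, CellData.CellTest]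

end Eval

/-- Clears entry `0` of array `13` of natural numbers if the test of some cell fails. -/
def checkCells : Program :=
  forCells (.branch (cellT iE jE) .skip (.assignNat 13 (.const 0) (.const 0)))

/-- The flag can only be cleared, and only by a cell that refutes the realization. If it is still
`1` at the end, then no cell cleared it and all tests succeeded. -/
theorem checkCells_spec : ∃ K, ∀ d : CellData, d.Regular → ∀ τ, d.IsTurns τ → ∀ s, Ready d s →
    Built d τ s → s.nat 13 0 = 1 → Ensures checkCells s (K * (d.n * d.m)) fun s' =>
      (s'.nat 13 0 = 1 ∧ d.Realizes τ (s.real 13 0)) ∨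
      (s'.nat 13 0 = 0 ∧ ¬ d.Realizes τ (s.real 13 0)) := by
  refine ⟨_, fun d hd τ hτ s hs hb h13 => Ensures.forCells_run hd.n_pos hd.m_pos
    (fun s' => s'.nat 13 0 = 1 ∨ (s'.nat 13 0 = 0 ∧ ¬ d.Realizes τ (s.real 13 0)))
    (fun i j s' => s'.nat 13 0 = 1 → d.CellOK τ (s.real 13 0) i j) rfl (by decide) (by decide)
    (by decide) hs.n_eq hs.m_eq
    (fun _ _ h => h) (fun _ _ h => h) (fun _ _ _ _ h => h) (fun _ _ _ _ h => h) (Or.inl h13)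
    (fun i hi j hj s' hF hci hcj hinv _ => ?_) (fun s' _ h h' => ?_)⟩
  · have hr : Ready d s' := hs.frame hF rfl
    have hb' : Built d τ s' := by
      intro l hl
      rw [hF.2 10 (by decide), hF.2 11 (by decide)]
      exact hb l hl
    have ht := hb'.holds_cellT hr (iX := iE) (jX := jE) hci hcj hi hj
    rw [← hd.cellOK_iff hτ hi hj, hF.2 13 (by decide)] at ht
    simp only [Program.run]
    split_ifs with hc
    · exact ⟨hinv, fun _ => ht.1 hc, fun _ _ _ _ h => h⟩
    · rw [ht] at hc
      simp only [NatExpr.eval, Memory.setNat_nat_same, if_true]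
      exact ⟨Or.inr ⟨trivial, fun h => hc (h i hi j hj)⟩, by simp, by simp⟩
  · rcases h with h | h
    · exact Or.inl ⟨h, fun i hi j hj => h' i hi j hj h⟩
    · exact Or.inr h

/-- Try the offset `e`, unless a realization has been found. -/
def tryOffset (e : RealExpr) : Program :=
  .branch (.natLE (.read 12 (.const 0)) (.const 0))
    (.seq (.seq (.assignReal 13 (.const 0) e) (.assignNat 13 (.const 0) (.const 1)))
      (.seq checkCells (.assignNat 12 (.const 0) (.read 13 (.const 0))))) .skip

/-- A realization with turns `τ` has been found. -/
def Found (d : CellData) (τ : ℕ → ℝ) (s : Memory) : Prop :=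
  s.nat 12 0 = 1 ∧ d.Realizes τ (s.real 13 0)

/-- The failure alternative also records that the flag was `0` before. So the failure of the last of
several trials implies that all of them were carried out and failed. -/
theorem tryOffset_spec (e : RealExpr) : ∃ K, ∀ d : CellData, d.Regular → ∀ τ, d.IsTurns τ →
    ∀ s, Ready d s → Built d τ s → (Found d τ s ∨ s.nat 12 0 = 0) →
    Ensures (tryOffset e) s (K * (d.n * d.m)) fun s' =>
      Found d τ s' ∨ (s.nat 12 0 = 0 ∧ s'.nat 12 0 = 0 ∧ ¬ d.Realizes τ (e.eval s)) := by
  obtain ⟨K, hK⟩ := checkCells_spec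
  refine ⟨e.cost + 30 + K, fun d hd τ hτ s hs hb hf => ?_⟩
  have hM : 0 < d.n * d.m := Nat.mul_pos hd.n_pos hd.m_pos
  refine (Ensures.branch (T := e.cost + 6 + (K * (d.n * d.m) + 4)) (U := 1) (fun hc => ?_)
    fun hc => ?_).mono ?_ fun _ _ h => h
  · have h12 : s.nat 12 0 = 0 := Nat.le_zero.1 hc
    refine ((Ensures.of_loopFree (p := .seq (.assignReal 13 (.const 0) e)
      (.assignNat 13 (.const 0) (.const 1))) rfl fun F1 F1' => ?_).mono ?_ fun _ _ h => h).seq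
    · refine ((hK d hd τ hτ _ (hs.frame F1 rfl) ?_ ?_).mono le_rfl fun s2 F2' g2 F2 => ?_).seq
      · intro l hl
        rw [F1.2 10 (List.count_eq_zero.1 rfl), F1.2 11 (List.count_eq_zero.1 rfl)]
        exact hb l hl
      · simp [Program.run, NatExpr.eval, Memory.setNat_nat_same]
      · have e13 : s2.real 13 0 = e.eval s := by
          rw [F2.2 13 (by decide)]
          simp [Program.run, NatExpr.eval, Memory.setNat_real, Memory.setReal_real_same]
        refine (Ensures.of_loopFree rfl fun _ => ?_).mono (U := 4) (by decide) fun _ _ h => h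
        have e13' : ((Program.seq (.assignReal 13 (.const 0) e)
            (.assignNat 13 (.const 0) (.const 1))).run s).real 13 0 = e.eval s := by
          simp [Program.run, NatExpr.eval, Memory.setNat_real, Memory.setReal_real_same]
        rw [e13'] at g2
        simp only [Found, Program.run, NatExpr.eval, Memory.setNat_nat_same, if_true,
          Memory.setNat_real, e13]
        rcases g2 with g2 | g2
        · exact Or.inl g2
        · exact Or.inr ⟨h12, g2⟩
    · simp only [Program.bound, NatExpr.cost]
      omega
  · refine (Ensures.of_loopFree rfl fun _ => ?_).mono (U := 1) le_rfl fun _ _ h => h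
    exact Or.inl (hf.resolve_right fun h => hc h.le)
  · simp only [Test.cost, NatExpr.cost]
    nlinarith

/-! ## The search -/

/-- Expression for `CellData.mixedOffset` of the stored cell. -/
def mixedOffsetE : RealExpr :=
  .add (.sub (.mul (rowDirE j0E) (.read 12 (.const 0))) (.read 11 i0E)) (.read 11 (.add nE j0E))

/-- The offset for a diagram without gray points. -/
def nearOffsetE : RealExpr := .add (.sub epsE (.read 14 (.const 0))) (.read 15 (.const 0))

/-- An offset for a diagram without white points. -/
def farOffsetE : RealExpr :=
  .add (.add epsE (.const 1)) (.mul (.const 2) (.read 6 lenE))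

/-- Try all offsets with the turns in array `9` of real numbers. -/
def tryTurns : Program :=
  build.seq (maxFirst.seq (minSecond.seq
    ((tryOffset mixedOffsetE).seq ((tryOffset nearOffsetE).seq (tryOffset farOffsetE)))))

/-- The slabs of the cells agree on the boundaries of the cells. -/
def _root_.CellData.Consistent (d : CellData) : Prop :=
  ∃ W : ℝ → ℝ → Prop, ∀ i < d.n, ∀ j < d.m, ∀ r ∈ Set.Icc (d.x i) (d.x (i + 1)),
    ∀ t ∈ Set.Icc (d.y j) (d.y (j + 1)), d.Slab i j r t ↔ W r t

/-- The three trials are the three candidates of `realizes_candidate`; if all fail, no offset works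
for these turns. -/
theorem tryTurns_spec : ∃ K, ∀ d : CellData, d.Regular → d.Consistent → ∀ s, Prepared d s →
    d.IsTurns (s.real 9) → s.nat 12 0 = 0 →
    Ensures tryTurns s (K * (d.n * d.m)) fun s' => Built d (s.real 9) s' ∧
      (Found d (s.real 9) s' ∨ (s'.nat 12 0 = 0 ∧ ∀ c, ¬ d.Realizes (s.real 9) c)) := by
  obtain ⟨K1, h1⟩ := build_spec
  obtain ⟨K2, h2⟩ := maxFirst_spec
  obtain ⟨K3, h3⟩ := minSecond_spec
  obtain ⟨K4, h4⟩ := tryOffset_spec mixedOffsetE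
  obtain ⟨K5, h5⟩ := tryOffset_spec nearOffsetE
  obtain ⟨K6, h6⟩ := tryOffset_spec farOffsetE
  refine ⟨K1 + (K2 + (K3 + (K4 + (K5 + K6)))), fun d hd ⟨W, hW⟩ s hs hτ h12 => ?_⟩
  simp only [Nat.add_mul]
  have keep : ∀ {p : Program} {s s' : Memory}, p.Frame s s' → 10 ∉ p.realMods → 11 ∉ p.realMods →
      ∀ {τ}, Built d τ s → Built d τ s' := by
    intro p s s' h k10 k11 τ hb l hl
    rw [h.2 10 k10, h.2 11 k11]
    exact hb l hl
  refine ((h1 d hd s hs.ready).mono le_rfl fun s1 _ b1 F1 => ?_).seq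
  have p1 := hs.frame F1 rfl
  refine ((h2 d hd s1 p1.ready).mono le_rfl fun s2 _ g2 F2 => ?_).seq
  have p2 := p1.frame F2 rfl
  have b2 := keep F2 (by decide) (by decide) b1
  refine ((h3 d hd s2 p2.ready).mono le_rfl fun s3 _ g3 F3 => ?_).seq
  have p3 := p2.frame F3 rfl
  have b3 := keep F3 (by decide) (by decide) b2
  have f3 : s3.nat 12 0 = 0 := by
    rw [F3.1 12 (by decide), F2.1 12 (by decide), F1.1 12 (by decide), h12]
  refine ((h4 d hd _ hτ s3 p3.ready b3 (Or.inr f3)).mono le_rfl fun s4 _ g4 F4 => ?_).seq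
  have p4 := p3.frame F4 rfl
  have b4 := keep F4 (by decide) (by decide) b3
  refine ((h5 d hd _ hτ s4 p4.ready b4 (g4.imp_right fun h => h.2.1)).mono le_rfl
    fun s5 _ g5 F5 => ?_).seq
  have p5 := p4.frame F5 rfl
  have b5 := keep F5 (by decide) (by decide) b4
  refine (h6 d hd _ hτ s5 p5.ready b5 (g5.imp_right fun h => h.2.1)).mono le_rfl
    fun s6 F6 g6 => ?_
  refine ⟨keep F6 (by decide) (by decide) b5, g6.imp_right fun ⟨k5, k6, n6⟩ => ⟨k6, fun c hc => ?_⟩⟩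
  -- The flag was `0` before the last trial, so the second one failed, and by the same argument the
  -- first one.
  obtain ⟨k4, -, n5⟩ := g5.resolve_left fun h => by simp [Found, k5] at h
  obtain ⟨-, -, n4⟩ := g4.resolve_left fun h => by simp [Found, k4] at h
  have e1 : mixedOffsetE.eval s3 = d.mixedOffset (s.real 9) (s3.nat 10 0) (s3.nat 11 0) := by
    have hi := p3.i0_lt
    have hj := p3.j0_lt
    have ei : i0E.eval s3 = s3.nat 10 0 := rfl
    have ej : j0E.eval s3 = s3.nat 11 0 := rfl
    simp only [mixedOffsetE, RealExpr.eval, NatExpr.eval, b3.eval_rowDirE p3.ready ej hj, ei, ej,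
      eval_nE, p3.ready.n_eq, p3.center, CellData.mixedOffset]
    rw [(b3 _ (by omega)).2, (b3 _ (by omega)).2]
  have e2 : nearOffsetE.eval s4 = d.eps - s2.real 14 0 + s3.real 15 0 := by
    simp only [nearOffsetE, RealExpr.eval, NatExpr.eval, p4.ready.eval_epsE]
    rw [F4.2 15 (by decide), F4.2 14 (by decide), F3.2 14 (by decide)]
  have e3 : farOffsetE.eval s5 = d.eps + 1 + 2 * d.pos (d.n + d.m) := by
    simp only [farOffsetE, RealExpr.eval, eval_lenE, p5.ready.eval_epsE, p5.ready.n_eq,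
      p5.ready.m_eq, p5.ready.pos _ le_rfl, Rat.cast_one, Rat.cast_ofNat]
  rw [e1] at n4
  rw [e2] at n5
  rw [e3] at n6
  have := hd.realizes_candidate hW (fun h => ⟨p3.i0_lt, p3.j0_lt, p3.mixed h⟩) hτ hc
    (M := s2.real 14 0) (N := s3.real 15 0)
    (fun i hi => by rw [← (b1 i (by omega)).2]; exact g2.1 i hi)
    (by obtain ⟨i, hi, h⟩ := g2.2; exact ⟨i, hi, by rw [h, (b1 i (by omega)).2]⟩)
    (fun j hj => by rw [← (b2 (d.n + j) (by omega)).2]; exact g3.1 j hj)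
    (by obtain ⟨j, hj, h⟩ := g3.2; exact ⟨j, hj, by rw [h, (b2 (d.n + j) (by omega)).2]⟩)
  rcases this with h | h | h
  exacts [n4 h, n5 h, n6 h]

/-- Try the turns encoded by entry `0` of array `7` of natural numbers, unless a realization has
been found. -/
def attempt : Program :=
  .branch (.natLE (.read 12 (.const 0)) (.const 0)) (decode.seq tryTurns) .skip

/-- A realization is in memory. -/
def Success (d : CellData) (s : Memory) : Prop :=
  s.nat 12 0 = 1 ∧ ∃ τ, d.IsTurns τ ∧ Built d τ s ∧ d.Realizes τ (s.real 13 0)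

theorem attempt_spec : ∃ K, ∀ d : CellData, d.Regular → d.Consistent → ∀ s, Prepared d s →
    (Success d s ∨ s.nat 12 0 = 0) →
    Ensures attempt s (K * (d.n * d.m)) fun s' => Success d s' ∨
      (s.nat 12 0 = 0 ∧ s'.nat 12 0 = 0 ∧ ∀ τ c, d.IsTurns τ → Agrees d s τ →
        enc (s.nat 2) τ (d.n + d.m) = s.nat 7 0 → ¬ d.Realizes τ c) := by
  obtain ⟨K1, h1⟩ := decode_spec
  obtain ⟨K2, h2⟩ := tryTurns_spec
  refine ⟨K1 + K2 + 10, fun d hd hW s hs hf => ?_⟩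
  have hM : 0 < d.n * d.m := Nat.mul_pos hd.n_pos hd.m_pos
  refine (Ensures.branch (T := K1 * (d.n * d.m) + K2 * (d.n * d.m)) (U := 1) (fun hc => ?_)
    fun hc => ?_).mono ?_ fun _ _ h => h
  · have h12 : s.nat 12 0 = 0 := Nat.le_zero.1 hc
    refine ((h1 d hd s hs).mono le_rfl fun s1 _ g1 F1 => ?_).seq
    refine (h2 d hd hW s1 (hs.frame F1 rfl) g1.1 ?_).mono le_rfl fun s2 F2 g2 => ?_
    · rw [F1.1 12 (by decide), h12]
    · refine g2.2.imp (fun h => ⟨h.1, _, g1.1, g2.1, h.2⟩) fun h => ⟨h12, h.1, ?_⟩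
      -- A realization with this code has the decoded turns below `n + m`, and these have just been
      -- refuted for all offsets.
      exact fun τ c t1 t2 t3 hc => h.2 c (hc.congr fun l hl => (g1.2 τ t1 t2 t3 l hl).symm)
  · refine (Ensures.of_loopFree rfl fun _ => ?_).mono (U := 1) le_rfl fun _ _ h => h
    exact Or.inl (hf.resolve_right fun h => hc h.le)
  · simp only [Test.cost, NatExpr.cost]
    nlinarith

/-- Try all turns. -/
def search : Program := forUp 7 (.read 6 lenE) attempt

theorem search_spec : ∃ K, ∀ d : CellData, d.Regular → d.Consistent → ∀ s, Prepared d s →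
    s.nat 12 0 = 0 →
    Ensures search s (K * (weight (s.nat 2) (d.n + d.m) * (d.n * d.m))) fun s' =>
      Ready d s' ∧ (Success d s' ∨ (s'.nat 12 0 = 0 ∧ ∀ τ c, d.IsTurns τ → ¬ d.Realizes τ c)) := by
  obtain ⟨K, hK⟩ := attempt_spec
  refine ⟨K + 100, fun d hd hW s hs h12 => ?_⟩
  have hM : 0 < d.n * d.m := Nat.mul_pos hd.n_pos hd.m_pos
  have hw : 0 < weight (s.nat 2) (d.n + d.m) := (Nat.zero_le _).trans_lt (enc_lt _ 0 _)
  refine (Ensures.forUp (c := 7) (T := K * (d.n * d.m)) (weight (s.nat 2) (d.n + d.m)) (fun k s' => Success d s' ∨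
    (s'.nat 12 0 = 0 ∧ ∀ τ c, d.IsTurns τ → Agrees d s τ →
      enc (s.nat 2) τ (d.n + d.m) < k → ¬ d.Realizes τ c)) (by decide) ?_
    (fun _ _ _ h => h) (Or.inr ⟨h12, by simp⟩) ?_ ?_).mono ?_ fun _ _ h => h
  · intro s' hF
    have hp := hs.frame hF rfl
    rw [NatExpr.eval, eval_lenE, hp.ready.n_eq, hp.ready.m_eq, hp.pow _ le_rfl,
      hF.1 2 (by decide)]
  · intro k hk s' hF hc hI
    have h2 : s'.nat 2 = s.nat 2 := hF.1 2 (by decide)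
    have h8 : s'.real 8 = s.real 8 := hF.2 8 (by decide)
    refine (hK d hd hW s' (hs.frame hF rfl) (hI.imp_right And.left)).mono le_rfl fun s'' _ h => ?_
    refine h.imp_right fun ⟨g0, g1, g2⟩ => ⟨g1, fun τ c t1 t2 t3 => ?_⟩
    rcases Nat.lt_succ_iff_lt_or_eq.1 t3 with t3 | t3
    · exact (hI.resolve_left fun h => by simp [Success, g0] at h).2 τ c t1 t2 t3
    · refine g2 τ c t1 ?_ (by rw [h2, hc, t3])
      intro l hl
      rw [h2, h8]
      exact t2 l hl
  · intro s' hF h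
    refine ⟨(hs.frame hF rfl).ready, h.imp_right fun ⟨g1, g2⟩ => ⟨g1, fun τ c hτ hc => ?_⟩⟩
    -- Turns of a realization have the marked values by soundness, and their code is in the range of
    -- the loop.
    refine g2 τ c hτ (fun l _ hf => ?_) (enc_lt _ _ _) hc
    rcases hs.sound l with h0 | h0
    · omega
    · exact h0.2.2 τ c hτ hc
  · simp only [NatExpr.cost, lenE, nE, mE]
    have e1 : weight (s.nat 2) (d.n + d.m) ≤ weight (s.nat 2) (d.n + d.m) * (d.n * d.m) :=
      Nat.le_mul_of_pos_right _ hM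
    have e2 : weight (s.nat 2) (d.n + d.m) * (K * (d.n * d.m)) =
      K * (weight (s.nat 2) (d.n + d.m) * (d.n * d.m)) := by ring
    have e3 := Nat.mul_pos hw hM
    simp only [Nat.mul_add, Nat.add_mul, e2]
    omega

/-! ## The output -/

/-- Writes the first curve. -/
def writeFirst : Program :=
  forUp 4 (.add nE (.const 1)) (.assignReal 0 iE (.add (.read 11 iE) (.read 13 (.const 0))))

/-- Writes the second curve. -/
def writeSecond : Program :=
  forUp 4 (.add mE (.const 1)) (.assignReal 1 iE (.read 11 (.add nE iE)))

/-- Writes the output. -/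
def writeOutput : Program :=
  writeFirst.seq (writeSecond.seq (.assignNat 0 (.const 0) (.read 12 (.const 0))))

theorem writeFirst_spec : ∃ K, ∀ {n m : ℕ}, 0 < n → 0 < m → ∀ s : Memory, s.nat 0 0 = n →
    Ensures writeFirst s (K * (n * m)) fun s' => ∀ i ≤ n,
      s'.real 0 i = s.real 11 i + s.real 13 0 := by
  refine ⟨_, fun {n m} hn hm s hsn => Ensures.forUp_run (n + 1)
    (Nat.mul_pos hn hm) (by nlinarith)
    (fun k s' => ∀ i < k, s'.real 0 i = s.real 11 i + s.real 13 0)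
    rfl (by decide) (fun s' h => ?_) (fun _ _ _ h => h) (by simp) (fun k hk s' hF hc h _ => ?_)
    (fun s' _ h i hi => h i (by omega))⟩
  · rw [NatExpr.eval, eval_nE, h.1 0 (by decide), hsn]; rfl
  · intro l hl
    simp only [Program.run, eval_iE, NatExpr.eval, RealExpr.eval, Memory.setReal_real_same, hc]
    split_ifs with he
    · rw [hF.2 11 (by decide), hF.2 13 (by decide), he]
    · exact h l (by omega)

theorem writeSecond_spec : ∃ K, ∀ {n m : ℕ}, 0 < n → 0 < m → ∀ s : Memory, s.nat 0 0 = n →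
    s.nat 0 1 = m → Ensures writeSecond s (K * (n * m)) fun s' => ∀ j ≤ m,
      s'.real 1 j = s.real 11 (n + j) := by
  refine ⟨_, fun {n m} hn hm s hsn hsm => Ensures.forUp_run (m + 1)
    (Nat.mul_pos hn hm) (by nlinarith) (fun k s' => ∀ j < k, s'.real 1 j = s.real 11 (n + j))
    rfl (by decide) (fun s' h => ?_) (fun _ _ _ h => h) (by simp) (fun k hk s' hF hc h _ => ?_)
    (fun s' _ h j hj => h j (by omega))⟩
  · rw [NatExpr.eval, eval_mE, h.1 0 (by decide), hsm]; rfl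
  · have hn' : s'.nat 0 0 = n := by rw [hF.1 0 (by decide), hsn]
    intro l hl
    simp only [Program.run, eval_iE, eval_nE, NatExpr.eval, RealExpr.eval,
      Memory.setReal_real_same, hc, hn']
    split_ifs with he
    · rw [hF.2 11 (by decide), he]
    · exact h l (by omega)

/-- The output overwrites the input: the vertices replace `ε` and the widths, and the flag replaces
`n`. The flag is therefore written last, when `n` is no longer needed as a loop bound or an index.
-/
theorem writeOutput_spec : ∃ K, ∀ {n m : ℕ}, 0 < n → 0 < m → ∀ s : Memory, s.nat 0 0 = n →
    s.nat 0 1 = m → Ensures writeOutput s (K * (n * m)) fun s' =>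
      s'.flag = s.nat 12 0 ∧ (∀ i, s'.outP n i = s.real 11 i + s.real 13 0) ∧
        ∀ j, s'.outQ m j = s.real 11 (n + j) := by
  obtain ⟨K1, h1⟩ := writeFirst_spec
  obtain ⟨K2, h2⟩ := writeSecond_spec
  refine ⟨K1 + (K2 + 4), fun {n m} hn hm s hsn hsm => ?_⟩
  simp only [Nat.add_mul]
  refine ((h1 hn hm s hsn).mono le_rfl fun s1 _ g1 F1 => ?_).seq
  refine ((h2 hn hm s1 ?_ ?_).mono le_rfl fun s2 _ g2 F2 => ?_).seq
  · rw [F1.1 0 (by decide), hsn]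
  · rw [F1.1 0 (by decide), hsm]
  · refine (Ensures.of_loopFree rfl fun _ => ?_).mono
      (Nat.le_mul_of_pos_right 4 (Nat.mul_pos hn hm)) fun _ _ h => h
    refine ⟨?_, fun i => ?_, fun j => ?_⟩
    · simp only [Memory.flag, Program.run, NatExpr.eval, Memory.setNat_nat_same, if_true]
      rw [F2.1 12 (by decide), F1.1 12 (by decide)]
    · simp only [Memory.outP, Program.run, Memory.setNat_real]
      rw [F2.2 0 (by decide), g1 i (by omega)]
    · simp only [Memory.outQ, Program.run, Memory.setNat_real]
      rw [g2 j (by omega), F1.2 11 (by decide)]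

/-- The program that solves the realizability problem. -/
def realize : Program := prepareSearch.seq (search.seq writeOutput)

theorem realize_spec : ∃ C, ∀ {n m : ℕ} (D : InputDiagram n m), 0 < n → 0 < m →
    Ensures realize (load D) (C * (m * n * 2 ^ D.freeLines)) fun s =>
      (s.flag = 1 ∧ D.RealizedBy (s.outP n) (s.outQ m)) ∨
        (s.flag = 0 ∧ ¬ ∃ (P : Curve n) (Q : Curve m), D.RealizedBy P Q) := by
  obtain ⟨K1, h1⟩ := prepareSearch_spec
  obtain ⟨K2, h2⟩ := search_spec
  obtain ⟨K3, h3⟩ := writeOutput_spec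
  refine ⟨K1 + (4 * K2 + K3), fun {n m} D hn hm => ?_⟩
  have hd := D.regular_cellData hn hm
  have hle : n * m ≤ m * n * 2 ^ D.freeLines :=
    (Nat.mul_comm n m).le.trans (Nat.le_mul_of_pos_right _ (by positivity))
  simp only [Nat.add_mul]
  refine ((h1 D hn hm).mono (Nat.mul_le_mul_left _ hle) fun s1 _ g1 F1 => ?_).seq
  obtain ⟨p1, w1, f1⟩ := g1
  refine ((h2 _ hd ⟨_, D.slab_iff_white⟩ s1 p1 f1).mono ?_ fun s2 _ g2 F2 => ?_).seq
  -- The factor `4` from the two turns that belong to no inner line is absorbed in the constant.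
  · refine (Nat.mul_le_mul_left K2 (Nat.mul_le_mul_right _ w1)).trans (le_of_eq ?_)
    change K2 * (4 * 2 ^ D.freeLines * (n * m)) = _
    ring
  obtain ⟨r2, g2⟩ := g2
  refine (h3 hn hm s2 r2.n_eq r2.m_eq).mono (Nat.mul_le_mul_left _ hle) fun s3 _ g3 => ?_
  obtain ⟨k1, k2, k3⟩ := g3
  rw [k1]
  refine g2.imp (fun ⟨f, τ, hτ, hb, hr⟩ => ⟨f, ?_⟩) fun ⟨f, hno⟩ => ⟨f, ?_⟩
  -- The first curve is written with the offset added and the second one as it stands in the walk.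
  · refine (D.realizedBy_iff_realizes hn hm hτ (a := s2.real 13 0) (b := 0) (fun i => ?_)
      fun j => ?_).2 (by rwa [sub_zero])
    · rw [k2, (hb i (by change _ ≤ n + m; omega)).2]
    · rw [k3, (hb (n + j) (by change _ ≤ n + m; omega)).2, add_zero]
  · rintro ⟨P, Q, h⟩
    obtain ⟨τ, c, hτ, hc⟩ := D.exists_turns hn hm h
    exact hno τ c (fun l _ => hτ l) hc

end RealRAM

/-- There is a real RAM program that, for every `m × n` diagram `D` with `k` grid lines not meeting
the boundary of the white space, halts after time `O(m n 2 ^ k)` and either outputs curves `P`, `Q`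
in `ℝ` realizing `D`, with flag `1`, or flag `0` if no such curves exist. -/
theorem mainTheorem6 :
    ∃ (prog : RealRAM.Program) (C : ℕ), ∀ (n m : ℕ) (D : InputDiagram n m), 0 < n → 0 < m →
      ∃ (t : ℕ) (s : RealRAM.Memory),
        RealRAM.Runs prog (RealRAM.load D) t s ∧
        t ≤ C * (m * n * 2 ^ D.toDiagram.freeLines) ∧
        ((s.flag = 1 ∧ D.RealizedBy (s.outP n) (s.outQ m)) ∨
          (s.flag = 0 ∧ ¬ ∃ (P : Curve n) (Q : Curve m), D.RealizedBy P Q)) := by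
  obtain ⟨C, hC⟩ := RealRAM.realize_spec
  refine ⟨RealRAM.realize, C, fun n m D hn hm => ?_⟩
  obtain ⟨t, ht, s, hr, h⟩ := hC D hn hm
  exact ⟨t, s, hr, ht, h⟩
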